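/- Let $N\ge 25$, $a_N=\frac{(N-2)^2+4}{2(N-1)(N-2)}$, $b_N=-\frac{4}{N-2}$. For a Riemannian metric $g$ on $\mathbb R^N$ with Ricci tensor $\mathcal R$ and scalar curvature $S_g$ let $$P_g\varphi=\Delta_g^2\varphi-\operatorname{div}_g\big((a_NS_g\,g+b_N\mathcal R)\,d\varphi\big)+\tfrac{N-4}{2}Q_g\varphi ,$$ $$Q_g=-\tfrac{1}{2(N-1)}\Delta_gS_g+\tfrac{N^3-4N^2+16N-16}{8(N-1)^2(N-2)^2}S_g^2-\tfrac{2}{(N-2)^2}|\mathcal R|^2$$ be the Paneitz operator. **The number $\tau$.** For $\tau\in\mathbb R$ let $I=I_{N,\tau}$ be the polynomial $$\begin{aligned}I(\lambda)=&-\tfrac{(N-4)(N+14)\lambda^{20}}{(N-24)(N-22)(N-20)}\big(N^6+42N^5-768N^4-17248N^3+38768N^2-2336N-38400\big)\\ &+\tfrac{270(N-4)\lambda^{18}}{(N-22)(N-20)}\big(N^6+32N^5-612N^4-10768N^3+24672N^2-640N-25600\big)\\ &-\tfrac{(N-4)\lambda^{16}}{(N-20)(N+12)}\big(23047N^6+543484N^5-10985408N^4-146678256N^3+351063488N^2-16180224N-363260160\big)\\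 &+\tfrac{30(N-4)\lambda^{14}}{(N+10)(N+12)}\big(22499N^6+356784N^5-7984044N^4-76228592N^3+193344928N^2-4902016N-209193984\big)\\ &-\tfrac{(N-18)(N-4)\lambda^{12}}{(N+8)(N+10)(N+12)}\big((2\tau+9052921)N^6+(4\tau+84049210)N^5-(384\tau+2265707776)N^4-(1856\tau+14204127072)N^3\\ &\qquad+(4704\tau+40189627120)N^2+(7360\tau-1125216800)N-12800\tau-45033619968\big)\\ &+\tfrac{30(N-18)(N-16)(N-4)\lambda^{10}}{(N+8)(N+10)(N+12)}\big((9\tau+1928800)N^5-(54\tau+3857600)N^4-(864\tau+293177600)N^3\\ &\qquad+(1584\tau+648076800)N^2+(2880\tau+61721600)N-4608\tau-740659200\big)\\ &-\tfrac{2(N-18)(N-16)(N-14)(N-4)\lambda^{8}}{(N+6)(N+8)(N+10)(N+12)}\big((2411\tau+72000000)N^5-(14466\tau+288000000)N^4-(135016\tau+5760000000)N^3\\ &\qquad+(308608\tau+14976000000)N^2+(347184\tau-2304000000)N-694368\tau-13824000000\big)\\ &+\tfrac{24000(N-18)(N-16)(N-14)(N-12)(N-4)(N-2)\tau\lambda^{6}}{(N+6)(N+8)(N+10)(N+12)}\big(N^3-8N^2+16\big)\\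 &-\tfrac{(N-18)(N-16)(N-14)(N-12)(N-10)(N-4)(N-2)^2\tau^2\lambda^{4}}{(N+4)(N+6)(N+8)(N+10)(N+12)}\big(N^2-4N-4\big).\end{aligned}$$ **The data.** Let $f(s)=\tau-12000s+2411s^2-135s^3+s^4$. Let $W=(W_{ikj\ell})$ be a nonzero array of real numbers ($1\le i,k,j,\ell\le N$) with all algebraic properties of a Weyl tensor (antisymmetric in $i,k$ and in $j,\ell$, symmetric under exchange of the two pairs, first Bianchi identity, trace-free), and put $H_{ij}(y)=\sum_{p,q}W_{ipjq}y_py_q$, $\overline H_{ij}(y)=f(|y|^2)H_{ij}(y)$. Let $0<\mu\le1$, $0<\varepsilon\le\rho\le1$, and let $h$ be a smooth trace-free symmetric two-tensor on $\mathbb R^N$ with $h(0)=0$, $h(x)=0$ for $|x|\ge1$, and $h_{ij}(x)=\mu\varepsilon^8f(\varepsilon^{-2}|x|^2)H_{ij}(x)$ for $|x|\le\rho$. Put $g=e^{h}$ and $\tilde g(y)=g(\varepsilon y)$. For $\xi\in\mathbb R^N$, $\lambda>0$ let $$u_{\xi,\lambda}(y)=\gamma_N\Big(\frac{\lambda}{\lambda^2+|y-\xi|^2}\Big)^{\frac{N-4}{2}},\qquad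 \gamma_N=\big[2N(N-2)(N+2)\big]^{\frac{N-4}{8}},$$ (so that $\Delta^2u_{\xi,\lambda}=\frac{N-4}{2}u_{\xi,\lambda}^{(N+4)/(N-4)}$), $Z_0=\partial_\lambda u_{\xi,\lambda}$, $Z_j=\partial_{\xi_j}u_{\xi,\lambda}$ for $1\le j\le N$, and, with $u=u_{\xi,\lambda}$, $$B_{\xi,\lambda}=\sum_{i,j,s}\Big[2\overline H_{ij}\partial_{ijss}u+2(\partial_s\overline H_{ij})\partial_{ijs}u+(\partial_{ss}\overline H_{ij})\partial_{ij}u-\tfrac{b_N}{2}(\partial_{ss}\overline H_{ij})\partial_{ij}u-\tfrac{b_N}{2}(\partial_{jss}\overline H_{ij})\partial_iu\Big].$$ Fix $r_0>0$ and smooth cut-off functions with values in $[0,1]$: $\chi=\chi_\xi$ equal to $1$ for $|y-\xi|\le r_0$ and $0$ for $|y-\xi|\ge r_0+1$, and $\hat\chi$ equal to $1$ for $|y|\le\rho/\varepsilon$ and $0$ for $|y|\ge2\rho/\varepsilon$. Let $R_1=-\mu\varepsilon^{10}\hat\chi B_{\xi,\lambda}$ and $\Lambda=\{(\xi,\lambda):|\xi|\le1,\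 \frac12<\lambda<\frac32\}$. **The corrector.** Let $w=w_{\xi,\lambda}$, $(\xi,\lambda)\in\Lambda$, be of class $C^4$ and satisfy, for some constants $c_i=c_i(\xi,\lambda)$, $$P_{\tilde g}w-\tfrac{N+4}{2}u_{\xi,\lambda}^{\frac{8}{N-4}}w=R_1+\sum_{i=0}^Nc_i\chi Z_i\ \text{ in }\mathbb R^N,\qquad \int_{\mathbb R^N}\chi Z_iw=0\quad(0\le i\le N),$$ in the weighted class determined by $$\sup_{y}\sum_{i=0}^2\frac{(1+|y-\xi|)^{N-14+i}}{\mu\varepsilon^{10}}|\partial^iw(y)|\le C\,\sup_y\frac{(1+|y-\xi|)^{N-10}}{\mu\varepsilon^{10}}|R_1(y)|$$ with a constant $C$ independent of $(\xi,\lambda)\in\Lambda$. Put $\bar w=w/(\mu\varepsilon^{10})$. **The auxiliary function.** With $u=u_{\xi,\lambda}$, all integrals over $\mathbb R^N$ and all indices running from $1$ to $N$, let $$\begin{aligned}F(\xi,\lambda)=&-\int\sum_{i,j,k,\ell}\overline H_{i\ell}\overline H_{j\ell}(\partial_{ikk}u)(\partial_ju)+\int\Big(\sum_{i,j}\overline H_{ij}\partial_{ij}u\Big)^2-\frac{a_N}{4}\int\sum_{i,k,\ell,m}(\partial_\ell\overline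 H_{mk})^2(\partial_iu)^2\\ &-\frac{b_N}{4}\int\sum_{i,j,m,s}(\partial_j\overline H_{ms})(\partial_i\overline H_{sm})(\partial_iu)(\partial_ju)\\ &-\frac{b_N}{2}\int\sum_{i,j,m,s}\Big[\overline H_{ms}\partial_s\overline H_{ij}-\overline H_{si}\partial_s\overline H_{mj}+\overline H_{sj}\partial_i\overline H_{ms}-\overline H_{ms}\partial_i\overline H_{sj}\Big]\partial_m(\partial_iu\,\partial_ju)\\ &+\frac{b_N}{2}\int\sum_{i,j,m,s}\overline H_{is}(\partial_{mm}\overline H_{js})(\partial_iu)(\partial_ju)\\ &+\frac{N-4}{8(N-1)}\int\sum_{i,k,\ell,m}\Big[(\partial_{i\ell}\overline H_{mk})^2+(\partial_\ell\overline H_{mk})(\partial_{ii\ell}\overline H_{mk})\Big]u^2\\ &-\frac{N-4}{4(N-2)^2}\int\sum_{i,j,m,s}(\partial_{mm}\overline H_{ij})(\partial_{ss}\overline H_{ij})u^2+\int B_{\xi,\lambda}\,\bar w_{\xi,\lambda}.\end{aligned}$$ **Claim.** There is a $\tau\in\mathbb R$ with $I_{N,\tau}'(1)=0$ and $I_{N,\tau}''(1)>0$;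 and for every such $\tau$ and all data and $w$ as above, $F$ has a strict local minimum at $(\xi,\lambda)=(0,1)$. -/

import Mathlib

open scoped BigOperators Topology ENNReal NNReal ContDiff

noncomputable section

namespace PaneitzBlowup

/-- The Euclidean space `ℝ^N`. -/
abbrev E (N : ℕ) : Type := EuclideanSpace ℝ (Fin N)

variable {N : ℕ}

/-- The partial derivative `∂_i φ`, as a function on `ℝ^N`. -/
def pd (i : Fin N) (φ : E N → ℝ) : E N → ℝ :=
  fun y => fderiv ℝ φ y (EuclideanSpace.single i 1)

/-! ### Riemannian geometry of a metric on `ℝ^N`, in the standard coordinates -/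

/-- A metric on `ℝ^N`, given by its matrix `(g_ij(x))` at every point. -/
abbrev MetricField (N : ℕ) : Type := E N → Matrix (Fin N) (Fin N) ℝ

/-- The component `g^{ij}` of the inverse metric. -/
def ginv (g : MetricField N) (i j : Fin N) : E N → ℝ := fun x => (g x)⁻¹ i j

/-- The Christoffel symbol `Γ^i_{kl}`. -/
def christoffel (g : MetricField N) (i k l : Fin N) : E N → ℝ := fun x =>
  ∑ m, (1 / 2) * ginv g i m x *
    (pd l (fun z => g z m k) x + pd k (fun z => g z m l) x - pd m (fun z => g z k l) x)

/-- The Ricci tensor `Ric_ij`. -/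
def ricci (g : MetricField N) (i j : Fin N) : E N → ℝ := fun x =>
  (∑ m, pd m (christoffel g m j i) x) - (∑ m, pd j (christoffel g m m i) x)
    + (∑ l, ∑ m, christoffel g m m l x * christoffel g l j i x)
    - (∑ l, ∑ m, christoffel g m j l x * christoffel g l m i x)

/-- The Ricci tensor with both indices raised. -/
def ricciUp (g : MetricField N) (i j : Fin N) : E N → ℝ := fun x =>
  ∑ s, ∑ t, ginv g i s x * ricci g s t x * ginv g t j x

/-- The scalar curvature `S_g`. -/
def scalarCurv (g : MetricField N) : E N → ℝ := fun x =>
  ∑ i, ∑ j, ginv g i j x * ricci g i j x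

/-- The divergence `div_g X` of a vector field `X = (X^i)`. -/
def divg (g : MetricField N) (X : Fin N → E N → ℝ) : E N → ℝ := fun x =>
  (Real.sqrt (g x).det)⁻¹ * ∑ i, pd i (fun z => Real.sqrt (g z).det * X i z) x

/-- The Laplace-Beltrami operator `Δ_g = div_g ∇_g`. -/
def laplacian (g : MetricField N) (φ : E N → ℝ) : E N → ℝ :=
  divg g (fun i x => ∑ j, ginv g i j x * pd j φ x)

/-- The constant `a_N`. -/
def aN (N : ℕ) : ℝ := (((N : ℝ) - 2) ^ 2 + 4) / (2 * ((N : ℝ) - 1) * ((N : ℝ) - 2))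

/-- The constant `b_N`. -/
def bN (N : ℕ) : ℝ := -4 / ((N : ℝ) - 2)

/-- The `Q`-curvature. -/
def qCurv (g : MetricField N) : E N → ℝ := fun x =>
  -1 / (2 * ((N : ℝ) - 1)) * laplacian g (scalarCurv g) x
    + ((N : ℝ) ^ 3 - 4 * (N : ℝ) ^ 2 + 16 * (N : ℝ) - 16)
        / (8 * ((N : ℝ) - 1) ^ 2 * ((N : ℝ) - 2) ^ 2) * scalarCurv g x ^ 2
    - 2 / ((N : ℝ) - 2) ^ 2 * ∑ i, ∑ j, ricciUp g i j x * ricci g i j x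

/-- The Paneitz operator
`P_g φ = Δ_g² φ - div_g ((a_N S_g g + b_N Ric_g) dφ) + (N-4)/2 Q_g φ`. -/
def paneitz (g : MetricField N) (φ : E N → ℝ) : E N → ℝ := fun x =>
  laplacian g (laplacian g φ) x
    - divg g (fun i z => ∑ j,
        (aN N * scalarCurv g z * ginv g i j z + bN N * ricciUp g i j z) * pd j φ z) x
    + ((N : ℝ) - 4) / 2 * qCurv g x * φ x

/-! ### The Weyl-type form, the polynomial `f` and the tensor `H̄` -/

/-- The components `W i k j l` have all the algebraic symmetries of a Weyl tensor. -/
structure IsWeylTensor (W : Fin N → Fin N → Fin N → Fin N → ℝ) : Prop where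
  antisymm_left : ∀ i k j l, W i k j l = -W k i j l
  antisymm_right : ∀ i k j l, W i k j l = -W i k l j
  pair_symm : ∀ i k j l, W i k j l = W j l i k
  bianchi : ∀ i k j l, W i k j l + W i j l k + W i l k j = 0
  trace_free : ∀ k l, ∑ i, W i k i l = 0

/-- `H_ij(y) = ∑_{p,q} W_ipjq y_p y_q`. -/
def Hq (W : Fin N → Fin N → Fin N → Fin N → ℝ) (i j : Fin N) : E N → ℝ := fun y =>
  ∑ p, ∑ q, W i p j q * y p * y q

/-- The quartic `f(s) = τ - 12000 s + 2411 s² - 135 s³ + s⁴`. -/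
def quartic (τ s : ℝ) : ℝ := τ - 12000 * s + 2411 * s ^ 2 - 135 * s ^ 3 + s ^ 4

/-- `H̄_ij(y) = f(|y|²) H_ij(y)`. -/
def Hbar (τ : ℝ) (W : Fin N → Fin N → Fin N → Fin N → ℝ) (i j : Fin N) : E N → ℝ := fun y =>
  quartic τ (‖y‖ ^ 2) * Hq W i j y

/-- The rational function `I(λ)` (a polynomial in `λ`), whose derivatives at `1` select `τ`. -/
def Ipoly (N : ℕ) (τ lam : ℝ) : ℝ :=
  let n : ℝ := N;
  -((n - 4) * (n + 14) * lam ^ 20 / ((n - 24) * (n - 22) * (n - 20))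
      * (n ^ 6 + 42 * n ^ 5 - 768 * n ^ 4 - 17248 * n ^ 3 + 38768 * n ^ 2 - 2336 * n - 38400))
  + 270 * (n - 4) * lam ^ 18 / ((n - 22) * (n - 20))
      * (n ^ 6 + 32 * n ^ 5 - 612 * n ^ 4 - 10768 * n ^ 3 + 24672 * n ^ 2 - 640 * n - 25600)
  - (n - 4) * lam ^ 16 / ((n - 20) * (n + 12))
      * (23047 * n ^ 6 + 543484 * n ^ 5 - 10985408 * n ^ 4 - 146678256 * n ^ 3
          + 351063488 * n ^ 2 - 16180224 * n - 363260160)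
  + 30 * (n - 4) * lam ^ 14 / ((n + 10) * (n + 12))
      * (22499 * n ^ 6 + 356784 * n ^ 5 - 7984044 * n ^ 4 - 76228592 * n ^ 3
          + 193344928 * n ^ 2 - 4902016 * n - 209193984)
  - (n - 18) * (n - 4) * lam ^ 12 / ((n + 8) * (n + 10) * (n + 12))
      * ((2 * τ + 9052921) * n ^ 6 + (4 * τ + 84049210) * n ^ 5
          - (384 * τ + 2265707776) * n ^ 4 - (1856 * τ + 14204127072) * n ^ 3
          + (4704 * τ + 40189627120) * n ^ 2 + (7360 * τ - 1125216800) * n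
          - 12800 * τ - 45033619968)
  + 30 * (n - 18) * (n - 16) * (n - 4) * lam ^ 10 / ((n + 8) * (n + 10) * (n + 12))
      * ((9 * τ + 1928800) * n ^ 5 - (54 * τ + 3857600) * n ^ 4
          - (864 * τ + 293177600) * n ^ 3 + (1584 * τ + 648076800) * n ^ 2
          + (2880 * τ + 61721600) * n - 4608 * τ - 740659200)
  - 2 * (n - 18) * (n - 16) * (n - 14) * (n - 4) * lam ^ 8
        / ((n + 6) * (n + 8) * (n + 10) * (n + 12))
      * ((2411 * τ + 72000000) * n ^ 5 - (14466 * τ + 288000000) * n ^ 4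
          - (135016 * τ + 5760000000) * n ^ 3 + (308608 * τ + 14976000000) * n ^ 2
          + (347184 * τ - 2304000000) * n - 694368 * τ - 13824000000)
  + 24000 * (n - 18) * (n - 16) * (n - 14) * (n - 12) * (n - 4) * (n - 2) * τ * lam ^ 6
        / ((n + 6) * (n + 8) * (n + 10) * (n + 12))
      * (n ^ 3 - 8 * n ^ 2 + 16)
  - (n - 18) * (n - 16) * (n - 14) * (n - 12) * (n - 10) * (n - 4) * (n - 2) ^ 2
        * τ ^ 2 * lam ^ 4
        / ((n + 4) * (n + 6) * (n + 8) * (n + 10) * (n + 12))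
      * (n ^ 2 - 4 * n - 4)

/-- The choice of `τ`: `I'(1) = 0` and `I''(1) > 0`. -/
def IsChosenTau (N : ℕ) (τ : ℝ) : Prop :=
  deriv (Ipoly N τ) 1 = 0 ∧ 0 < deriv (deriv (Ipoly N τ)) 1

/-! ### The bubbles -/

/-- The normalizing constant `γ_N`, for which the bubbles solve `Δ² u = (N-4)/2 u^((N+4)/(N-4))`. -/
def gammaN (N : ℕ) : ℝ :=
  (2 * (N : ℝ) * ((N : ℝ) - 2) * ((N : ℝ) + 2)) ^ (((N : ℝ) - 4) / 8)

/-- The bubble `γ_N (λ / (λ² + |y - ξ|²))^((N-4)/2)`. -/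
def bubble (ξ : E N) (lam : ℝ) : E N → ℝ := fun y =>
  gammaN N * (lam / (lam ^ 2 + ‖y - ξ‖ ^ 2)) ^ (((N : ℝ) - 4) / 2)

/-- `Z_0`, the derivative of the bubble in `λ`. -/
def Z0 (ξ : E N) (lam : ℝ) : E N → ℝ := fun y => deriv (fun l => bubble ξ l y) lam

/-- `Z_j`, the derivative of the bubble in `ξ_j`. -/
def Zj (ξ : E N) (lam : ℝ) (j : Fin N) : E N → ℝ := fun y =>
  pd j (fun x => bubble x lam y) ξ

/-- The configuration set `Λ`. -/
def configSet (N : ℕ) : Set (E N × ℝ) :=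
  {p | ‖p.1‖ ≤ 1 ∧ 1 / 2 < p.2 ∧ p.2 < 3 / 2}

/-! ### The linear first-order term and the corrector `w` -/

/-- The bracket
`∑ [2 H̄_ij ∂_ijss u + 2 ∂_s H̄_ij ∂_ijs u + ∂_ss H̄_ij ∂_ij u
  - (b_N/2) ∂_ss H̄_ij ∂_ij u - (b_N/2) ∂_jss H̄_ij ∂_i u]`, where `u` is the bubble. -/
def bracket (τ : ℝ) (W : Fin N → Fin N → Fin N → Fin N → ℝ) (ξ : E N) (lam : ℝ) :
    E N → ℝ := fun y =>
  ∑ i, ∑ j, ∑ s,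
    (2 * Hbar τ W i j y * pd i (pd j (pd s (pd s (bubble ξ lam)))) y
      + 2 * pd s (Hbar τ W i j) y * pd i (pd j (pd s (bubble ξ lam))) y
      + pd s (pd s (Hbar τ W i j)) y * pd i (pd j (bubble ξ lam)) y
      - bN N / 2 * pd s (pd s (Hbar τ W i j)) y * pd i (pd j (bubble ξ lam)) y
      - bN N / 2 * pd j (pd s (pd s (Hbar τ W i j))) y * pd i (bubble ξ lam) y)

/-- The geometric data: a smooth trace-free symmetric two-tensor `h` on `ℝ^N` which vanishes
at `0` and outside the unit ball and has the prescribed form on the ball of radius `ρ`. -/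
structure IsBackground (τ : ℝ) (W : Fin N → Fin N → Fin N → Fin N → ℝ)
    (h : E N → Matrix (Fin N) (Fin N) ℝ) (ρ μ ε : ℝ) : Prop where
  mu_pos : 0 < μ
  mu_le : μ ≤ 1
  eps_pos : 0 < ε
  eps_le : ε ≤ ρ
  rho_le : ρ ≤ 1
  smooth : ∀ i j, ContDiff ℝ ∞ (fun x => h x i j)
  symm : ∀ x, (h x).IsSymm
  trace_free : ∀ x, (h x).trace = 0
  zero : h 0 = 0
  support : ∀ x, 1 ≤ ‖x‖ → h x = 0
  form : ∀ x, ‖x‖ ≤ ρ → ∀ i j,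
    h x i j = μ * ε ^ 8 * quartic τ (ε⁻¹ ^ 2 * ‖x‖ ^ 2) * Hq W i j x

/-- The rescaled metric `g̃(y) = g(ε y)`, where `g = exp h`. -/
def scaledMetric (h : E N → Matrix (Fin N) (Fin N) ℝ) (ε : ℝ) : MetricField N := fun y =>
  NormedSpace.exp (h (ε • y))

/-- The cut-off functions: for every `ξ`, `χ ξ` is one on the ball of radius `r₀` about `ξ` and
vanishes at distance at least `r₀ + 1` from `ξ`; `χhat` is one for `|y| ≤ ρ/ε` and zero for
`|y| ≥ 2ρ/ε`. -/
structure IsCutoff (r₀ : ℝ) (χ : E N → E N → ℝ) (χhat : E N → ℝ) (ρ ε : ℝ) : Prop where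
  radius_pos : 0 < r₀
  smooth : ∀ ξ, ContDiff ℝ ∞ (χ ξ)
  mem_Icc : ∀ ξ y, χ ξ y ∈ Set.Icc (0 : ℝ) 1
  eq_one : ∀ ξ y, ‖y - ξ‖ ≤ r₀ → χ ξ y = 1
  eq_zero : ∀ ξ y, r₀ + 1 ≤ ‖y - ξ‖ → χ ξ y = 0
  hat_smooth : ContDiff ℝ ∞ χhat
  hat_mem_Icc : ∀ y, χhat y ∈ Set.Icc (0 : ℝ) 1
  hat_eq_one : ∀ y, ‖y‖ ≤ ρ / ε → χhat y = 1
  hat_eq_zero : ∀ y, 2 * ρ / ε ≤ ‖y‖ → χhat y = 0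

/-- The right-hand side `R₁` of the corrector equation. -/
def R1 (τ : ℝ) (W : Fin N → Fin N → Fin N → Fin N → ℝ) (χhat : E N → ℝ) (μ ε : ℝ)
    (ξ : E N) (lam : ℝ) : E N → ℝ := fun y =>
  -(μ * ε ^ 10 * χhat y * bracket τ W ξ lam y)

/-- The weighted norm of the solution:
`sup_y ∑_{i ≤ 2} (1+|y-ξ|)^(N-14+i) / (μ ε^10) |∂^i φ(y)|`. -/
def normStar (μ ε : ℝ) (ξ : E N) (φ : E N → ℝ) : ℝ≥0∞ :=
  ⨆ y, ENNReal.ofReal (∑ i ∈ Finset.range 3,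
    (1 + ‖y - ξ‖) ^ ((N : ℝ) - 14 + i) / (μ * ε ^ 10) * ‖iteratedFDeriv ℝ i φ y‖)

/-- The weighted norm of the right-hand side:
`sup_y (1+|y-ξ|)^(N-10) / (μ ε^10) |ζ(y)|`. -/
def normStarStar (μ ε : ℝ) (ξ : E N) (ζ : E N → ℝ) : ℝ≥0∞ :=
  ⨆ y, ENNReal.ofReal ((1 + ‖y - ξ‖) ^ ((N : ℝ) - 10) / (μ * ε ^ 10) * |ζ y|)

/-- `φ` solves the corrector equation with parameters `(ξ, λ)`:
`P_g̃ φ - (N+4)/2 u^(8/(N-4)) φ = R₁ + ∑_i c_i χ Z_i` for some constants `c_0, …, c_N`,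
and `∫ χ Z_i φ = 0` for all `i`. -/
structure SolvesCorrectorEq (τ : ℝ) (W : Fin N → Fin N → Fin N → Fin N → ℝ)
    (h : E N → Matrix (Fin N) (Fin N) ℝ) (μ ε : ℝ) (χ : E N → E N → ℝ) (χhat : E N → ℝ)
    (ξ : E N) (lam : ℝ) (φ : E N → ℝ) : Prop where
  contDiff : ContDiff ℝ 4 φ
  equation : ∃ (c₀ : ℝ) (c : Fin N → ℝ), ∀ y,
    paneitz (scaledMetric h ε) φ y
        - ((N : ℝ) + 4) / 2 * bubble ξ lam y ^ (8 / ((N : ℝ) - 4)) * φ y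
      = R1 τ W χhat μ ε ξ lam y
        + (c₀ * χ ξ y * Z0 ξ lam y + ∑ j, c j * χ ξ y * Zj ξ lam j y)
  orth_zero : ∫ y, χ ξ y * Z0 ξ lam y * φ y = 0
  orth : ∀ j, ∫ y, χ ξ y * Zj ξ lam j y * φ y = 0

/-- The corrector `w = w_{(ξ,λ)}`, `(ξ,λ) ∈ Λ`: the solution of the corrector equation in the
weighted class determined by `‖w‖ ≤ C ‖R₁‖`, with `C` independent of `(ξ,λ) ∈ Λ`. -/
def IsCorrector (τ : ℝ) (W : Fin N → Fin N → Fin N → Fin N → ℝ)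
    (h : E N → Matrix (Fin N) (Fin N) ℝ) (μ ε : ℝ) (χ : E N → E N → ℝ) (χhat : E N → ℝ)
    (w : E N → ℝ → E N → ℝ) : Prop :=
  (∀ p ∈ configSet N, SolvesCorrectorEq τ W h μ ε χ χhat p.1 p.2 (w p.1 p.2)) ∧
  ∃ C : ℝ≥0, ∀ p ∈ configSet N,
    normStar μ ε p.1 (w p.1 p.2)
      ≤ C * normStarStar μ ε p.1 (R1 τ W χhat μ ε p.1 p.2)

/-! ### The auxiliary function -/

/-- The auxiliary function `F(ξ,λ)`; here `w̄ = w / (μ ε^10)`. -/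
def auxF (τ : ℝ) (W : Fin N → Fin N → Fin N → Fin N → ℝ) (μ ε : ℝ)
    (w : E N → ℝ → E N → ℝ) (p : E N × ℝ) : ℝ :=
  let u : E N → ℝ := bubble p.1 p.2
  let H : Fin N → Fin N → E N → ℝ := Hbar τ W
  let n : ℝ := N;
  -(∫ y, ∑ i, ∑ j, ∑ k, ∑ l, H i l y * H j l y * pd i (pd k (pd k u)) y * pd j u y)
  + (∫ y, (∑ i, ∑ j, H i j y * pd i (pd j u) y) ^ 2)
  - aN N / 4 * (∫ y, ∑ i, ∑ k, ∑ l, ∑ m, pd l (H m k) y ^ 2 * pd i u y ^ 2)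
  - bN N / 4 * (∫ y, ∑ i, ∑ j, ∑ m, ∑ s,
      pd j (H m s) y * pd i (H s m) y * pd i u y * pd j u y)
  - bN N / 2 * (∫ y, ∑ i, ∑ j, ∑ m, ∑ s,
      (H m s y * pd s (H i j) y - H s i y * pd s (H m j) y
        + H s j y * pd i (H m s) y - H m s y * pd i (H s j) y)
        * pd m (fun z => pd i u z * pd j u z) y)
  + bN N / 2 * (∫ y, ∑ i, ∑ j, ∑ m, ∑ s,
      H i s y * pd m (pd m (H j s)) y * pd i u y * pd j u y)
  + (n - 4) / (8 * (n - 1)) * (∫ y, ∑ i, ∑ k, ∑ l, ∑ m,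
      (pd i (pd l (H m k)) y ^ 2 + pd l (H m k) y * pd i (pd i (pd l (H m k))) y) * u y ^ 2)
  - (n - 4) / (4 * (n - 2) ^ 2) * (∫ y, ∑ i, ∑ j, ∑ m, ∑ s,
      pd m (pd m (H i j)) y * pd s (pd s (H i j)) y * u y ^ 2)
  + (∫ y, bracket τ W p.1 p.2 y * (w p.1 p.2 y / (μ * ε ^ 10)))

end PaneitzBlowup

end

/-! Every explicit term of F, apart from the square of ∑ H̄_ij ∂_ij u and the term with H̄ ∂H̄ ∂(∂u
∂u), becomes an integral of a polynomial against a power of λ² + |y - ξ|². Repeated integration by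
parts turns such a moment into Pizzetti's finite sum over m of constants times powers of λ times
(Δ^m P)(ξ) (`pizzetti`, `moment_trans`). The Weyl symmetries make each H_ij a harmonic quadratic
form, with H trace-free, divergence-free and annihilated by y. So the polynomials that occur are
radial factors times ∑ H_ij², ∑ |∇H_ij|² or a constant, or else quadratic forms in ξ built from H_il
H_jl. Splitting them into powers of |y|² times harmonics of degree 0, 2 and 4 gives, near (0, 1), an
expansion a(λ) + b|ξ|² + c G(ξ) + o(|ξ|²) with G(ξ) = ∑ |∇H_ij(ξ)|² ≥ 0 (`hasExpansion_reducedF`).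
The dependence on λ is exact in a, and the error is measured by |ξ|² alone, so the two directions
decouple.

In the direction of λ, a is a positive multiple of I (`sum_leadFactor`), which has a strict minimum
at 1 by the choice of τ. In the direction of ξ one needs b > 0 and c ≥ 0. All moments |y|^(2j) with
a given exponent are polynomial multiples of one positive number (`exists_radialMoment_eq`), so b
and c have the signs of polynomials in N and τ. In the variables N - 25 and τ - 16900 these have
positive coefficients only (`hessNumB_sum`, `hessNumC_sum`).

The remaining terms do no harm. The cubic term vanishes pointwise (`sum_cubic_eq_zero`). The square
is nonnegative and vanishes at ξ = 0. As y annihilates H, each contraction of H̄ with y - ξ is one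
with -ξ; hence B is O(|ξ|²) with decay (`bracket_bound`), the weighted estimate makes the corrector
O(|ξ|²), and their pairing is O(|ξ|⁴) (`corrector_bound`).

For τ: up to positive factors, I'(1) is a concave quadratic in τ, positive at 16900 and negative at
18200, while I''(1) - 3I'(1) is affine and increasing in τ and positive at 16900. This gives
existence. Conversely, every admissible τ is at least 16900: below `tauLower` the second quantity is
negative, and between `tauLower` and 16900 concavity keeps the first one positive
(`le_of_isChosenTau`). -/

noncomputable section

namespace PaneitzBlowup

open MvPolynomial MeasureTheory

variable {N : ℕ}

/-! ### Polynomial functions on `ℝ^N` -/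

/-- Polynomials in `N` real variables. -/
abbrev Poly (N : ℕ) : Type := MvPolynomial (Fin N) ℝ

/-- The function on `ℝ^N` given by a polynomial. -/
def polyFun (P : Poly N) (y : E N) : ℝ := eval (fun i => y i) P

@[simp] lemma polyFun_add (P Q : Poly N) (y : E N) :
    polyFun (P + Q) y = polyFun P y + polyFun Q y := by simp [polyFun]

@[simp] lemma polyFun_sub (P Q : Poly N) (y : E N) :
    polyFun (P - Q) y = polyFun P y - polyFun Q y := by simp [polyFun]

@[simp] lemma polyFun_mul (P Q : Poly N) (y : E N) :
    polyFun (P * Q) y = polyFun P y * polyFun Q y := by simp [polyFun]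

@[simp] lemma polyFun_pow (P : Poly N) (k : ℕ) (y : E N) :
    polyFun (P ^ k) y = polyFun P y ^ k := by simp [polyFun]

@[simp] lemma polyFun_sum {ι : Type*} (s : Finset ι) (P : ι → Poly N) (y : E N) :
    polyFun (∑ i ∈ s, P i) y = ∑ i ∈ s, polyFun (P i) y := by simp [polyFun]

@[simp] lemma polyFun_C (c : ℝ) (y : E N) : polyFun (C c) y = c := by simp [polyFun]

@[simp] lemma polyFun_X (i : Fin N) (y : E N) : polyFun (X i) y = y i := by simp [polyFun]

@[simp] lemma polyFun_zero (y : E N) : polyFun (0 : Poly N) y = 0 := by simp [polyFun]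

@[simp] lemma polyFun_one (y : E N) : polyFun (1 : Poly N) y = 1 := by simp [polyFun]

@[simp] lemma polyFun_two (y : E N) : polyFun (2 : Poly N) y = 2 := by simp [polyFun]

lemma contDiff_coord (j : Fin N) {n : WithTop ℕ∞} : ContDiff ℝ n (fun y : E N => y j) :=
  (EuclideanSpace.proj (𝕜 := ℝ) j : E N →L[ℝ] ℝ).contDiff

lemma contDiff_polyFun (P : Poly N) {n : WithTop ℕ∞} : ContDiff ℝ n (polyFun P) := by
  induction P using MvPolynomial.induction_on with
  | C a =>
    have : polyFun (C a : Poly N) = fun _ => a := by funext; simp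
    exact this ▸ contDiff_const
  | add p q hp hq =>
    have : polyFun (p + q) = fun y => polyFun p y + polyFun q y := by funext; simp
    exact this ▸ hp.add hq
  | mul_X p i hp =>
    have : polyFun (p * X i) = fun y => polyFun p y * y i := by funext; simp
    exact this ▸ hp.mul (contDiff_coord i)

lemma continuous_polyFun (P : Poly N) : Continuous (polyFun P) :=
  (contDiff_polyFun P (n := 0)).continuous

lemma differentiable_polyFun (P : Poly N) : Differentiable ℝ (polyFun P) :=
  (contDiff_polyFun P (n := 1)).differentiable (by simp)

/-! ### Partial derivatives -/

lemma pd_const (i : Fin N) (c : ℝ) : pd i (fun _ : E N => c) = fun _ => 0 := by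
  funext y; simp [pd]

lemma pd_add {f g : E N → ℝ} (i : Fin N) {y : E N} (hf : DifferentiableAt ℝ f y)
    (hg : DifferentiableAt ℝ g y) : pd i (fun z => f z + g z) y = pd i f y + pd i g y := by
  simp only [pd]
  rw [fderiv_fun_add hf hg]; simp

lemma pd_mul {f g : E N → ℝ} (i : Fin N) {y : E N} (hf : DifferentiableAt ℝ f y)
    (hg : DifferentiableAt ℝ g y) :
    pd i (fun z => f z * g z) y = pd i f y * g y + f y * pd i g y := by
  simp only [pd]
  rw [fderiv_fun_mul hf hg]; simp; ring

lemma pd_const_mul {f : E N → ℝ} (i : Fin N) {y : E N} (c : ℝ) (hf : DifferentiableAt ℝ f y) :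
    pd i (fun z => c * f z) y = c * pd i f y := by
  simp only [pd]
  rw [fderiv_const_mul hf]; simp

lemma pd_coord (i j : Fin N) : pd i (fun y : E N => y j) = fun _ => if i = j then 1 else 0 := by
  funext y
  have : HasFDerivAt (fun y : E N => y j) (EuclideanSpace.proj (𝕜 := ℝ) j : E N →L[ℝ] ℝ) y :=
    (EuclideanSpace.proj (𝕜 := ℝ) j : E N →L[ℝ] ℝ).hasFDerivAt
  simp only [pd, this.fderiv]
  simp [eq_comm]

lemma differentiable_coord (j : Fin N) : Differentiable ℝ (fun y : E N => y j) :=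
  (contDiff_coord j (n := 1)).differentiable (by simp)

@[simp] lemma pd_polyFun (i : Fin N) (P : Poly N) :
    pd i (polyFun P) = polyFun (pderiv i P) := by
  funext y
  induction P using MvPolynomial.induction_on with
  | C a =>
    have : polyFun (C a : Poly N) = fun _ => a := by funext; simp
    rw [this, pd_const]; simp
  | add p q hp hq =>
    have : polyFun (p + q) = fun y => polyFun p y + polyFun q y := by funext; simp
    rw [this, pd_add i (differentiable_polyFun p y) (differentiable_polyFun q y), hp, hq]; simp
  | mul_X p j hp =>
    have : polyFun (p * X j) = fun y => polyFun p y * y j := by funext; simp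
    rw [this, pd_mul i (differentiable_polyFun p y) (differentiable_coord j y), hp, pd_coord]
    simp only [Derivation.leibniz, pderiv_X, Pi.single_apply, smul_eq_mul, polyFun_add,
      polyFun_mul, polyFun_X]
    by_cases h : i = j
    · simp [h]; ring
    · simp [h, Ne.symm h]; ring

/-! ### Degrees, growth and translation -/

lemma totalDegree_pderiv_le (i : Fin N) (P : Poly N) :
    (pderiv i P).totalDegree ≤ P.totalDegree - 1 := by
  rw [P.as_sum, map_sum]
  refine totalDegree_finsetSum_le fun v hv => ?_
  rw [pderiv_monomial, ← P.as_sum]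
  have hP := le_totalDegree hv
  by_cases h0 : v i = 0
  · simp [h0]
  refine (totalDegree_monomial_le _ _).trans ?_
  have h1 : (v - Finsupp.single i 1).sum (fun _ e => e) + 1 = v.sum fun _ e => e := by
    have : v = (v - Finsupp.single i 1) + Finsupp.single i 1 := by
      rw [tsub_add_cancel_of_le]
      simpa [Finsupp.single_le_iff] using Nat.one_le_iff_ne_zero.2 h0
    conv_rhs => rw [this, Finsupp.sum_add_index' (by simp) (by simp)]
    simp
  simp only [Function.id_def]
  omega

/-- Since |y_i| ≤ 1 + |y|, a monomial of degree k is at most (1 + |y|)^k, and the base is at least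
one. This growth exponent decides which moments converge. -/
lemma polyFun_growth (P : Poly N) :
    ∃ K, 0 ≤ K ∧ ∀ y : E N, |polyFun P y| ≤ K * (1 + ‖y‖) ^ P.totalDegree := by
  refine ⟨∑ v ∈ P.support, |coeff v P|, Finset.sum_nonneg fun _ _ => abs_nonneg _, fun y => ?_⟩
  have h : polyFun P y = ∑ v ∈ P.support, coeff v P * v.prod fun i k => y i ^ k := by
    rw [polyFun, eval_eq]; rfl
  rw [h, Finset.sum_mul]
  refine (Finset.abs_sum_le_sum_abs _ _).trans (Finset.sum_le_sum fun v hv => ?_)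
  rw [abs_mul]
  gcongr
  calc |v.prod fun i k => y i ^ k| ≤ v.prod fun _ k => (1 + ‖y‖) ^ k := by
        simp only [Finsupp.prod, Finset.abs_prod, abs_pow]
        refine Finset.prod_le_prod (fun _ _ => by positivity) fun i _ => ?_
        gcongr
        have := PiLp.norm_apply_le y i
        rw [Real.norm_eq_abs] at this
        linarith
    _ = (1 + ‖y‖) ^ (v.sum fun _ k => k) := by
        simp [Finsupp.prod, Finsupp.sum, Finset.prod_pow_eq_pow_sum]
    _ ≤ _ := pow_le_pow_right₀ (by linarith [norm_nonneg y]) (le_totalDegree hv)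

/-- Translation of a polynomial by `ξ`. -/
def trans (ξ : E N) : Poly N →ₐ[ℝ] Poly N := aeval fun i => X i + C (ξ i)

@[simp] lemma trans_X (ξ : E N) (i : Fin N) : trans ξ (X i) = X i + C (ξ i) := by simp [trans]

@[simp] lemma trans_C (ξ : E N) (c : ℝ) : trans ξ (C c) = C c := by
  simp [trans, algebraMap_eq]

@[simp] lemma polyFun_trans (ξ : E N) (P : Poly N) (z : E N) :
    polyFun (trans ξ P) z = polyFun P (z + ξ) := by
  induction P using MvPolynomial.induction_on with
  | C a => simp
  | add p q hp hq => simp [hp, hq]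
  | mul_X p i hp => simp [hp]

lemma pderiv_trans (ξ : E N) (i : Fin N) (P : Poly N) :
    pderiv i (trans ξ P) = trans ξ (pderiv i P) := by
  induction P using MvPolynomial.induction_on with
  | C a => simp
  | add p q hp hq => simp [hp, hq]
  | mul_X p j hp =>
    simp [hp, pderiv_X, Pi.single_apply]
    split_ifs <;> simp

lemma totalDegree_trans_le (ξ : E N) (P : Poly N) :
    (trans ξ P).totalDegree ≤ P.totalDegree := by
  have hX : ∀ i : Fin N, (X i + C (ξ i) : Poly N).totalDegree ≤ 1 := fun i =>
    (totalDegree_add _ _).trans (by simp)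
  conv_lhs => rw [P.as_sum, map_sum]
  refine totalDegree_finsetSum_le fun v hv => ?_
  rw [monomial_eq, map_mul, trans_C, Finsupp.prod, map_prod]
  refine (totalDegree_mul _ _).trans ?_
  rw [totalDegree_C, zero_add]
  refine (totalDegree_finsetProd _ _).trans (le_trans ?_ (le_totalDegree hv))
  refine Finset.sum_le_sum fun i _ => ?_
  rw [map_pow, trans_X]
  refine (totalDegree_pow _ _).trans ?_
  nlinarith [hX i]

/-- The Laplacian of a polynomial. -/
def lap : Poly N →ₗ[ℝ] Poly N :=
  ∑ i, (pderiv i).toLinearMap ∘ₗ (pderiv i).toLinearMap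

lemma lap_apply (P : Poly N) : lap P = ∑ i, pderiv i (pderiv i P) := by simp [lap]

lemma lap_trans (ξ : E N) (P : Poly N) : lap (trans ξ P) = trans ξ (lap P) := by
  simp [lap_apply, pderiv_trans]

lemma lap_iterate_trans (ξ : E N) (P : Poly N) (m : ℕ) :
    lap^[m] (trans ξ P) = trans ξ (lap^[m] P) := by
  induction m generalizing P with
  | zero => rfl
  | succ m ih => simp [lap_trans, ih]

end PaneitzBlowup
end

noncomputable section

namespace PaneitzBlowup

open MvPolynomial MeasureTheory

variable {N : ℕ}

/-! ### Moments of polynomials against powers of `λ² + |z|²` -/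

/-- The weight `(λ² + |z|²)^(-s)`. -/
def wt (lam s : ℝ) (z : E N) : ℝ := (lam ^ 2 + ‖z‖ ^ 2) ^ (-s)

lemma wt_base_pos {lam : ℝ} (hl : 0 < lam) (z : E N) : 0 < lam ^ 2 + ‖z‖ ^ 2 := by positivity

lemma wt_pos {lam : ℝ} (hl : 0 < lam) (s : ℝ) (z : E N) : 0 < wt lam s z :=
  Real.rpow_pos_of_pos (wt_base_pos hl z) _

lemma wt_add {lam : ℝ} (hl : 0 < lam) (s t : ℝ) (z : E N) :
    wt lam (s + t) z = wt lam s z * wt lam t z := by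
  simp only [wt]
  rw [neg_add, Real.rpow_add (wt_base_pos hl z)]

lemma base_mul_wt {lam : ℝ} (hl : 0 < lam) (s : ℝ) (z : E N) :
    (lam ^ 2 + ‖z‖ ^ 2) * wt lam (s + 1) z = wt lam s z := by
  rw [wt_add hl]
  simp only [wt, Real.rpow_neg_one]
  field_simp [(wt_base_pos hl z).ne']

lemma contDiff_wt {lam : ℝ} (hl : 0 < lam) (s : ℝ) (ξ : E N) {n : WithTop ℕ∞} :
    ContDiff ℝ n (fun y : E N => wt lam s (y - ξ)) := by
  unfold wt
  refine ContDiff.rpow_const_of_ne ?_ fun y => (wt_base_pos hl _).ne'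
  exact contDiff_const.add ((contDiff_id.sub contDiff_const).norm_sq ℝ)

lemma differentiable_wt {lam : ℝ} (hl : 0 < lam) (s : ℝ) (ξ : E N) :
    Differentiable ℝ (fun y : E N => wt lam s (y - ξ)) :=
  (contDiff_wt hl s ξ (n := 1)).differentiable (by simp)

lemma continuous_wt {lam : ℝ} (hl : 0 < lam) (s : ℝ) : Continuous (wt lam s : E N → ℝ) := by
  simpa using (contDiff_wt hl s (0 : E N) (n := 0)).continuous

lemma pd_wt {lam : ℝ} (hl : 0 < lam) (s : ℝ) (ξ : E N) (i : Fin N) :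
    pd i (fun y : E N => wt lam s (y - ξ)) =
      fun y => -(2 * s) * (y i - ξ i) * wt lam (s + 1) (y - ξ) := by
  funext y
  have h1 : HasFDerivAt (fun y : E N => lam ^ 2 + ‖y - ξ‖ ^ 2) _ y :=
    (((hasFDerivAt_id y).sub_const ξ).norm_sq).const_add (lam ^ 2)
  have h2 := h1.rpow_const (p := -s) (Or.inl (wt_base_pos hl (y - ξ)).ne')
  simp only [pd, wt]
  rw [h2.fderiv]
  simp [EuclideanSpace.inner_single_right]
  rw [show -s - 1 = -1 + -s by ring]
  ring

/-- Bound of the weight by a power of `1 + |z|`, uniform for `λ ≥ c`. -/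
lemma wt_le {c : ℝ} (hc : 0 < c) (hc1 : c ≤ 1) {s : ℝ} (hs : 0 ≤ s) {lam : ℝ} (hl : c ≤ lam)
    (z : E N) : wt lam s z ≤ (2 / c ^ 2) ^ s * (1 + ‖z‖) ^ (-(2 * s)) := by
  have hz := norm_nonneg z
  -- Follows from (1 + |z|)² ≤ 2(1 + |z|²) together with c ≤ 1 and c ≤ λ.
  have h1 : (c ^ 2 / 2) * (1 + ‖z‖) ^ 2 ≤ lam ^ 2 + ‖z‖ ^ 2 := by
    have h2 : c ^ 2 ≤ lam ^ 2 := by gcongr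
    have h3 : c ^ 2 ≤ 1 := pow_le_one₀ hc.le hc1
    nlinarith [sq_nonneg (1 - ‖z‖), mul_nonneg (sub_nonneg.2 h3) (sq_nonneg ‖z‖),
      mul_nonneg (sq_nonneg c) (sq_nonneg (1 - ‖z‖))]
  calc wt lam s z ≤ ((c ^ 2 / 2) * (1 + ‖z‖) ^ 2) ^ (-s) :=
        Real.rpow_le_rpow_of_nonpos (by positivity) h1 (by linarith)
    _ = _ := by
        rw [Real.mul_rpow (by positivity) (by positivity), Real.rpow_neg (by positivity),
          ← Real.inv_rpow (by positivity), ← Real.rpow_natCast (1 + ‖z‖) 2, ← Real.rpow_mul (by positivity)]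
        congr 2
        · rw [inv_div]
        · push_cast; ring

lemma integrable_one_add_norm_rpow {r : ℝ} (h : (N : ℝ) < r) :
    Integrable (fun z : E N => (1 + ‖z‖) ^ (-r)) :=
  integrable_one_add_norm (by simpa using h)

lemma integrable_mul_wt {f : E N → ℝ} (hf : AEStronglyMeasurable f volume) {K : ℝ} {d : ℕ}
    (hK : ∀ z, |f z| ≤ K * (1 + ‖z‖) ^ d) {lam s : ℝ} (hl : 0 < lam) (hs : (N : ℝ) + d < 2 * s) :
    Integrable (fun z => f z * wt lam s z) := by
  have hs0 : 0 ≤ s := by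
    have : (0 : ℝ) ≤ N := by positivity
    have : (0 : ℝ) ≤ d := by positivity
    linarith
  -- `wt_le` wants a lower bound for λ that is at most one.
  set c := min lam 1
  have hc : 0 < c := lt_min hl one_pos
  refine ((integrable_one_add_norm_rpow (N := N) (r := 2 * s - d) (by linarith)).const_mul
    (K * (2 / c ^ 2) ^ s)).mono' (hf.mul (continuous_wt hl s).aestronglyMeasurable) ?_
  refine Filter.Eventually.of_forall fun z => ?_
  rw [norm_mul, Real.norm_eq_abs, Real.norm_eq_abs, abs_of_pos (wt_pos hl s z)]
  have h1 := wt_le hc (min_le_right _ _) hs0 (min_le_left lam 1) z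
  have hz := norm_nonneg z
  calc |f z| * wt lam s z
      ≤ (K * (1 + ‖z‖) ^ d) * ((2 / c ^ 2) ^ s * (1 + ‖z‖) ^ (-(2 * s))) := by
        exact mul_le_mul (hK z) h1 (wt_pos hl s z).le ((abs_nonneg _).trans (hK z))
    _ = K * (2 / c ^ 2) ^ s * ((1 + ‖z‖) ^ (d : ℝ) * (1 + ‖z‖) ^ (-(2 * s))) := by
        rw [Real.rpow_natCast]; ring
    _ = _ := by rw [← Real.rpow_add (by linarith)]; congr 2; ring

lemma integrable_polyFun_mul_wt (P : Poly N) {lam s : ℝ} (hl : 0 < lam)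
    (hs : (N : ℝ) + P.totalDegree < 2 * s) : Integrable (fun z => polyFun P z * wt lam s z) := by
  obtain ⟨K, -, hK⟩ := polyFun_growth P
  exact integrable_mul_wt (continuous_polyFun P).aestronglyMeasurable hK hl hs

/-- The moment `∫ P(z) (λ² + |z|²)^(-s) dz`. -/
def moment (lam s : ℝ) (P : Poly N) : ℝ := ∫ z, polyFun P z * wt lam s z

lemma moment_add {lam s : ℝ} (hl : 0 < lam) {P Q : Poly N}
    (hP : (N : ℝ) + P.totalDegree < 2 * s) (hQ : (N : ℝ) + Q.totalDegree < 2 * s) :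
    moment lam s (P + Q) = moment lam s P + moment lam s Q := by
  simp only [moment, polyFun_add, add_mul]
  exact integral_add (integrable_polyFun_mul_wt P hl hP) (integrable_polyFun_mul_wt Q hl hQ)

lemma moment_sum {lam s : ℝ} (hl : 0 < lam) {ι : Type*} (t : Finset ι) {P : ι → Poly N}
    (hP : ∀ i ∈ t, (N : ℝ) + (P i).totalDegree < 2 * s) :
    moment lam s (∑ i ∈ t, P i) = ∑ i ∈ t, moment lam s (P i) := by
  simp only [moment, polyFun_sum, Finset.sum_mul]
  exact integral_finsetSum _ fun i hi => integrable_polyFun_mul_wt _ hl (hP i hi)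

lemma moment_C_mul (lam s c : ℝ) (P : Poly N) :
    moment lam s (C c * P) = c * moment lam s P := by
  simp only [moment, polyFun_mul, polyFun_C, mul_assoc]
  exact integral_const_mul _ _

@[simp] lemma moment_zero (lam s : ℝ) : moment lam s (0 : Poly N) = 0 := by simp [moment]

/-- The moments depend continuously on the exponent from the right. -/
lemma tendsto_moment (P : Poly N) {lam s : ℝ} (hl : 0 < lam)
    (hs : (N : ℝ) + P.totalDegree < 2 * s) :
    Filter.Tendsto (fun n : ℕ => moment lam (s + 1 / ((n : ℝ) + 1)) P) Filter.atTop
      (𝓝 (moment lam s P)) := by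
  -- For 0 ≤ e ≤ 1 the extra weight (λ² + |z|²)^(-e) is at most max(1, λ^(-2)); this gives the
  -- dominating function.
  set M := max 1 (lam ^ 2)⁻¹
  refine tendsto_integral_of_dominated_convergence
    (fun z => M * |polyFun P z * wt lam s z|) (fun n => ?_) ?_ (fun n => ?_) ?_
  · exact ((continuous_polyFun P).mul (continuous_wt hl _)).aestronglyMeasurable
  · exact (integrable_polyFun_mul_wt P hl hs).abs.const_mul M
  · refine Filter.Eventually.of_forall fun z => ?_
    have hε : 0 < 1 / ((n : ℝ) + 1) := by positivity
    have hε1 : 1 / ((n : ℝ) + 1) ≤ 1 := by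
      rw [div_le_one (by positivity)]; linarith [(Nat.cast_nonneg n : (0 : ℝ) ≤ n)]
    have h1 : wt lam (1 / ((n : ℝ) + 1)) z ≤ M := by
      have hb := wt_base_pos hl z
      rw [wt, Real.rpow_neg hb.le, ← Real.inv_rpow hb.le]
      rcases le_total (lam ^ 2 + ‖z‖ ^ 2)⁻¹ 1 with h | h
      · exact (Real.rpow_le_one (by positivity) h hε.le).trans (le_max_left _ _)
      · refine (Real.rpow_le_rpow_of_exponent_le h hε1).trans ?_
        rw [Real.rpow_one]
        refine le_trans ?_ (le_max_right _ _)
        gcongr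
        linarith [sq_nonneg ‖z‖]
    rw [wt_add hl, ← mul_assoc, norm_mul, mul_comm, Real.norm_eq_abs, Real.norm_eq_abs,
      abs_of_pos (wt_pos hl _ z)]
    gcongr
  · refine Filter.Eventually.of_forall fun z => ?_
    have h1 : Filter.Tendsto (fun n : ℕ => s + 1 / ((n : ℝ) + 1)) Filter.atTop (𝓝 s) := by
      simpa using tendsto_const_nhds.add (tendsto_one_div_add_atTop_nhds_zero_nat (𝕜 := ℝ))
    exact ((tendsto_const_nhds.rpow h1.neg (Or.inl (wt_base_pos hl z).ne'))).const_mul _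

lemma totalDegree_X_mul_le (a : Fin N) (P : Poly N) :
    (X a * P).totalDegree ≤ P.totalDegree + 1 := by
  refine (totalDegree_mul _ _).trans ?_
  rw [totalDegree_X, add_comm]

/-- The a-th derivative of the weight of exponent s is -2s z_a times the weight of exponent s + 1,
so this is integration by parts of P against that weight. The strict inequality makes the product of
P and the weight integrable. -/
lemma moment_X_mul_aux (P : Poly N) (a : Fin N) {lam s : ℝ} (hl : 0 < lam)
    (hs : (N : ℝ) + P.totalDegree < 2 * s) :
    2 * s * moment lam (s + 1) (X a * P) = moment lam s (pderiv a P) := by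
  have hd : ((pderiv a P).totalDegree : ℝ) ≤ P.totalDegree := by
    exact_mod_cast (totalDegree_pderiv_le a P).trans (Nat.sub_le _ _)
  have hd' : ((X a * P).totalDegree : ℝ) ≤ P.totalDegree + 1 := by
    exact_mod_cast totalDegree_X_mul_le a P
  have hw : Differentiable ℝ (wt lam s : E N → ℝ) := by simpa using differentiable_wt hl s 0
  have hpw : ∀ z : E N, fderiv ℝ (wt lam s) z (EuclideanSpace.single a 1)
      = -(2 * s) * z a * wt lam (s + 1) z := fun z => by
    simpa [pd] using congrFun (pd_wt hl s (0 : E N) a) z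
  have hpP : ∀ z : E N, fderiv ℝ (polyFun P) z (EuclideanSpace.single a 1)
      = polyFun (pderiv a P) z := fun z => congrFun (pd_polyFun a P) z
  have h1 := integrable_polyFun_mul_wt (pderiv a P) hl (s := s) (by linarith)
  have h2 := integrable_polyFun_mul_wt (X a * P) hl (s := s + 1) (by linarith)
  have h3 : ∀ z : E N, polyFun P z * (-(2 * s) * z a * wt lam (s + 1) z)
      = -(2 * s) * (polyFun (X a * P) z * wt lam (s + 1) z) := fun z => by simp; ring
  have key := integral_mul_fderiv_eq_neg_fderiv_mul_of_integrable (μ := volume)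
    (f := polyFun P) (g := wt lam s) (v := EuclideanSpace.single a (1 : ℝ))
    (by simpa only [hpP] using h1)
    (by simp only [hpw, h3]; exact h2.const_mul _)
    (integrable_polyFun_mul_wt P hl hs)
    (fun z _ => differentiable_polyFun P z) (fun z _ => hw z)
  simp only [hpw, hpP, h3, integral_const_mul] at key
  simp only [moment]
  linarith

/-- Integration by parts for moments. -/
lemma moment_X_mul (P : Poly N) (a : Fin N) {lam s : ℝ} (hl : 0 < lam)
    (hs : (N : ℝ) + P.totalDegree ≤ 2 * s) :
    2 * s * moment lam (s + 1) (X a * P) = moment lam s (pderiv a P) := by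
  have hd' : ((X a * P).totalDegree : ℝ) ≤ P.totalDegree + 1 := by
    exact_mod_cast totalDegree_X_mul_le a P
  -- The endpoint N + deg P = 2s is needed later. There the product of P and the weight need not be
  -- integrable, so the identity is taken at s + 1/(n + 1) and passed to the limit.
  have hL := tendsto_moment (X a * P) hl (s := s + 1) (by linarith)
  have hsq : Filter.Tendsto (fun n : ℕ => 2 * (s + 1 / ((n : ℝ) + 1))) Filter.atTop
      (𝓝 (2 * s)) := by
    simpa using (tendsto_const_nhds (x := s)).add
      (tendsto_one_div_add_atTop_nhds_zero_nat (𝕜 := ℝ)) |>.const_mul 2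
  -- For constant P the degree does not drop under differentiation, and at 2s = N the limit of the
  -- right side could not be justified by integrability; but that side is zero for every exponent.
  by_cases h0 : P.totalDegree = 0
  · rw [totalDegree_eq_zero_iff_eq_C] at h0
    rcases hs.lt_or_eq with hs | hs
    · exact moment_X_mul_aux P a hl hs
    have := hsq.mul hL
    have h2 : ∀ n : ℕ, 2 * (s + 1 / ((n : ℝ) + 1)) *
        moment lam (s + 1 + 1 / ((n : ℝ) + 1)) (X a * P) = 0 := fun n => by
      have hε : 0 < 1 / ((n : ℝ) + 1) := by positivity
      rw [add_right_comm, moment_X_mul_aux P a hl (by linarith), h0, pderiv_C, moment_zero]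
    simp only [h2] at this
    rw [← tendsto_nhds_unique tendsto_const_nhds this, h0, pderiv_C, moment_zero]
  have hd : ((pderiv a P).totalDegree : ℝ) + 1 ≤ P.totalDegree := by
    have := totalDegree_pderiv_le a P
    exact_mod_cast (by omega : (pderiv a P).totalDegree + 1 ≤ P.totalDegree)
  have hR := tendsto_moment (pderiv a P) hl (s := s) (by linarith)
  refine tendsto_nhds_unique (hsq.mul hL) (hR.congr fun n => ?_)
  have hε : 0 < 1 / ((n : ℝ) + 1) := by positivity
  rw [add_right_comm, moment_X_mul_aux P a hl (by linarith)]

end PaneitzBlowup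
end

noncomputable section

namespace PaneitzBlowup

open MvPolynomial MeasureTheory

variable {N : ℕ}

/-! ### The Pizzetti formula -/

lemma isHomogeneous_pderiv {P : Poly N} {d : ℕ} (h : P.IsHomogeneous (d + 1)) (i : Fin N) :
    (pderiv i P).IsHomogeneous d := h.pderiv

lemma isHomogeneous_lap {P : Poly N} {d : ℕ} (h : P.IsHomogeneous (d + 2)) :
    (lap P).IsHomogeneous d := by
  rw [lap_apply]
  exact IsHomogeneous.sum _ _ _ fun i _ => isHomogeneous_pderiv (isHomogeneous_pderiv h i) i

lemma lap_eq_zero_of_totalDegree {P : Poly N} (h : P.totalDegree ≤ 1) : lap P = 0 := by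
  rw [lap_apply]
  refine Finset.sum_eq_zero fun i _ => ?_
  have h1 := totalDegree_pderiv_le i P
  have h2 : pderiv i P = C _ := totalDegree_eq_zero_iff_eq_C.1 (by omega)
  rw [h2, pderiv_C]

lemma polyFun_smul {P : Poly N} {d : ℕ} (h : P.IsHomogeneous d) (t : ℝ) (y : E N) :
    polyFun P (t • y) = t ^ d * polyFun P y := by
  have h1 : ∀ v ∈ P.support, (v.sum fun _ k => k) = d := fun v hv => by
    have := h (mem_support_iff.1 hv)
    simpa [Finsupp.weight_apply] using this
  simp only [polyFun, eval_eq, Finset.mul_sum]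
  refine Finset.sum_congr rfl fun v hv => ?_
  rw [← h1 v hv]
  simp [Finsupp.sum, mul_pow, Finset.prod_mul_distrib, Finset.prod_pow_eq_pow_sum]
  ring

lemma polyFun_apply_zero {P : Poly N} {d : ℕ} (h : P.IsHomogeneous d) (hd : d ≠ 0) :
    polyFun P 0 = 0 := by
  have := polyFun_smul h 0 0
  simpa [hd] using this

lemma polyFun_homogeneous_bound {P : Poly N} {d : ℕ} (h : P.IsHomogeneous d) :
    ∃ K, 0 ≤ K ∧ ∀ y : E N, |polyFun P y| ≤ K * ‖y‖ ^ d := by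
  obtain ⟨K, hK, hP⟩ := polyFun_growth P
  refine ⟨K * 2 ^ P.totalDegree, by positivity, fun y => ?_⟩
  rcases eq_or_ne y 0 with rfl | hy
  · rcases eq_or_ne d 0 with rfl | hd
    · refine (hP 0).trans ?_
      simp only [norm_zero, add_zero, one_pow, pow_zero, mul_one]
      exact le_mul_of_one_le_right hK (one_le_pow₀ (by norm_num))
    · simp [polyFun_apply_zero h hd, hd]
  · have hy' : 0 < ‖y‖ := norm_pos_iff.2 hy
    have h1 : polyFun P y = ‖y‖ ^ d * polyFun P (‖y‖⁻¹ • y) := by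
      rw [← polyFun_smul h, smul_smul, mul_inv_cancel₀ hy'.ne', one_smul]
    have h2 := hP (‖y‖⁻¹ • y)
    rw [norm_smul, norm_inv, norm_norm, inv_mul_cancel₀ hy'.ne'] at h2
    rw [h1, abs_mul, abs_of_pos (by positivity), mul_comm]
    norm_num at h2
    gcongr

/-- The Laplacian lowers the degree by two, so only m = d/2 can leave a nonzero constant at the
origin. -/
lemma polyFun_lap_iterate_zero {P : Poly N} {d m : ℕ} (h : P.IsHomogeneous d) (hm : d ≠ 2 * m) :
    polyFun (lap^[m] P) 0 = 0 := by
  induction m generalizing P d with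
  | zero => exact polyFun_apply_zero h (by simpa using hm)
  | succ m ih =>
    rw [Function.iterate_succ_apply]
    rcases Nat.lt_or_ge d 2 with hd | hd
    · rw [lap_eq_zero_of_totalDegree (h.totalDegree_le.trans (by omega)),
        Function.iterate_fixed (map_zero lap)]
      simp
    · obtain ⟨e, rfl⟩ := Nat.exists_eq_add_of_le' hd
      exact ih (isHomogeneous_lap h) (by omega)

/-- Euler's identity writes d·P as ∑ X_a ∂_a P, and integrating by parts each summand produces ∂_a
∂_a P. The result exchanges degree d and exponent s + 1 for degree d - 2 and exponent s. -/
lemma moment_homogeneous {P : Poly N} {d : ℕ} (h : P.IsHomogeneous d) {lam s : ℝ} (hl : 0 < lam)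
    (hs : (N : ℝ) + d ≤ 2 * s + 1) (hN : (N : ℝ) < 2 * s) :
    2 * d * s * moment lam (s + 1) P = moment lam s (lap P) := by
  rcases d with _ | d
  · rw [lap_eq_zero_of_totalDegree (h.totalDegree_le.trans (by omega))]
    simp
  push_cast at hs
  have hdeg : ∀ a, ((pderiv a P).totalDegree : ℝ) ≤ d := fun a => by
    exact_mod_cast (isHomogeneous_pderiv h a).totalDegree_le
  have hE : C ((d : ℝ) + 1) * P = ∑ a, X a * pderiv a P := by
    rw [h.sum_X_mul_pderiv]
    simp
  have h1 : ((d : ℝ) + 1) * moment lam (s + 1) P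
      = ∑ a, moment lam (s + 1) (X a * pderiv a P) := by
    rw [← moment_C_mul, hE, moment_sum hl]
    intro a _
    have h2 : ((X a * pderiv a P).totalDegree : ℝ) ≤ (pderiv a P).totalDegree + 1 := by
      exact_mod_cast totalDegree_X_mul_le a _
    linarith [hdeg a]
  have h3 : moment lam s (lap P) = ∑ a, moment lam s (pderiv a (pderiv a P)) := by
    rw [lap_apply, moment_sum hl]
    intro a _
    have h4 := totalDegree_pderiv_le a (pderiv a P)
    rcases Nat.eq_zero_or_pos (pderiv a P).totalDegree with h0 | h0
    · have : (pderiv a (pderiv a P)).totalDegree = 0 := by omega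
      rw [this]; simpa using hN
    · have h5 : ((pderiv a (pderiv a P)).totalDegree : ℝ) + 1 ≤ (pderiv a P).totalDegree := by
        exact_mod_cast (by omega :
          (pderiv a (pderiv a P)).totalDegree + 1 ≤ (pderiv a P).totalDegree)
      linarith [hdeg a]
  rw [h3]
  push_cast
  calc 2 * ((d : ℝ) + 1) * s * moment lam (s + 1) P
      = 2 * s * (((d : ℝ) + 1) * moment lam (s + 1) P) := by ring
    _ = _ := by
      rw [h1, Finset.mul_sum]
      refine Finset.sum_congr rfl fun a _ => moment_X_mul _ a hl ?_
      linarith [hdeg a]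

/-- The coefficients in the Pizzetti formula. -/
def pizzettiCoeff (N : ℕ) (lam s : ℝ) (m : ℕ) : ℝ :=
  moment lam (s - m) (1 : Poly N) / (4 ^ m * m.factorial * ∏ i ∈ Finset.range m, (s - 1 - i))

/-- The coefficients are built to satisfy the recursion of `moment_homogeneous` in degree 2(m + 1)
with exponent s - 1. -/
lemma pizzettiCoeff_succ (lam s : ℝ) (m : ℕ) (hs : s ≠ 1) :
    2 * (2 * ((m : ℝ) + 1)) * (s - 1) * pizzettiCoeff N lam s (m + 1)
      = pizzettiCoeff N lam (s - 1) m := by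
  have h1 : s - 1 ≠ 0 := sub_ne_zero.2 hs
  have hm : (m : ℝ) + 1 ≠ 0 := by positivity
  simp only [pizzettiCoeff, Finset.prod_range_succ', Nat.factorial_succ]
  push_cast
  rw [show s - ((m : ℝ) + 1) = s - 1 - m by ring]
  have : ∀ i : ℕ, s - 1 - ((i : ℝ) + 1) = s - 1 - 1 - i := fun i => by ring
  simp only [this, sub_zero]
  -- If the product vanishes, both coefficients are quotients by zero, hence zero.
  rcases eq_or_ne (∏ i ∈ Finset.range m, (s - 1 - 1 - (i : ℝ))) 0 with h0 | h0
  · simp [h0]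
  have : (m.factorial : ℝ) ≠ 0 := by positivity
  field_simp
  ring

/-- Induction on the degree in steps of two through `moment_homogeneous`, starting from constants
and from degree one. The slack D ≥ d lets all homogeneous components of a polynomial share one range
of summation. -/
lemma pizzetti_homogeneous (hN : 2 ≤ N) {P : Poly N} {d : ℕ} (h : P.IsHomogeneous d) {lam s : ℝ}
    (hl : 0 < lam) (hs : (N : ℝ) + d + 1 ≤ 2 * s) {D : ℕ} (hD : d ≤ D) :
    moment lam s P =
      ∑ m ∈ Finset.range (D + 1), pizzettiCoeff N lam s m * polyFun (lap^[m] P) 0 := by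
  induction d using Nat.strong_induction_on generalizing P s D with
  | _ d ih =>
  rcases d with _ | d
  · obtain ⟨c, rfl⟩ : ∃ c, P = C c :=
      ⟨_, totalDegree_eq_zero_iff_eq_C.1 (Nat.le_zero.1 h.totalDegree_le)⟩
    rw [Finset.sum_eq_single_of_mem 0 (by simp)]
    · have := moment_C_mul (N := N) lam s c 1
      rw [mul_one] at this
      simp [pizzettiCoeff, this, mul_comm]
    · intro m _ hm
      rw [polyFun_lap_iterate_zero h (by omega), mul_zero]
  have hN' : (2 : ℝ) ≤ N := by exact_mod_cast hN
  push_cast at hs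
  have hd0 : (0 : ℝ) ≤ d := by positivity
  have hs1 : 0 < s - 1 := by linarith
  obtain ⟨D, rfl⟩ : ∃ e, D = e + 1 := ⟨D - 1, by omega⟩
  rw [Finset.sum_range_succ']
  rw [Function.iterate_zero_apply, polyFun_apply_zero h (by omega), mul_zero, add_zero]
  simp only [Function.iterate_succ_apply]
  -- In degree one the polynomial is a sum of X_a times constants, and integration by parts
  -- differentiates the constants: the moment is zero.
  rcases d with _ | d
  · have hl0 : lap P = 0 := lap_eq_zero_of_totalDegree (h.totalDegree_le.trans (by omega))
    have hz : moment lam s P = 0 := by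
      have hE : P = ∑ a, X a * pderiv a P := by simpa using h.sum_X_mul_pderiv.symm
      rw [hE, moment_sum hl]
      · refine Finset.sum_eq_zero fun a _ => ?_
        have h1 : (pderiv a P).totalDegree = 0 :=
          Nat.le_zero.1 (isHomogeneous_pderiv h a).totalDegree_le
        have h2 := moment_X_mul (pderiv a P) a hl (s := s - 1)
          (by rw [h1]; push_cast at hs ⊢; linarith)
        rw [totalDegree_eq_zero_iff_eq_C.1 h1, pderiv_C, moment_zero, sub_add_cancel] at h2
        rw [totalDegree_eq_zero_iff_eq_C.1 h1]
        rcases mul_eq_zero.1 h2 with h3 | h3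
        · linarith
        · exact h3
      · intro a _
        have h1 : ((X a * pderiv a P).totalDegree : ℝ) ≤ 1 := by
          have := totalDegree_X_mul_le a (pderiv a P)
          have h1 := (isHomogeneous_pderiv h a).totalDegree_le
          exact_mod_cast (by omega : (X a * pderiv a P).totalDegree ≤ 1)
        push_cast at hs
        linarith
    rw [hz, hl0]
    simp [Function.iterate_fixed (map_zero lap)]
  push_cast at hs
  have hlap := isHomogeneous_lap h
  have h1 := ih d (by omega) hlap (s := s - 1) (by linarith) (D := D) (by omega)
  have h2 := moment_homogeneous h hl (s := s - 1) (by push_cast; linarith) (by linarith)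
  rw [sub_add_cancel, h1] at h2
  have hne : (2 * ((d + 1 + 1 : ℕ) : ℝ) * (s - 1)) ≠ 0 := by positivity
  refine mul_left_cancel₀ hne ?_
  rw [h2, Finset.mul_sum]
  refine Finset.sum_congr rfl fun m _ => ?_
  -- Only the index with 2(m + 1) equal to the degree survives; there the factor from
  -- `moment_homogeneous` is the one in the recursion of the coefficients.
  by_cases hm : d + 2 = 2 * (m + 1)
  · rw [← pizzettiCoeff_succ lam s m (by linarith)]
    have : ((d + 1 + 1 : ℕ) : ℝ) = 2 * ((m : ℝ) + 1) := by exact_mod_cast hm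
    rw [this]; ring
  · have : polyFun (lap^[m] (lap P)) 0 = 0 := polyFun_lap_iterate_zero hlap (by omega)
    rw [this]; simp

/-- **Pizzetti's formula** for the moments. -/
lemma pizzetti (hN : 2 ≤ N) {P : Poly N} {D : ℕ} (h : P.totalDegree ≤ D) {lam s : ℝ}
    (hl : 0 < lam) (hs : (N : ℝ) + D + 1 ≤ 2 * s) :
    moment lam s P =
      ∑ m ∈ Finset.range (D + 1), pizzettiCoeff N lam s m * polyFun (lap^[m] P) 0 := by
  have hlin : ∀ m, lap^[m] P = ∑ i ∈ Finset.range (P.totalDegree + 1),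
      lap^[m] (homogeneousComponent i P) := fun m => by
    conv_lhs => rw [← sum_homogeneousComponent P]
    rw [← Module.End.coe_pow, map_sum]
  have hdeg : ∀ i ∈ Finset.range (P.totalDegree + 1),
      (i : ℝ) ≤ D := fun i hi => by
    exact_mod_cast (Nat.lt_succ_iff.1 (Finset.mem_range.1 hi)).trans h
  have h1 : moment lam s P = ∑ i ∈ Finset.range (P.totalDegree + 1),
      moment lam s (homogeneousComponent i P) := by
    conv_lhs => rw [← sum_homogeneousComponent P]
    refine moment_sum hl _ fun i hi => ?_
    have h2 : ((homogeneousComponent i P).totalDegree : ℝ) ≤ i := by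
      exact_mod_cast (homogeneousComponent_isHomogeneous i P).totalDegree_le
    linarith [hdeg i hi]
  rw [h1]
  simp only [hlin, polyFun_sum, Finset.mul_sum]
  rw [Finset.sum_comm]
  refine Finset.sum_congr rfl fun i hi => ?_
  exact pizzetti_homogeneous hN (homogeneousComponent_isHomogeneous i P) hl
    (by linarith [hdeg i hi]) (by exact_mod_cast hdeg i hi)

/-- The Laplacian commutes with translations, so Pizzetti's values at the origin become values at ξ.
-/
lemma moment_trans (hN : 2 ≤ N) {P : Poly N} {D : ℕ} (h : P.totalDegree ≤ D) {lam s : ℝ}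
    (hl : 0 < lam) (hs : (N : ℝ) + D + 1 ≤ 2 * s) (ξ : E N) :
    moment lam s (trans ξ P) =
      ∑ m ∈ Finset.range (D + 1), pizzettiCoeff N lam s m * polyFun (lap^[m] P) ξ := by
  rw [pizzetti hN ((totalDegree_trans_le ξ P).trans h) hl hs]
  simp [lap_iterate_trans]

/-! ### Radial polynomials times harmonic polynomials -/

/-- The polynomial `|y|²`. -/
def nsq : Poly N := ∑ i, X i ^ 2

@[simp] lemma polyFun_nsq (y : E N) : polyFun nsq y = ‖y‖ ^ 2 := by
  simp [nsq, EuclideanSpace.norm_sq_eq]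

lemma isHomogeneous_nsq : (nsq : Poly N).IsHomogeneous 2 :=
  IsHomogeneous.sum _ _ _ fun i _ => by simpa using (isHomogeneous_X ℝ i).pow 2

lemma pderiv_nsq (i : Fin N) : pderiv i (nsq : Poly N) = 2 * X i := by
  simp [nsq, pderiv_X, Pi.single_apply]

lemma pderiv_aeval_nsq (i : Fin N) (φ : Polynomial ℝ) :
    pderiv i (Polynomial.aeval (nsq : Poly N) φ)
      = 2 * Polynomial.aeval nsq (Polynomial.derivative φ) * X i := by
  rw [Derivation.map_aeval, pderiv_nsq, smul_eq_mul]
  ring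

/-- With r = |y|, Δ(φ(r²)) = 4r²φ'' + 2Nφ', and the mixed term 2∇φ(r²)·∇h equals 4φ' y·∇h = 4dφ'h by
Euler's identity. -/
lemma lap_aeval_nsq_mul (φ : Polynomial ℝ) {h : Poly N} {d : ℕ} (hh : h.IsHomogeneous d) :
    lap (Polynomial.aeval nsq φ * h) =
      Polynomial.aeval nsq (4 * Polynomial.X * Polynomial.derivative (Polynomial.derivative φ)
        + Polynomial.C (2 * N + 4 * d : ℝ) * Polynomial.derivative φ) * h
      + Polynomial.aeval nsq φ * lap h := by
  have hE : ∑ i, X i * pderiv i h = (d : Poly N) * h := by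
    rw [hh.sum_X_mul_pderiv]; simp
  have h1 : ∀ i : Fin N, pderiv i (pderiv i (Polynomial.aeval (nsq : Poly N) φ * h)) =
      4 * Polynomial.aeval nsq (Polynomial.derivative (Polynomial.derivative φ)) * h * X i ^ 2
      + 2 * Polynomial.aeval nsq (Polynomial.derivative φ) * h
      + 4 * Polynomial.aeval nsq (Polynomial.derivative φ) * (X i * pderiv i h)
      + Polynomial.aeval nsq φ * pderiv i (pderiv i h) := fun i => by
    have h2 : pderiv i (2 : Poly N) = 0 := by
      rw [show (2 : Poly N) = C 2 from rfl, pderiv_C]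
    simp only [Derivation.leibniz, map_add, pderiv_aeval_nsq, smul_eq_mul, pderiv_X_self, h2]
    ring
  rw [lap_apply]
  simp only [h1, Finset.sum_add_distrib, ← Finset.mul_sum, hE]
  rw [← nsq, lap_apply]
  simp only [map_add, map_mul, map_ofNat, Polynomial.aeval_X,
    map_natCast]
  simp only [Finset.sum_const, Finset.card_univ, Fintype.card_fin, nsmul_eq_mul]
  ring

/-- `h` is harmonic and homogeneous of degree `d`. -/
structure IsSolidHarmonic (h : Poly N) (d : ℕ) : Prop where
  homogeneous : h.IsHomogeneous d
  harmonic : lap h = 0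

lemma lap_nsq_pow_mul {h : Poly N} {d : ℕ} (hh : IsSolidHarmonic h d) (j : ℕ) :
    lap (nsq ^ (j + 1) * h) = C (2 * ((j : ℝ) + 1) * (2 * j + N + 2 * d)) * (nsq ^ j * h) := by
  have := lap_aeval_nsq_mul (Polynomial.X ^ (j + 1)) hh.homogeneous
  rw [hh.harmonic, mul_zero, add_zero] at this
  simp only [map_pow, Polynomial.aeval_X] at this
  rw [this]
  rcases j with _ | j
  · simp [algebraMap_eq, map_ofNat C]
    ring_nf; simp
  · simp [algebraMap_eq, map_ofNat C, map_ofNat (Polynomial.aeval (nsq : Poly N))]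
    ring

/-- The coefficient of `|y|^(2(j-m)) h` in `Δ^m (|y|^(2j) h)`, for `h` harmonic of degree `d`. -/
def lapCoeff (N d : ℕ) : ℕ → ℕ → ℝ
  | _, 0 => 1
  | 0, _ + 1 => 0
  | j + 1, m + 1 => 2 * ((j : ℝ) + 1) * (2 * j + N + 2 * d) * lapCoeff N d j m

/-- The truncated exponent j - m is harmless, because the coefficient vanishes for m > j. -/
lemma lap_iterate_nsq_pow_mul {h : Poly N} {d : ℕ} (hh : IsSolidHarmonic h d) (j m : ℕ) :
    lap^[m] (nsq ^ j * h) = C (lapCoeff N d j m) * (nsq ^ (j - m) * h) := by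
  induction m generalizing j with
  | zero => cases j <;> simp [lapCoeff]
  | succ m ih =>
    cases j with
    | zero =>
      simp [lapCoeff, hh.harmonic, Function.iterate_fixed (map_zero lap)]
    | succ j =>
      rw [Function.iterate_succ_apply, lap_nsq_pow_mul hh, ← smul_eq_C_mul,
        ← Module.End.coe_pow, map_smul, Module.End.coe_pow, ih, smul_eq_C_mul, lapCoeff]
      rw [show j + 1 - (m + 1) = j - m by omega]
      simp only [C_mul]
      ring

lemma lapCoeff_eq_zero (N d : ℕ) {j m : ℕ} (h : j < m) : lapCoeff N d j m = 0 := by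
  induction m generalizing j with
  | zero => omega
  | succ m ih =>
    cases j with
    | zero => rfl
    | succ j => rw [lapCoeff, ih (by omega), mul_zero]

/-- Each iterated Laplacian of |y|^(2j) h is again a radial power times h, so the dependence of the
moment on ξ is h(ξ) times a polynomial in |ξ|². The order in ξ of each term can be read off. -/
lemma moment_trans_nsq_pow_mul (hN : 2 ≤ N) {h : Poly N} {d : ℕ} (hh : IsSolidHarmonic h d)
    (j : ℕ) {lam s : ℝ} (hl : 0 < lam) (hs : (N : ℝ) + (2 * j + d) + 1 ≤ 2 * s) (ξ : E N) :
    moment lam s (trans ξ (nsq ^ j * h)) =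
      ∑ m ∈ Finset.range (j + 1), pizzettiCoeff N lam s m * lapCoeff N d j m
        * (polyFun h ξ * ‖ξ‖ ^ (2 * (j - m))) := by
  have hdeg : (nsq ^ j * h : Poly N).totalDegree ≤ 2 * j + d :=
    ((isHomogeneous_nsq.pow j).mul hh.homogeneous).totalDegree_le
  rw [moment_trans hN hdeg hl (by push_cast; exact hs)]
  symm
  refine Finset.sum_subset_zero_on_sdiff (fun m => by simp; omega) (fun m hm => ?_)
    fun m _ => ?_
  · rw [lap_iterate_nsq_pow_mul hh, lapCoeff_eq_zero N d (by simp at hm; omega)]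
    simp
  · rw [lap_iterate_nsq_pow_mul hh]
    simp only [polyFun_mul, polyFun_C, polyFun_pow, polyFun_nsq]
    rw [pow_mul]
    ring

/-- The radial moment `∫ |z|^(2j) (1 + |z|²)^(-s) dz`. -/
def radialMoment (N j : ℕ) (s : ℝ) : ℝ := moment 1 s (nsq ^ j : Poly N)

lemma isSolidHarmonic_one : IsSolidHarmonic (1 : Poly N) 0 :=
  ⟨isHomogeneous_one _ _, lap_eq_zero_of_totalDegree (by simp)⟩

/-- At ξ = 0 with h = 1 only m = j survives in the previous expansion. This replaces the abstract
Pizzetti coefficients by positive radial moments. -/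
lemma pizzettiCoeff_mul_lapCoeff_self (hN : 2 ≤ N) (j : ℕ) {s : ℝ}
    (hs : (N : ℝ) + 2 * j + 1 ≤ 2 * s) :
    pizzettiCoeff N 1 s j * lapCoeff N 0 j j = radialMoment N j s := by
  have h1 := moment_trans_nsq_pow_mul hN isSolidHarmonic_one j one_pos
    (by push_cast; linarith : (N : ℝ) + (2 * j + (0 : ℕ)) + 1 ≤ 2 * s) (0 : E N)
  have h2 : trans (0 : E N) (nsq ^ j * 1) = nsq ^ j := by
    have : trans (0 : E N) = AlgHom.id ℝ (Poly N) := by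
      refine algHom_ext fun i => ?_
      simp
    rw [this]; simp
  rw [h2] at h1
  rw [radialMoment, h1, Finset.sum_range_succ, Finset.sum_eq_zero]
  · simp
  · intro m hm
    have : 2 * (j - m) ≠ 0 := by simp at hm; omega
    simp [this]

/-- The quotient is the product of (2i + N + 4)/(2i + N) over i < j, which telescopes to its end
factors. -/
lemma lapCoeff_two_self (hN : 2 ≤ N) (j : ℕ) :
    lapCoeff N 2 j j = lapCoeff N 0 j j * ((2 * j + N) * (2 * j + N + 2) / (N * (N + 2))) := by
  have : (N : ℝ) ≠ 0 := by positivity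
  have : (N : ℝ) + 2 ≠ 0 := by positivity
  induction j with
  | zero => simp [lapCoeff]; field_simp
  | succ j ih =>
    rw [lapCoeff, lapCoeff, ih]
    push_cast
    field_simp
    ring

lemma lapCoeff_zero_pred (hN : 2 ≤ N) (j : ℕ) :
    lapCoeff N 0 (j + 1) j = lapCoeff N 0 j j * ((j + 1) * (2 * j + N) / N) := by
  have : (N : ℝ) ≠ 0 := by positivity
  induction j with
  | zero => simp [lapCoeff]; field_simp
  | succ j ih =>
    rw [lapCoeff, ih, lapCoeff]
    push_cast
    field_simp
    ring

/-! ### Scaling and recursion of the moments -/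

lemma moment_one_scaling {lam s : ℝ} (hl : 0 < lam) :
    moment lam s (1 : Poly N) = lam ^ ((N : ℝ) - 2 * s) * moment 1 s (1 : Poly N) := by
  simp only [moment, polyFun_one, one_mul]
  have h := Measure.integral_comp_smul (volume : Measure (E N)) (wt lam s) lam
  have h1 : ∀ z : E N, wt lam s (lam • z) = lam ^ (-(2 * s)) * wt 1 s z := fun z => by
    simp only [wt, norm_smul, Real.norm_eq_abs, abs_of_pos hl]
    rw [show lam ^ 2 + (lam * ‖z‖) ^ 2 = lam ^ 2 * (1 ^ 2 + ‖z‖ ^ 2) by ring,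
      Real.mul_rpow (by positivity) (by positivity), ← Real.rpow_natCast lam 2,
      ← Real.rpow_mul hl.le]
    congr 2; push_cast; ring
  simp only [h1, integral_const_mul, finrank_euclideanSpace, Fintype.card_fin, smul_eq_mul] at h
  rw [abs_of_pos (by positivity)] at h
  have h2 : ∫ z : E N, wt lam s z = lam ^ N * (lam ^ (-(2 * s)) * ∫ z : E N, wt 1 s z) := by
    rw [h]; field_simp
  rw [h2, ← mul_assoc, ← Real.rpow_natCast, ← Real.rpow_add hl]
  rfl

lemma pizzettiCoeff_scaling {lam s : ℝ} (hl : 0 < lam) (m : ℕ) :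
    pizzettiCoeff N lam s m = lam ^ ((N : ℝ) - 2 * s + 2 * m) * pizzettiCoeff N 1 s m := by
  simp only [pizzettiCoeff]
  rw [moment_one_scaling hl, show (N : ℝ) - 2 * (s - m) = N - 2 * s + 2 * m by ring]
  ring

lemma radialMoment_pos (j : ℕ) {s : ℝ} (hs : (N : ℝ) + 2 * j < 2 * s) (hN : 2 ≤ N) :
    0 < radialMoment N j s := by
  have hi := integrable_polyFun_mul_wt (nsq ^ j : Poly N) one_pos (s := s) (by
    have : ((nsq ^ j : Poly N).totalDegree : ℝ) ≤ 2 * j := by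
      exact_mod_cast (isHomogeneous_nsq.pow j).totalDegree_le
    linarith)
  rw [radialMoment, moment, integral_pos_iff_support_of_nonneg _ hi]
  · refine lt_of_lt_of_le ?_ (measure_mono (s := {0}ᶜ) fun z hz => ?_)
    · have : Nonempty (Fin N) := ⟨⟨0, by omega⟩⟩
      have : Nontrivial (E N) := inferInstance
      refine isOpen_compl_singleton.measure_pos volume ?_
      obtain ⟨z, hz⟩ := exists_ne (0 : E N)
      exact ⟨z, hz⟩
    · have : 0 < ‖z‖ := norm_pos_iff.2 hz
      have h2 := wt_pos one_pos s z
      simp only [Function.mem_support, polyFun_pow, polyFun_nsq]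
      positivity
  · intro z
    have h2 := wt_pos one_pos s z
    simp only [polyFun_pow, polyFun_nsq, Pi.zero_apply]
    positivity

/-- The case of `moment_homogeneous` for |y|^(2j+2), with the common factor 2(j + 1) cancelled. -/
lemma radialMoment_succ_succ (j : ℕ) {s : ℝ} (hs : (N : ℝ) + 2 * j + 1 ≤ 2 * s) :
    2 * s * radialMoment N (j + 1) (s + 1) = (2 * j + N) * radialMoment N j s := by
  have hj : (0 : ℝ) ≤ j := by positivity
  have h1 := moment_homogeneous (isHomogeneous_nsq.pow (j + 1) : (nsq ^ (j + 1) : Poly N).IsHomogeneous _)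
    one_pos (s := s) (by push_cast; linarith) (by linarith)
  have h2 := lap_nsq_pow_mul (N := N) isSolidHarmonic_one j
  rw [mul_one, mul_one] at h2
  rw [h2, moment_C_mul] at h1
  simp only [radialMoment]
  have h3 : (2 * ((j : ℝ) + 1)) ≠ 0 := by positivity
  refine mul_left_cancel₀ h3 ?_
  push_cast at h1
  linear_combination h1

/-- Multiplying the weight of exponent s + 1 by 1 + |z|² gives the weight of exponent s. With the
previous recursion this determines the ratios of all radial moments. -/
lemma radialMoment_add (j : ℕ) {s : ℝ} (hs : (N : ℝ) + 2 * j < 2 * s) :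
    radialMoment N j s = radialMoment N (j + 1) (s + 1) + radialMoment N j (s + 1) := by
  have hd : ∀ j : ℕ, ((nsq ^ j : Poly N).totalDegree : ℝ) ≤ 2 * j := fun j => by
    exact_mod_cast (isHomogeneous_nsq.pow j).totalDegree_le
  simp only [radialMoment]
  have h1 := hd (j + 1)
  push_cast at h1
  rw [← moment_add one_pos (by linarith) (by linarith [hd j])]
  refine integral_congr_ae (Filter.Eventually.of_forall fun z => ?_)
  simp only [polyFun_add, polyFun_pow, polyFun_nsq]
  rw [← base_mul_wt one_pos s z]
  ring

end PaneitzBlowup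
end

noncomputable section

namespace PaneitzBlowup

open MvPolynomial MeasureTheory Asymptotics Filter

variable {N : ℕ}

/-! ### Expansions in `ξ` at `(0, 1)` up to `o(|ξ|²)` -/

/-- The moment of the polynomial `P`, centred at `ξ` and multiplied by `λ^(N-4)`. -/
def scaledMoment (s : ℝ) (P : Poly N) (p : E N × ℝ) : ℝ :=
  p.2 ^ ((N : ℝ) - 4) * moment p.2 s (trans p.1 P)

lemma eventually_snd_pos : ∀ᶠ p : E N × ℝ in 𝓝 (0, 1), 0 < p.2 :=
  (continuous_snd.tendsto ((0 : E N), (1 : ℝ))).eventually (lt_mem_nhds one_pos)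

lemma scaledMoment_nsq_pow_mul (hN : 2 ≤ N) {h : Poly N} {d : ℕ} (hh : IsSolidHarmonic h d)
    (j : ℕ) {s : ℝ} (hs : (N : ℝ) + (2 * j + d) + 1 ≤ 2 * s) {p : E N × ℝ} (hp : 0 < p.2) :
    scaledMoment s (nsq ^ j * h) p =
      ∑ m ∈ Finset.range (j + 1), (pizzettiCoeff N 1 s m * lapCoeff N d j m)
        * (p.2 ^ (2 * (N : ℝ) - 4 - 2 * s + 2 * m) * (polyFun h p.1 * ‖p.1‖ ^ (2 * (j - m)))) := by
  rw [scaledMoment, moment_trans_nsq_pow_mul hN hh j hp hs, Finset.mul_sum]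
  refine Finset.sum_congr rfl fun m _ => ?_
  have e : p.2 ^ (2 * (N : ℝ) - 4 - 2 * s + 2 * m)
      = p.2 ^ ((N : ℝ) - 4) * p.2 ^ ((N : ℝ) - 2 * s + 2 * m) := by
    rw [← Real.rpow_add hp]; congr 1; ring
  rw [pizzettiCoeff_scaling hp, e]
  ring

lemma isBigO_polyFun {h : Poly N} {d : ℕ} (hh : h.IsHomogeneous d) (l : Filter (E N × ℝ)) :
    (fun p : E N × ℝ => polyFun h p.1) =O[l] fun p => ‖p.1‖ ^ d := by
  obtain ⟨K, -, hK⟩ := polyFun_homogeneous_bound hh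
  exact IsBigO.of_bound K (Eventually.of_forall fun p => by simpa using hK p.1)

lemma isLittleO_norm_pow {i : ℕ} (hi : 3 ≤ i) :
    (fun p : E N × ℝ => ‖p.1‖ ^ i) =o[𝓝 (0, 1)] fun p => ‖p.1‖ ^ 2 := by
  obtain ⟨k, rfl⟩ := Nat.exists_eq_add_of_le' (by omega : 2 + 1 ≤ i)
  have h1 : Tendsto (fun p : E N × ℝ => ‖p.1‖ ^ (k + 1)) (𝓝 (0, 1)) (𝓝 0) := by
    have : Continuous fun p : E N × ℝ => ‖p.1‖ ^ (k + 1) := by fun_prop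
    simpa using this.tendsto (0, 1)
  have h2 := ((isLittleO_one_iff ℝ).2 h1).mul_isBigO
    (isBigO_refl (fun p : E N × ℝ => ‖p.1‖ ^ 2) (𝓝 (0, 1)))
  refine (h2.congr (fun p => ?_) fun p => ?_)
  · ring
  · ring

lemma tendsto_snd_rpow (e : ℝ) :
    Tendsto (fun p : E N × ℝ => p.2 ^ e) (𝓝 (0, 1)) (𝓝 1) := by
  have : ContinuousAt (fun p : E N × ℝ => p.2 ^ e) (0, 1) :=
    continuousAt_snd.rpow_const (Or.inl one_ne_zero)
  simpa [ContinuousAt] using this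

lemma isLittleO_higher {h : Poly N} {d i : ℕ} (hh : h.IsHomogeneous d) (hi : 3 ≤ d + i) (e : ℝ) :
    (fun p : E N × ℝ => p.2 ^ e * (polyFun h p.1 * ‖p.1‖ ^ i)) =o[𝓝 (0, 1)]
      fun p => ‖p.1‖ ^ 2 := by
  have h1 : (fun p : E N × ℝ => p.2 ^ e) =O[𝓝 (0, 1)] fun _ => (1 : ℝ) :=
    (tendsto_snd_rpow e).isBigO_one ℝ
  have h2 := h1.mul ((isBigO_polyFun hh (𝓝 (0, 1))).mul
    (isBigO_refl (fun p : E N × ℝ => ‖p.1‖ ^ i) (𝓝 (0, 1))))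
  refine h2.trans_isLittleO ((isLittleO_norm_pow hi).congr (fun p => ?_) fun _ => rfl)
  rw [pow_add]; ring

/-- In a term already quadratic in ξ, a power of λ may be replaced by its value at 1: the error is
o(1) times O(|ξ|²). -/
lemma isLittleO_rpow_sub_one {h : Poly N} (hh : h.IsHomogeneous 2) (e : ℝ) :
    (fun p : E N × ℝ => p.2 ^ e * polyFun h p.1 - polyFun h p.1) =o[𝓝 (0, 1)]
      fun p => ‖p.1‖ ^ 2 := by
  have h1 : (fun p : E N × ℝ => p.2 ^ e - 1) =o[𝓝 (0, 1)] fun _ => (1 : ℝ) := by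
    rw [isLittleO_one_iff]
    simpa using (tendsto_snd_rpow (N := N) e).sub_const 1
  refine (h1.mul_isBigO (isBigO_polyFun hh (𝓝 (0, 1)))).congr (fun p => ?_) fun p => ?_
  · ring
  · ring

/-- `T(ξ,λ) = a(λ) + b |ξ|² + c G(ξ) + o(|ξ|²)` at `(0, 1)`. -/
def HasExpansion (G : E N → ℝ) (T : E N × ℝ → ℝ) (a : ℝ → ℝ) (b c : ℝ) : Prop :=
  (fun p => T p - (a p.2 + b * ‖p.1‖ ^ 2 + c * G p.1)) =o[𝓝 (0, 1)] fun p => ‖p.1‖ ^ 2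

namespace HasExpansion

variable {G : E N → ℝ} {T T' : E N × ℝ → ℝ} {a a' : ℝ → ℝ} {b b' c c' : ℝ}

lemma congr' (h : HasExpansion G T a b c) (hT : T' =ᶠ[𝓝 (0, 1)] T)
    (ha : ∀ l, 0 < l → a' l = a l) (hb : b' = b) (hc : c' = c) : HasExpansion G T' a' b' c' := by
  subst hb hc
  refine IsLittleO.congr' h ?_ EventuallyEq.rfl
  filter_upwards [hT, eventually_snd_pos] with p hp hp'
  rw [hp, ha _ hp']

lemma add (h : HasExpansion G T a b c) (h' : HasExpansion G T' a' b' c') :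
    HasExpansion G (fun p => T p + T' p) (fun l => a l + a' l) (b + b') (c + c') :=
  (IsLittleO.add h h').congr_left fun p => by ring

lemma const_mul (h : HasExpansion G T a b c) (k : ℝ) :
    HasExpansion G (fun p => k * T p) (fun l => k * a l) (k * b) (k * c) :=
  (IsLittleO.const_mul_left h k).congr_left fun p => by ring

lemma sum {ι : Type*} {t : Finset ι} {T : ι → E N × ℝ → ℝ} {a : ι → ℝ → ℝ} {b c : ι → ℝ}
    (h : ∀ i ∈ t, HasExpansion G (T i) (a i) (b i) (c i)) :
    HasExpansion G (fun p => ∑ i ∈ t, T i p) (fun l => ∑ i ∈ t, a i l) (∑ i ∈ t, b i)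
      (∑ i ∈ t, c i) := by
  refine (IsLittleO.fun_sum h).congr_left fun p => ?_
  simp only [Finset.sum_sub_distrib, Finset.sum_add_distrib, Finset.sum_mul]

end HasExpansion

/-- The discarded terms m < q have order d + 2(j - m) in ξ. This order decreases with m, so it
suffices that it is at least three at m = q - 1. -/
lemma isLittleO_scaledMoment_sub (hN : 2 ≤ N) {h : Poly N} {d : ℕ} (hh : IsSolidHarmonic h d)
    (j : ℕ) {s : ℝ} (hs : (N : ℝ) + (2 * j + d) + 1 ≤ 2 * s) {q : ℕ} (hq : q ≤ j + 1)
    (hd : 1 ≤ q → 3 ≤ d + 2 * (j - (q - 1))) :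
    (fun p : E N × ℝ => scaledMoment s (nsq ^ j * h) p - ∑ m ∈ Finset.Ico q (j + 1),
      (pizzettiCoeff N 1 s m * lapCoeff N d j m)
        * (p.2 ^ (2 * (N : ℝ) - 4 - 2 * s + 2 * m) * (polyFun h p.1 * ‖p.1‖ ^ (2 * (j - m)))))
      =o[𝓝 (0, 1)] fun p => ‖p.1‖ ^ 2 := by
  have h1 : (fun p : E N × ℝ => ∑ m ∈ Finset.range q,
      (pizzettiCoeff N 1 s m * lapCoeff N d j m)
        * (p.2 ^ (2 * (N : ℝ) - 4 - 2 * s + 2 * m) * (polyFun h p.1 * ‖p.1‖ ^ (2 * (j - m)))))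
      =o[𝓝 (0, 1)] fun p => ‖p.1‖ ^ 2 := by
    refine IsLittleO.fun_sum fun m hm => (isLittleO_higher hh.homogeneous ?_ _).const_mul_left _
    have := Finset.mem_range.1 hm
    have := hd (by omega)
    omega
  refine h1.congr' ?_ EventuallyEq.rfl
  filter_upwards [eventually_snd_pos] with p hp
  rw [scaledMoment_nsq_pow_mul hN hh j hs hp, ← Finset.sum_range_add_sum_Ico _ hq]
  ring

/-- Expansion of the radial moments. -/
lemma hasExpansion_nsq (G : E N → ℝ) (hN : 2 ≤ N) (j : ℕ) {s : ℝ}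
    (hs : (N : ℝ) + 2 * j + 1 ≤ 2 * s) :
    HasExpansion G (scaledMoment s (nsq ^ j))
      (fun l => radialMoment N j s * l ^ (2 * (N : ℝ) - 4 - 2 * s + 2 * j))
      (j * (2 * j + N - 2) / N * radialMoment N (j - 1) s) 0 := by
  rcases j with _ | j
  · have h1 := isLittleO_scaledMoment_sub hN isSolidHarmonic_one 0 (s := s)
      (by push_cast at hs ⊢; linarith) (q := 0) (by omega) (by omega)
    refine IsLittleO.congr_left h1 fun p => ?_
    have := pizzettiCoeff_mul_lapCoeff_self hN 0 (s := s) hs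
    simp [← this]
  · have hs' := hs
    push_cast at hs'
    -- For the power j + 1, keeping m ≥ j retains the |ξ|² term and the term independent of ξ; the
    -- power of λ in the former is then set to 1.
    have h1 := isLittleO_scaledMoment_sub hN isSolidHarmonic_one (j + 1) (s := s)
      (by push_cast at hs ⊢; linarith) (q := j) (by omega) (by omega)
    have h2 := (isLittleO_rpow_sub_one (isHomogeneous_nsq (N := N))
      (2 * (N : ℝ) - 4 - 2 * s + 2 * j)).const_mul_left
      (pizzettiCoeff N 1 s j * lapCoeff N 0 (j + 1) j)
    refine (h1.add h2).congr_left fun p => ?_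
    have e1 := pizzettiCoeff_mul_lapCoeff_self hN (j + 1) (s := s) hs
    have e2 := pizzettiCoeff_mul_lapCoeff_self hN j (s := s) (by linarith)
    rw [Finset.sum_Ico_succ_top (by omega), Finset.sum_Ico_succ_top (by omega), Finset.Ico_self,
      Finset.sum_empty, mul_one, e1, lapCoeff_zero_pred hN]
    rw [Nat.add_sub_cancel, ← e2]
    rw [show j + 1 - j = 1 by omega, Nat.sub_self]
    simp only [polyFun_one, polyFun_nsq]
    push_cast
    ring

/-- Leading term for a harmonic factor of degree two. -/
lemma isLittleO_scaledMoment_two (hN : 2 ≤ N) {h : Poly N} (hh : IsSolidHarmonic h 2) (j : ℕ)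
    {s : ℝ} (hs : (N : ℝ) + (2 * j + 2) + 1 ≤ 2 * s) :
    (fun p : E N × ℝ => scaledMoment s (nsq ^ j * h) p -
      radialMoment N j s * ((2 * j + N) * (2 * j + N + 2) / (N * (N + 2))) * polyFun h p.1)
      =o[𝓝 (0, 1)] fun p => ‖p.1‖ ^ 2 := by
  have h1 := isLittleO_scaledMoment_sub hN hh j (s := s)
    (by push_cast; linarith) (q := j) (by omega) (by omega)
  have h2 := (isLittleO_rpow_sub_one hh.homogeneous
    (2 * (N : ℝ) - 4 - 2 * s + 2 * j)).const_mul_left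
    (pizzettiCoeff N 1 s j * lapCoeff N 2 j j)
  refine (h1.add h2).congr_left fun p => ?_
  rw [Finset.sum_Ico_succ_top (by omega), Finset.Ico_self, Finset.sum_empty,
    ← pizzettiCoeff_mul_lapCoeff_self hN j (s := s) (by linarith), lapCoeff_two_self hN]
  simp
  ring

/-- Harmonic factors of degree at least three do not contribute. -/
lemma isLittleO_scaledMoment_three (hN : 2 ≤ N) {h : Poly N} {d : ℕ} (hh : IsSolidHarmonic h d)
    (hd : 3 ≤ d) (j : ℕ) {s : ℝ} (hs : (N : ℝ) + (2 * j + d) + 1 ≤ 2 * s) :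
    (fun p : E N × ℝ => scaledMoment s (nsq ^ j * h) p) =o[𝓝 (0, 1)] fun p => ‖p.1‖ ^ 2 := by
  have h1 := isLittleO_scaledMoment_sub hN hh j (s := s)
    hs (q := j + 1) (by omega) (by omega)
  simpa using h1

end PaneitzBlowup
end

noncomputable section

namespace PaneitzBlowup

open MvPolynomial MeasureTheory Asymptotics Filter

variable {N : ℕ}

/-! ### Sums of squares of harmonic quadratic forms -/

/-- The commutator of two derivations is a derivation, so it vanishes once it kills the variables.
-/
lemma pderiv_comm (i j : Fin N) (P : Poly N) : pderiv i (pderiv j P) = pderiv j (pderiv i P) := by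
  have : ⁅(pderiv i : Derivation ℝ (Poly N) (Poly N)), (pderiv j : Derivation ℝ (Poly N) (Poly N))⁆ = 0 := by
    refine derivation_ext fun k => ?_
    rw [Derivation.commutator_apply]
    simp [pderiv_X, Pi.single_apply, apply_ite]
  have h := congrArg (fun D : Derivation ℝ (Poly N) (Poly N) => D P) this
  simpa [Derivation.commutator_apply, sub_eq_zero] using h

lemma lap_pderiv (i : Fin N) (P : Poly N) : lap (pderiv i P) = pderiv i (lap P) := by
  simp only [lap_apply, map_sum]
  refine Finset.sum_congr rfl fun j _ => ?_
  rw [pderiv_comm j i, pderiv_comm j i]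

lemma lap_mul (P Q : Poly N) :
    lap (P * Q) = P * lap Q + Q * lap P + 2 * ∑ i, pderiv i P * pderiv i Q := by
  simp only [lap_apply, Finset.mul_sum, ← Finset.sum_add_distrib]
  refine Finset.sum_congr rfl fun i _ => ?_
  simp only [Derivation.leibniz, map_add, smul_eq_mul]
  ring

section Family

variable {ι : Type*} [Fintype ι]

/-- `∑ q_e²`. -/
def sqSum (q : ι → Poly N) : Poly N := ∑ e, q e * q e

/-- `∑ |∇ q_e|²`. -/
def gradSum (q : ι → Poly N) : Poly N := ∑ e, ∑ a, pderiv a (q e) * pderiv a (q e)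

/-- `∑ |∇² q_e|²`, for quadratic forms `q_e`. -/
def hessSum (q : ι → Poly N) : ℝ :=
  ∑ e, ∑ a, ∑ b, polyFun (pderiv b (pderiv a (q e))) 0 ^ 2

variable {q : ι → Poly N}

/-- For harmonic q one has Δ(q²) = 2|∇q|², and ∇q is again harmonic, so a second Laplacian gives the
constant 2|∇²q|². Hence ∑ q², ∑ |∇q|² and constants are closed under Δ. -/
lemma lap_sqSum (hq : ∀ e, IsSolidHarmonic (q e) 2) : lap (sqSum q) = 2 * gradSum q := by
  simp only [sqSum, gradSum, map_sum, lap_mul, (hq _).harmonic, Finset.mul_sum]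
  simp

lemma lap_gradSum (hq : ∀ e, IsSolidHarmonic (q e) 2) : lap (gradSum q) = C (2 * hessSum q) := by
  simp only [hessSum, gradSum, map_sum, lap_mul, lap_pderiv, (hq _).harmonic, Finset.mul_sum,
    map_zero, mul_zero, zero_add, C_mul]
  refine Finset.sum_congr rfl fun e _ => Finset.sum_congr rfl fun a _ =>
    Finset.sum_congr rfl fun b _ => ?_
  have h : (pderiv b (pderiv a (q e))).IsHomogeneous 0 :=
    isHomogeneous_pderiv (isHomogeneous_pderiv (hq e).homogeneous a) b
  obtain ⟨c, hc⟩ : ∃ c, pderiv b (pderiv a (q e)) = C c :=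
    ⟨_, totalDegree_eq_zero_iff_eq_C.1 (Nat.le_zero.1 h.totalDegree_le)⟩
  rw [hc]
  simp [map_ofNat C]
  ring

lemma isHomogeneous_sqSum (hq : ∀ e, IsSolidHarmonic (q e) 2) : (sqSum q).IsHomogeneous 4 :=
  IsHomogeneous.sum _ _ _ fun e _ => (hq e).homogeneous.mul (hq e).homogeneous

lemma isHomogeneous_gradSum (hq : ∀ e, IsSolidHarmonic (q e) 2) : (gradSum q).IsHomogeneous 2 :=
  IsHomogeneous.sum _ _ _ fun e _ => IsHomogeneous.sum _ _ _ fun a _ =>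
    (isHomogeneous_pderiv (hq e).homogeneous a).mul (isHomogeneous_pderiv (hq e).homogeneous a)

lemma isHomogeneous_C_mul' {P : Poly N} {d : ℕ} (h : P.IsHomogeneous d) (c : ℝ) :
    (C c * P).IsHomogeneous d := by
  simpa using (isHomogeneous_C (Fin N) c).mul h

lemma lap_C_mul (c : ℝ) (P : Poly N) : lap (C c * P) = C c * lap P := by
  rw [← smul_eq_C_mul, map_smul, smul_eq_C_mul]

lemma lap_nsq : lap (nsq : Poly N) = C (2 * (N : ℝ)) := by
  have := lap_nsq_pow_mul (N := N) isSolidHarmonic_one 0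
  simpa using this

/-- The harmonic part of degree two. -/
lemma isSolidHarmonic_gradSum_sub (hq : ∀ e, IsSolidHarmonic (q e) 2) (hN : 2 ≤ N) :
    IsSolidHarmonic (gradSum q - C (hessSum q / N) * nsq) 2 := by
  refine ⟨(isHomogeneous_gradSum hq).sub (isHomogeneous_C_mul' isHomogeneous_nsq _), ?_⟩
  have : (N : ℝ) ≠ 0 := by positivity
  rw [map_sub, lap_gradSum hq, lap_C_mul, lap_nsq, ← C_mul, sub_eq_zero]
  congr 1
  field_simp

/-- The harmonic part of degree four. -/
lemma isSolidHarmonic_sqSum_sub (hq : ∀ e, IsSolidHarmonic (q e) 2) (hN : 2 ≤ N) :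
    IsSolidHarmonic (sqSum q - C (1 / ((N : ℝ) + 4)) * (nsq * (gradSum q - C (hessSum q / N) * nsq))
      - C (hessSum q / (2 * N * (N + 2))) * nsq ^ 2) 4 := by
  have hN0 : (N : ℝ) ≠ 0 := by positivity
  have hN2 : (N : ℝ) + 2 ≠ 0 := by positivity
  have hN4 : (N : ℝ) + 4 ≠ 0 := by positivity
  have h2 := isSolidHarmonic_gradSum_sub hq hN
  refine ⟨((isHomogeneous_sqSum hq).sub (isHomogeneous_C_mul' (isHomogeneous_nsq.mul
    h2.homogeneous) _)).sub (isHomogeneous_C_mul' (isHomogeneous_nsq.pow 2) _), ?_⟩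
  have e1 := lap_nsq_pow_mul h2 0
  have e2 := lap_nsq_pow_mul (N := N) isSolidHarmonic_one 1
  simp only [zero_add, pow_one, pow_zero, one_mul, mul_one] at e1 e2
  rw [map_sub, map_sub, lap_C_mul, lap_C_mul, lap_sqSum hq, e1, e2]
  rw [← mul_assoc (C (1 / ((N : ℝ) + 4))), ← C_mul,
    ← mul_assoc (C (hessSum q / (2 * (N : ℝ) * (N + 2)))), ← C_mul]
  -- The constants are chosen to cancel Δ(∑ q²) = 2∑ |∇q|²: the first removes the harmonic part of ∑
  -- |∇q|², the second the remaining multiple of |y|².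
  have c1 : 1 / ((N : ℝ) + 4) * (2 * (((0 : ℕ) : ℝ) + 1) * (2 * ((0 : ℕ) : ℝ) + N + 2 * (2 : ℕ)))
      = 2 := by
    push_cast; field_simp; ring
  have c2 : hessSum q / (2 * N * (N + 2)) * (2 * (((1 : ℕ) : ℝ) + 1)
      * (2 * ((1 : ℕ) : ℝ) + N + 2 * (0 : ℕ))) = 2 * (hessSum q / N) := by
    push_cast; field_simp; ring
  rw [c1, c2, map_ofNat C]
  simp only [C_mul, map_ofNat C]
  ring

/-- The coefficient of `h(ξ)` in the moment of `|y|^(2j) h`, for `h` harmonic of degree two. -/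
def kappa (N j : ℕ) (s : ℝ) : ℝ :=
  radialMoment N j s * ((2 * j + N) * (2 * j + N + 2) / (N * (N + 2)))

lemma scaledMoment_add {s : ℝ} {P Q : Poly N} {p : E N × ℝ} (hp : 0 < p.2)
    (hP : (N : ℝ) + P.totalDegree < 2 * s) (hQ : (N : ℝ) + Q.totalDegree < 2 * s) :
    scaledMoment s (P + Q) p = scaledMoment s P p + scaledMoment s Q p := by
  have hP' : ((trans p.1 P).totalDegree : ℝ) ≤ P.totalDegree := by
    exact_mod_cast totalDegree_trans_le _ _
  have hQ' : ((trans p.1 Q).totalDegree : ℝ) ≤ Q.totalDegree := by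
    exact_mod_cast totalDegree_trans_le _ _
  rw [scaledMoment, map_add, moment_add hp (by linarith) (by linarith), mul_add]
  rfl

lemma scaledMoment_C_mul (s c : ℝ) (P : Poly N) (p : E N × ℝ) :
    scaledMoment s (C c * P) p = c * scaledMoment s P p := by
  rw [scaledMoment, map_mul, trans_C, moment_C_mul, scaledMoment]
  ring

lemma scaledMoment_sum {ι : Type*} (t : Finset ι) {s : ℝ} {P : ι → Poly N} {p : E N × ℝ}
    (hp : 0 < p.2) (hP : ∀ i ∈ t, (N : ℝ) + (P i).totalDegree < 2 * s) :
    scaledMoment s (∑ i ∈ t, P i) p = ∑ i ∈ t, scaledMoment s (P i) p := by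
  rw [scaledMoment, map_sum, moment_sum hp, Finset.mul_sum]
  · rfl
  intro i hi
  have hP' : ((trans p.1 (P i)).totalDegree : ℝ) ≤ (P i).totalDegree := by
    exact_mod_cast totalDegree_trans_le _ _
  linarith [hP i hi]

/-- Splits ∑ |∇q|² into a harmonic form of degree two and (ω/N)|y|², with ω = `hessSum q`. The
harmonic form contributes κ(G - (ω/N)|ξ|²), which explains the negative summand in the coefficient
of |ξ|². -/
lemma hasExpansion_gradSum (hq : ∀ e, IsSolidHarmonic (q e) 2) (hN : 2 ≤ N) (j : ℕ) {s : ℝ}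
    (hs : (N : ℝ) + (2 * j + 2) + 1 ≤ 2 * s) :
    HasExpansion (polyFun (gradSum q)) (scaledMoment s (nsq ^ j * gradSum q))
      (fun l => hessSum q / N * (radialMoment N (j + 1) s
        * l ^ (2 * (N : ℝ) - 4 - 2 * s + 2 * (j + 1))))
      (hessSum q / N * ((j + 1) * (2 * j + N) / N * radialMoment N j s)
        - hessSum q / N * kappa N j s)
      (kappa N j s) := by
  have h2 := isSolidHarmonic_gradSum_sub hq hN
  have e1 := hasExpansion_nsq (polyFun (gradSum q)) hN (j + 1) (s := s) (by push_cast; linarith)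
  have e2 := isLittleO_scaledMoment_two hN h2 j hs
  refine ((IsLittleO.const_mul_left e1 (hessSum q / N)).add e2).congr' ?_ EventuallyEq.rfl
  filter_upwards [eventually_snd_pos] with p hp
  have d1 : ((nsq ^ j * (gradSum q - C (hessSum q / N) * nsq)).totalDegree : ℝ) ≤ 2 * j + 2 := by
    exact_mod_cast ((isHomogeneous_nsq.pow j).mul h2.homogeneous).totalDegree_le
  have d2 : ((C (hessSum q / N) * nsq ^ (j + 1) : Poly N).totalDegree : ℝ) ≤ 2 * (j + 1) := by
    exact_mod_cast (isHomogeneous_C_mul' (isHomogeneous_nsq.pow (j + 1)) _).totalDegree_le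
  have hsplit : (nsq ^ j * gradSum q) = nsq ^ j * (gradSum q - C (hessSum q / N) * nsq)
      + C (hessSum q / N) * nsq ^ (j + 1) := by ring
  rw [hsplit, scaledMoment_add hp (by linarith) (by linarith), scaledMoment_C_mul]
  simp only [polyFun_sub, polyFun_mul, polyFun_C, polyFun_nsq, kappa, Nat.add_sub_cancel]
  push_cast
  ring

/-- In the splitting of ∑ q² into harmonics of degree 4, 2 and 0 times radial powers, degree four is
o(|ξ|²), degree two gives G and a multiple of |ξ|², and degree zero is a radial moment. -/
lemma hasExpansion_sqSum (hq : ∀ e, IsSolidHarmonic (q e) 2) (hN : 2 ≤ N) (j : ℕ) {s : ℝ}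
    (hs : (N : ℝ) + (2 * j + 4) + 1 ≤ 2 * s) :
    HasExpansion (polyFun (gradSum q)) (scaledMoment s (nsq ^ j * sqSum q))
      (fun l => hessSum q / (2 * N * (N + 2)) * (radialMoment N (j + 2) s
        * l ^ (2 * (N : ℝ) - 4 - 2 * s + 2 * (j + 2))))
      (hessSum q / (2 * N * (N + 2)) * ((j + 2) * (2 * j + N + 2) / N * radialMoment N (j + 1) s)
        - hessSum q / N * (kappa N (j + 1) s / (N + 4)))
      (kappa N (j + 1) s / (N + 4)) := by
  have h2 := isSolidHarmonic_gradSum_sub hq hN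
  have h4 := isSolidHarmonic_sqSum_sub hq hN
  have e1 := hasExpansion_nsq (polyFun (gradSum q)) hN (j + 2) (s := s) (by push_cast; linarith)
  have e2 := isLittleO_scaledMoment_two hN h2 (j + 1) (s := s) (by push_cast; linarith)
  have e3 := isLittleO_scaledMoment_three hN h4 (by norm_num) j (s := s) hs
  refine (((IsLittleO.const_mul_left e1 (hessSum q / (2 * N * (N + 2)))).add
    (IsLittleO.const_mul_left e2 (1 / ((N : ℝ) + 4)))).add e3).congr' ?_ EventuallyEq.rfl
  filter_upwards [eventually_snd_pos] with p hp
  have hsplit : (nsq ^ j * sqSum q) =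
      nsq ^ j * (sqSum q - C (1 / ((N : ℝ) + 4)) * (nsq * (gradSum q - C (hessSum q / N) * nsq))
        - C (hessSum q / (2 * N * (N + 2))) * nsq ^ 2)
      + (C (1 / ((N : ℝ) + 4)) * (nsq ^ (j + 1) * (gradSum q - C (hessSum q / N) * nsq))
      + C (hessSum q / (2 * N * (N + 2))) * nsq ^ (j + 2)) := by ring
  have d1 := ((isHomogeneous_nsq.pow j).mul h4.homogeneous).totalDegree_le
  have d2 := (isHomogeneous_C_mul' ((isHomogeneous_nsq.pow (j + 1)).mul h2.homogeneous)
    (1 / ((N : ℝ) + 4))).totalDegree_le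
  have d3 := (isHomogeneous_C_mul' (isHomogeneous_nsq.pow (j + 2) : (nsq ^ (j + 2) : Poly N).IsHomogeneous _)
    (hessSum q / (2 * N * (N + 2)))).totalDegree_le
  have d2' := (totalDegree_add (C (1 / ((N : ℝ) + 4)) * (nsq ^ (j + 1) *
    (gradSum q - C (hessSum q / N) * nsq))) (C (hessSum q / (2 * N * (N + 2))) * nsq ^ (j + 2)))
  rify at d1 d2 d3 d2'
  have hj : (2 * ((j : ℝ) + 2)) = 2 * j + 4 := by ring
  rw [hsplit, scaledMoment_add hp (by linarith), scaledMoment_add hp (by linarith) (by linarith),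
    scaledMoment_C_mul, scaledMoment_C_mul]
  · simp only [polyFun_sub, polyFun_mul, polyFun_C, polyFun_nsq, kappa,
      show j + 2 - 1 = j + 1 by omega]
    push_cast
    ring
  · have : max ((C (1 / ((N : ℝ) + 4)) * (nsq ^ (j + 1) *
        (gradSum q - C (hessSum q / N) * nsq))).totalDegree : ℝ)
        ((C (hessSum q / (2 * N * (N + 2))) * nsq ^ (j + 2) : Poly N).totalDegree : ℝ) ≤ 2 * j + 4 :=
      max_le (by linarith) (by linarith)
    linarith

end Family

/-! ### Polynomial radial factors -/

lemma aeval_nsq_mul (φ : Polynomial ℝ) {D : ℕ} (hφ : φ.natDegree < D) (P : Poly N) :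
    Polynomial.aeval nsq φ * P = ∑ j ∈ Finset.range D, C (φ.coeff j) * (nsq ^ j * P) := by
  rw [Polynomial.aeval_eq_sum_range' hφ, Finset.sum_mul]
  refine Finset.sum_congr rfl fun j _ => ?_
  rw [smul_eq_C_mul, mul_assoc]

lemma HasExpansion.aeval_nsq_mul {G : E N → ℝ} {P : Poly N} {d : ℕ} (hP : P.IsHomogeneous d)
    (φ : Polynomial ℝ) {D : ℕ} (hφ : φ.natDegree < D) {s : ℝ}
    (hs : (N : ℝ) + (2 * D + d) - 1 ≤ 2 * s) {a : ℕ → ℝ → ℝ} {b c : ℕ → ℝ}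
    (h : ∀ j < D, HasExpansion G (scaledMoment s (nsq ^ j * P)) (a j) (b j) (c j)) :
    HasExpansion G (scaledMoment s (Polynomial.aeval nsq φ * P))
      (fun l => ∑ j ∈ Finset.range D, φ.coeff j * a j l)
      (∑ j ∈ Finset.range D, φ.coeff j * b j) (∑ j ∈ Finset.range D, φ.coeff j * c j) := by
  have h1 := HasExpansion.sum fun j (hj : j ∈ Finset.range D) =>
    (h j (Finset.mem_range.1 hj)).const_mul (φ.coeff j)
  refine h1.congr' ?_ (fun _ _ => rfl) rfl rfl
  filter_upwards [eventually_snd_pos] with p hp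
  rw [PaneitzBlowup.aeval_nsq_mul φ hφ, scaledMoment_sum _ hp]
  · simp only [scaledMoment_C_mul]
  · intro j hj
    have d1 := (isHomogeneous_C_mul' ((isHomogeneous_nsq.pow j).mul hP) (φ.coeff j)).totalDegree_le
    have : j + 1 ≤ D := Finset.mem_range.1 hj
    rify at d1 this
    linarith

/-- The value at `(0, 1)` of an expansion. -/
lemma HasExpansion.apply_zero_one {G : E N → ℝ} {T : E N × ℝ → ℝ} {a : ℝ → ℝ} {b c : ℝ}
    (h : HasExpansion G T a b c) (hG : G 0 = 0) : T (0, 1) = a 1 := by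
  have h1 := (isLittleO_iff.1 h one_pos).self_of_nhds
  simp [hG] at h1
  linarith

/-- By Pizzetti's formula the moment is a finite sum of powers of λ times polynomials in ξ. It
serves to freeze moments at (0, 1) when they are multiplied by ξ_i ξ_j. -/
lemma continuousAt_scaledMoment (hN : 2 ≤ N) (P : Poly N) {s : ℝ}
    (hs : (N : ℝ) + P.totalDegree + 1 ≤ 2 * s) :
    ContinuousAt (scaledMoment s P) (0, 1) := by
  have h1 : ContinuousAt (fun p : E N × ℝ => p.2 ^ ((N : ℝ) - 4) *
      ∑ m ∈ Finset.range (P.totalDegree + 1), p.2 ^ ((N : ℝ) - 2 * s + 2 * m)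
        * pizzettiCoeff N 1 s m * polyFun (lap^[m] P) p.1) (0, 1) := by
    refine (continuousAt_snd.rpow_const (Or.inl one_ne_zero)).mul
      (tendsto_finsetSum _ fun m _ => ?_)
    exact ((continuousAt_snd.rpow_const (Or.inl one_ne_zero)).mul continuousAt_const).mul
      ((continuous_polyFun _).comp continuous_fst).continuousAt
  refine h1.congr ?_
  filter_upwards [eventually_snd_pos] with p hp
  rw [scaledMoment, moment_trans hN le_rfl hp hs]
  simp only [pizzettiCoeff_scaling hp]

end PaneitzBlowup
end

noncomputable section

namespace PaneitzBlowup

open MvPolynomial MeasureTheory Asymptotics Filter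

variable {N : ℕ}

/-! ### The tensor `H` -/

/-- The polynomial `H_ij`. -/
def Hpoly (W : Fin N → Fin N → Fin N → Fin N → ℝ) (i j : Fin N) : Poly N :=
  ∑ p, ∑ q, C (W i p j q) * (X p * X q)

/-- The quartic as a polynomial. -/
def quarticPoly (τ : ℝ) : Polynomial ℝ :=
  Polynomial.C τ - Polynomial.C 12000 * Polynomial.X + Polynomial.C 2411 * Polynomial.X ^ 2
    - Polynomial.C 135 * Polynomial.X ^ 3 + Polynomial.X ^ 4

/-- The radial polynomial `φ(|y|²)`. -/
def radial (N : ℕ) (φ : Polynomial ℝ) : Poly N := Polynomial.aeval nsq φ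

lemma polyFun_radial (φ : Polynomial ℝ) (y : E N) :
    polyFun (radial N φ) y = φ.eval (‖y‖ ^ 2) := by
  induction φ using Polynomial.induction_on' with
  | add p q hp hq => simp_all [radial]
  | monomial k c => simp [radial, Polynomial.aeval_monomial, algebraMap_eq]

lemma pderiv_radial (i : Fin N) (φ : Polynomial ℝ) :
    pderiv i (radial N φ) = 2 * radial N φ.derivative * X i := pderiv_aeval_nsq i φ

/-- The polynomial of `H̄_ij`. -/
def HbarPoly (φ : Polynomial ℝ) (W : Fin N → Fin N → Fin N → Fin N → ℝ) (i j : Fin N) : Poly N :=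
  radial N φ * Hpoly W i j

lemma Hbar_eq (τ : ℝ) (W : Fin N → Fin N → Fin N → Fin N → ℝ) (i j : Fin N) :
    Hbar τ W i j = polyFun (HbarPoly (quarticPoly τ) W i j) := by
  funext y
  simp [Hbar, HbarPoly, polyFun_radial, quarticPoly, quartic, Hq, Hpoly, mul_assoc]

/-- The polynomial `g` with `Δ(φ(|y|²) h) = g(|y|²) h` for harmonic quadratic forms `h`. -/
def lapRadial (N : ℕ) (φ : Polynomial ℝ) : Polynomial ℝ :=
  4 * Polynomial.X * φ.derivative.derivative + Polynomial.C (2 * N + 8 : ℝ) * φ.derivative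

section Weyl

variable {W : Fin N → Fin N → Fin N → Fin N → ℝ}

lemma isHomogeneous_Hpoly (i j : Fin N) : (Hpoly W i j).IsHomogeneous 2 :=
  IsHomogeneous.sum _ _ _ fun p _ => IsHomogeneous.sum _ _ _ fun q _ =>
    isHomogeneous_C_mul' ((isHomogeneous_X ℝ p).mul (isHomogeneous_X ℝ q)) _

lemma pderiv_Hpoly (a i j : Fin N) :
    pderiv a (Hpoly W i j) = ∑ q, C (W i a j q + W i q j a) * X q := by
  have h : ∀ p q, pderiv a (C (W i p j q) * (X p * X q) : Poly N) =
      (if q = a then C (W i p j q) * X p else 0) + if p = a then C (W i p j q) * X q else 0 := by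
    intro p q
    rw [pderiv_C_mul, Derivation.leibniz, pderiv_X, pderiv_X]
    simp only [Pi.single_apply, smul_eq_mul, mul_ite, mul_one, mul_zero, mul_add]
  simp only [Hpoly, map_sum, h, Finset.sum_add_distrib, C_add, add_mul]
  rw [add_comm]
  congr 1
  · rw [Finset.sum_comm]
    simp
  · simp

lemma pderiv_pderiv_Hpoly (a b i j : Fin N) :
    pderiv b (pderiv a (Hpoly W i j)) = C (W i a j b + W i b j a) := by
  rw [pderiv_Hpoly]
  simp only [map_sum, pderiv_C_mul, pderiv_X, Pi.single_apply, mul_ite, mul_one, mul_zero]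
  simp

/-- Antisymmetric coefficients annihilate symmetric products. -/
lemma sum_antisymm_mul {R : Type*} [CommRing R] [Algebra ℝ R] {w : Fin N → Fin N → R}
    (hw : ∀ i j, w i j = -w j i) (x : Fin N → R) : ∑ i, ∑ j, w i j * (x i * x j) = 0 := by
  have h : ∑ i, ∑ j, w i j * (x i * x j) = -∑ i, ∑ j, w i j * (x i * x j) := by
    conv_lhs => rw [Finset.sum_comm]
    simp only [← Finset.sum_neg_distrib]
    refine Finset.sum_congr rfl fun i _ => Finset.sum_congr rfl fun j _ => ?_
    rw [hw j i]; ring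
  have h2 : (2 : ℝ) • ∑ i, ∑ j, w i j * (x i * x j) = 0 := by
    rw [two_smul]
    nth_rw 1 [h]
    exact neg_add_cancel _
  have := congrArg (fun t => (1 / 2 : ℝ) • t) h2
  simpa [smul_smul] using this

lemma Hpoly_symm (hW : IsWeylTensor W) (i j : Fin N) : Hpoly W i j = Hpoly W j i := by
  rw [Hpoly, Finset.sum_comm, Hpoly]
  refine Finset.sum_congr rfl fun p _ => Finset.sum_congr rfl fun q _ => ?_
  rw [hW.pair_symm i q j p, mul_comm (X q)]

lemma IsWeylTensor.trace' (hW : IsWeylTensor W) (i j : Fin N) : ∑ a, W i a j a = 0 := by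
  rw [← hW.trace_free i j]
  refine Finset.sum_congr rfl fun a _ => ?_
  rw [hW.antisymm_left, hW.antisymm_right, neg_neg]

lemma isSolidHarmonic_Hpoly (hW : IsWeylTensor W) (i j : Fin N) :
    IsSolidHarmonic (Hpoly W i j) 2 := by
  refine ⟨isHomogeneous_Hpoly i j, ?_⟩
  simp only [lap_apply, pderiv_pderiv_Hpoly, ← map_sum, Finset.sum_add_distrib, hW.trace']
  simp

/-- The pair (i, p), in which W is antisymmetric, is contracted with the symmetric product y_i y_p.
-/
lemma sum_X_mul_Hpoly (hW : IsWeylTensor W) (j : Fin N) : ∑ i, X i * Hpoly W i j = 0 := by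
  have h : ∀ q, ∑ i, ∑ p, (C (W i p j q) : Poly N) * (X i * X p) = 0 := fun q =>
    sum_antisymm_mul (fun i p => by rw [hW.antisymm_left, map_neg]) _
  simp only [Hpoly, Finset.mul_sum]
  have h2 : ∀ i, ∑ p, ∑ q, X i * (C (W i p j q) * (X p * X q))
      = ∑ q, (∑ p, (C (W i p j q) : Poly N) * (X i * X p)) * X q := fun i => by
    rw [Finset.sum_comm]
    simp only [Finset.sum_mul]
    refine Finset.sum_congr rfl fun p _ => Finset.sum_congr rfl fun q _ => ?_
    ring
  simp only [h2]
  rw [Finset.sum_comm]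
  simp only [← Finset.sum_mul, h]
  simp

lemma sum_Hpoly_diag (hW : IsWeylTensor W) : ∑ i, Hpoly W i i = 0 := by
  simp only [Hpoly]
  rw [Finset.sum_comm]
  refine Finset.sum_eq_zero fun p _ => ?_
  rw [Finset.sum_comm]
  refine Finset.sum_eq_zero fun q _ => ?_
  rw [← Finset.sum_mul, ← map_sum, hW.trace_free]
  simp

/-- The derivative leaves two contractions of W: one over its antisymmetric first pair and one that
is a trace. Both vanish. -/
lemma sum_pderiv_Hpoly (hW : IsWeylTensor W) (j : Fin N) :
    ∑ i, pderiv i (Hpoly W i j) = 0 := by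
  simp only [pderiv_Hpoly]
  rw [Finset.sum_comm]
  refine Finset.sum_eq_zero fun q _ => ?_
  rw [← Finset.sum_mul, ← map_sum, Finset.sum_add_distrib]
  have h1 : ∑ i, W i i j q = 0 := Finset.sum_eq_zero fun i _ => by
    have := hW.antisymm_left i i j q
    linarith
  have h2 : ∑ i, W i q j i = 0 := by
    have := hW.trace_free q j
    simp only [hW.antisymm_right _ q j _, Finset.sum_neg_distrib, this, neg_zero]
  rw [h1, h2]
  simp

/-- `∑ ∂_s H_ij(y) z_i z_j z_s = 0`. -/
lemma sum_pderiv_Hpoly_mul (hW : IsWeylTensor W) (y : E N) (z : Fin N → ℝ) :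
    ∑ i, ∑ j, ∑ s, polyFun (pderiv s (Hpoly W i j)) y * (z i * z j * z s) = 0 := by
  -- Each of the two terms of ∂_s H_ij has the differentiated index s in an antisymmetric pair with
  -- i or with j, and z is contracted with both.
  have h1 : ∀ j q, ∑ i, ∑ s, W i s j q * (z i * z s) = 0 := fun j q =>
    sum_antisymm_mul (fun i s => hW.antisymm_left i s j q) z
  have h2 : ∀ i q, ∑ j, ∑ s, W i q j s * (z j * z s) = 0 := fun i q =>
    sum_antisymm_mul (fun j s => hW.antisymm_right i q j s) z
  have e : ∀ i j s, polyFun (pderiv s (Hpoly W i j)) y * (z i * z j * z s)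
      = (∑ q, W i s j q * (z i * z s) * (y q * z j))
        + ∑ q, W i q j s * (z j * z s) * (y q * z i) := fun i j s => by
    rw [pderiv_Hpoly]
    simp only [polyFun_sum, polyFun_mul, polyFun_C, polyFun_X, Finset.sum_mul,
      ← Finset.sum_add_distrib]
    refine Finset.sum_congr rfl fun q _ => ?_
    ring
  simp only [e, Finset.sum_add_distrib]
  have t1 : ∑ i, ∑ j, ∑ s, ∑ q, W i s j q * (z i * z s) * (y q * z j) = 0 := by
    rw [Finset.sum_comm]
    refine Finset.sum_eq_zero fun j _ => ?_
    have : ∀ i, ∑ s, ∑ q, W i s j q * (z i * z s) * (y q * z j)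
        = ∑ q, (∑ s, W i s j q * (z i * z s)) * (y q * z j) := fun i => by
      rw [Finset.sum_comm]; simp only [Finset.sum_mul]
    simp only [this]
    rw [Finset.sum_comm]
    simp only [← Finset.sum_mul, h1, zero_mul, Finset.sum_const_zero]
  have t2 : ∑ i, ∑ j, ∑ s, ∑ q, W i q j s * (z j * z s) * (y q * z i) = 0 := by
    refine Finset.sum_eq_zero fun i _ => ?_
    have : ∀ j, ∑ s, ∑ q, W i q j s * (z j * z s) * (y q * z i)
        = ∑ q, (∑ s, W i q j s * (z j * z s)) * (y q * z i) := fun j => by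
      rw [Finset.sum_comm]; simp only [Finset.sum_mul]
    simp only [this]
    rw [Finset.sum_comm]
    simp only [← Finset.sum_mul, h2, zero_mul, Finset.sum_const_zero]
  rw [t1, t2, add_zero]

/-! ### The tensor `φ(|y|²) H` -/

variable (φ : Polynomial ℝ)

lemma HbarPoly_symm (hW : IsWeylTensor W) (i j : Fin N) : HbarPoly φ W i j = HbarPoly φ W j i := by
  rw [HbarPoly, Hpoly_symm hW, HbarPoly]

lemma pderiv_HbarPoly (s i j : Fin N) : pderiv s (HbarPoly φ W i j) =
    2 * radial N φ.derivative * X s * Hpoly W i j + radial N φ * pderiv s (Hpoly W i j) := by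
  rw [HbarPoly, Derivation.leibniz, pderiv_radial, smul_eq_mul, smul_eq_mul]
  ring

/-- H_ij is harmonic of degree two, so Δ acts on the radial factor only. Hence ΔH̄ inherits all the
contraction identities of H̄. -/
lemma lap_HbarPoly (hW : IsWeylTensor W) (i j : Fin N) :
    lap (HbarPoly φ W i j) = HbarPoly (lapRadial N φ) W i j := by
  rw [HbarPoly, radial, lap_aeval_nsq_mul φ (isHomogeneous_Hpoly i j),
    (isSolidHarmonic_Hpoly hW i j).harmonic, mul_zero, add_zero, HbarPoly, radial, lapRadial]
  norm_num

lemma sum_X_mul_HbarPoly (hW : IsWeylTensor W) (j : Fin N) :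
    ∑ i, X i * HbarPoly φ W i j = 0 := by
  have : ∀ i, X i * HbarPoly φ W i j = radial N φ * (X i * Hpoly W i j) := fun i => by
    rw [HbarPoly]; ring
  simp only [this, ← Finset.mul_sum, sum_X_mul_Hpoly hW, mul_zero]

lemma sum_HbarPoly_diag (hW : IsWeylTensor W) : ∑ i, HbarPoly φ W i i = 0 := by
  simp only [HbarPoly, ← Finset.mul_sum, sum_Hpoly_diag hW, mul_zero]

lemma sum_pderiv_HbarPoly (hW : IsWeylTensor W) (j : Fin N) :
    ∑ i, pderiv i (HbarPoly φ W i j) = 0 := by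
  have : ∀ i, pderiv i (HbarPoly φ W i j) = 2 * radial N φ.derivative * (X i * Hpoly W i j)
      + radial N φ * pderiv i (Hpoly W i j) := fun i => by
    rw [pderiv_HbarPoly]; ring
  simp only [this, Finset.sum_add_distrib, ← Finset.mul_sum, sum_X_mul_Hpoly hW,
    sum_pderiv_Hpoly hW, mul_zero, add_zero]

/-- The quadratic form `∑ H_ij(y) ξ_i ξ_j`. -/
def Hform (W : Fin N → Fin N → Fin N → Fin N → ℝ) (ξ y : E N) : ℝ :=
  ∑ i, ∑ j, polyFun (Hpoly W i j) y * (ξ i * ξ j)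

/-- Since y annihilates H̄(y), the vector y - ξ may be replaced by -ξ. This is the source of the
smallness in ξ of the bracket and of the terms with H̄_il H̄_jl. -/
lemma sum_HbarPoly_mul_sub (hW : IsWeylTensor W) (ξ y : E N) (j : Fin N) :
    ∑ i, polyFun (HbarPoly φ W i j) y * (y i - ξ i)
      = -∑ i, polyFun (HbarPoly φ W i j) y * ξ i := by
  have h := congrArg (fun P => polyFun P y) (sum_X_mul_HbarPoly φ hW j)
  simp only [polyFun_sum, polyFun_mul, polyFun_X, polyFun_zero] at h
  simp only [mul_sub, Finset.sum_sub_distrib]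
  simp only [mul_comm (polyFun (HbarPoly φ W _ j) y)] at *
  rw [h]; simp

lemma sum_HbarPoly_mul_sub_mul_sub (hW : IsWeylTensor W) (ξ y : E N) :
    ∑ i, ∑ j, polyFun (HbarPoly φ W i j) y * ((y i - ξ i) * (y j - ξ j))
      = φ.eval (‖y‖ ^ 2) * Hform W ξ y := by
  have h1 : ∀ j, ∑ i, polyFun (HbarPoly φ W i j) y * ((y i - ξ i) * (y j - ξ j))
      = -∑ i, polyFun (HbarPoly φ W i j) y * (ξ i * (y j - ξ j)) := fun j => by
    have := congrArg (· * (y j - ξ j)) (sum_HbarPoly_mul_sub φ hW ξ y j)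
    simp only [neg_mul, Finset.sum_mul] at this
    simpa only [mul_assoc] using this
  have h2 : ∀ i, ∑ j, polyFun (HbarPoly φ W i j) y * (ξ i * (y j - ξ j))
      = -∑ j, polyFun (HbarPoly φ W i j) y * (ξ i * ξ j) := fun i => by
    have := congrArg (ξ i * ·) (sum_HbarPoly_mul_sub φ hW ξ y i)
    simp only [mul_neg, Finset.mul_sum, HbarPoly_symm φ hW _ i] at this
    refine Eq.trans (Finset.sum_congr rfl fun j _ => ?_) (this.trans ?_)
    · ring
    · congr 1
      refine Finset.sum_congr rfl fun j _ => ?_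
      ring
  rw [Finset.sum_comm]
  simp only [h1]
  rw [Finset.sum_neg_distrib, Finset.sum_comm]
  simp only [h2]
  rw [Finset.sum_neg_distrib, neg_neg, Hform, Finset.mul_sum]
  refine Finset.sum_congr rfl fun i _ => ?_
  rw [Finset.mul_sum]
  refine Finset.sum_congr rfl fun j _ => ?_
  rw [HbarPoly, polyFun_mul, polyFun_radial]
  ring

end Weyl

end PaneitzBlowup
end

noncomputable section

namespace PaneitzBlowup

open MvPolynomial MeasureTheory Asymptotics Filter

variable {N : ℕ}

/-! ### Derivatives of the bubbles -/

lemma pd_sum {ι : Type*} (t : Finset ι) (f : ι → E N → ℝ) (i : Fin N) {y : E N}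
    (hf : ∀ k ∈ t, DifferentiableAt ℝ (f k) y) :
    pd i (fun z => ∑ k ∈ t, f k z) y = ∑ k ∈ t, pd i (f k) y := by
  simp only [pd]
  rw [fderiv_fun_sum hf]
  simp

lemma pd_sub_coord (i j : Fin N) (ξ : E N) (y : E N) :
    pd i (fun y : E N => y j - ξ j) y = if i = j then 1 else 0 := by
  have := pd_add i (f := fun y : E N => y j) (g := fun _ => -ξ j) (y := y)
    (differentiable_coord j y) (differentiableAt_const _)
  simp only [pd_coord, pd_const, add_zero, ← sub_eq_add_neg] at this
  exact this

lemma differentiable_sub_coord (j : Fin N) (ξ : E N) :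
    Differentiable ℝ (fun y : E N => y j - ξ j) := (differentiable_coord j).sub_const _

section Weight

variable {lam : ℝ} (ξ : E N) (s : ℝ)

lemma pd_coord_mul_wt (hl : 0 < lam) (i j : Fin N) :
    pd i (fun y : E N => (y j - ξ j) * wt lam s (y - ξ)) = fun y =>
      (if i = j then 1 else 0) * wt lam s (y - ξ)
        - 2 * s * ((y i - ξ i) * (y j - ξ j)) * wt lam (s + 1) (y - ξ) := by
  funext y
  rw [pd_mul i (differentiable_sub_coord j ξ y) (differentiable_wt hl s ξ y), pd_sub_coord,
    pd_wt hl]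
  ring

lemma pd_pd_wt (hl : 0 < lam) (i j : Fin N) :
    pd i (pd j (fun y : E N => wt lam s (y - ξ))) = fun y =>
      -(2 * s) * (if i = j then 1 else 0) * wt lam (s + 1) (y - ξ)
        + 4 * s * (s + 1) * ((y i - ξ i) * (y j - ξ j)) * wt lam (s + 2) (y - ξ) := by
  rw [pd_wt hl]
  funext y
  have h := pd_const_mul i (f := fun y : E N => (y j - ξ j) * wt lam (s + 1) (y - ξ))
    (-(2 * s)) ((differentiable_sub_coord j ξ y).mul (differentiable_wt hl (s + 1) ξ y))
  simp only [← mul_assoc] at h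
  rw [h, congrFun (pd_coord_mul_wt ξ (s + 1) hl i j) y, show s + 1 + 1 = s + 2 by ring]
  ring

lemma pd_coord_mul_coord_mul_wt (hl : 0 < lam) (i j k : Fin N) (y : E N) :
    pd i (fun y : E N => ((y j - ξ j) * (y k - ξ k)) * wt lam s (y - ξ)) y =
      ((if i = j then 1 else 0) * (y k - ξ k) + (if i = k then 1 else 0) * (y j - ξ j))
        * wt lam s (y - ξ)
        - 2 * s * ((y i - ξ i) * (y j - ξ j) * (y k - ξ k)) * wt lam (s + 1) (y - ξ) := by
  have h := pd_mul i (f := fun y : E N => (y j - ξ j)) (g := fun y => (y k - ξ k) * wt lam s (y - ξ))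
    (differentiable_sub_coord j ξ y)
    ((differentiable_sub_coord k ξ y).mul (differentiable_wt hl s ξ y))
  simp only [← mul_assoc] at h
  rw [h, pd_sub_coord, congrFun (pd_coord_mul_wt ξ s hl i k) y]
  ring

lemma pd_pd_pd_wt (hl : 0 < lam) (i j k : Fin N) :
    pd i (pd j (pd k (fun y : E N => wt lam s (y - ξ)))) = fun y =>
      4 * s * (s + 1) * ((if j = k then 1 else 0) * (y i - ξ i) + (if i = j then 1 else 0) * (y k - ξ k)
        + (if i = k then 1 else 0) * (y j - ξ j)) * wt lam (s + 2) (y - ξ)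
      - 8 * s * (s + 1) * (s + 2) * ((y i - ξ i) * (y j - ξ j) * (y k - ξ k))
        * wt lam (s + 3) (y - ξ) := by
  rw [pd_pd_wt ξ s hl]
  funext y
  have hw1 := differentiable_wt hl (s + 1) ξ y
  have hw2 := ((differentiable_sub_coord j ξ y).mul (differentiable_sub_coord k ξ y)).mul
    (differentiable_wt hl (s + 2) ξ y)
  have h := pd_add i (hw1.const_mul (-(2 * s) * (if j = k then 1 else 0)))
    (hw2.const_mul (4 * s * (s + 1)))
  rw [pd_const_mul i _ hw1, pd_const_mul i _ hw2, pd_wt hl] at h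
  have h2 := pd_coord_mul_coord_mul_wt ξ (s + 2) hl i j k y
  simp only [show s + 2 + 1 = s + 3 by ring, show s + 1 + 1 = s + 2 by ring] at h h2
  simp only [mul_assoc] at h h2 ⊢
  refine h.trans ?_
  change _ + 4 * (s * ((s + 1) *
    pd i (fun y : E N => (y j - ξ j) * ((y k - ξ k) * wt lam (s + 2) (y - ξ))) y)) = _
  rw [h2]
  ring

end Weight

/-- Half of `N - 4`. -/
def mN (N : ℕ) : ℝ := ((N : ℝ) - 4) / 2

/-- The constant in front of the bubble. -/
def bubbleConst (N : ℕ) (lam : ℝ) : ℝ := gammaN N * lam ^ mN N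

lemma bubble_eq {lam : ℝ} (hl : 0 < lam) (ξ : E N) :
    bubble ξ lam = fun y => bubbleConst N lam * wt lam (mN N) (y - ξ) := by
  funext y
  have := wt_base_pos hl (y - ξ)
  rw [bubble, bubbleConst, wt, mN, Real.div_rpow hl.le this.le, Real.rpow_neg this.le]
  ring

lemma contDiff_bubble {lam : ℝ} (hl : 0 < lam) (ξ : E N) {n : WithTop ℕ∞} :
    ContDiff ℝ n (bubble ξ lam) := by
  rw [bubble_eq hl]
  exact contDiff_const.mul (contDiff_wt hl _ ξ)

lemma contDiff_pd {f : E N → ℝ} (hf : ContDiff ℝ ∞ f) (i : Fin N) : ContDiff ℝ ∞ (pd i f) := by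
  have : ContDiff ℝ ∞ (fderiv ℝ f) := hf.fderiv_right (by simp)
  exact this.clm_apply contDiff_const

lemma differentiable_of_contDiff {f : E N → ℝ} (hf : ContDiff ℝ ∞ f) : Differentiable ℝ f :=
  hf.differentiable (by simp)

lemma pd_const_mul_fun {f : E N → ℝ} (hf : ContDiff ℝ ∞ f) (i : Fin N) (c : ℝ) :
    pd i (fun y => c * f y) = fun y => c * pd i f y :=
  funext fun y => pd_const_mul i c (differentiable_of_contDiff hf y)

section Bubble

variable {lam : ℝ} (ξ : E N)

lemma pd_bubble (hl : 0 < lam) (i : Fin N) : pd i (bubble ξ lam) = fun y =>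
    bubbleConst N lam * (-(2 * mN N) * (y i - ξ i) * wt lam (mN N + 1) (y - ξ)) := by
  rw [bubble_eq hl, pd_const_mul_fun (contDiff_wt hl _ ξ), pd_wt hl]

lemma pd_pd_bubble (hl : 0 < lam) (i j : Fin N) : pd i (pd j (bubble ξ lam)) = fun y =>
    bubbleConst N lam * (-(2 * mN N) * (if i = j then 1 else 0) * wt lam (mN N + 1) (y - ξ)
      + 4 * mN N * (mN N + 1) * ((y i - ξ i) * (y j - ξ j)) * wt lam (mN N + 2) (y - ξ)) := by
  have h := contDiff_wt hl (mN N) ξ (n := ∞)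
  rw [bubble_eq hl, pd_const_mul_fun h, pd_const_mul_fun (contDiff_pd h _), pd_pd_wt ξ _ hl]

lemma pd_pd_pd_bubble (hl : 0 < lam) (i j k : Fin N) :
    pd i (pd j (pd k (bubble ξ lam))) = fun y => bubbleConst N lam *
      (4 * mN N * (mN N + 1) * ((if j = k then 1 else 0) * (y i - ξ i)
        + (if i = j then 1 else 0) * (y k - ξ k)
        + (if i = k then 1 else 0) * (y j - ξ j)) * wt lam (mN N + 2) (y - ξ)
      - 8 * mN N * (mN N + 1) * (mN N + 2) * ((y i - ξ i) * (y j - ξ j) * (y k - ξ k))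
        * wt lam (mN N + 3) (y - ξ)) := by
  have h := contDiff_wt hl (mN N) ξ (n := ∞)
  rw [bubble_eq hl, pd_const_mul_fun h, pd_const_mul_fun (contDiff_pd h _),
    pd_const_mul_fun (contDiff_pd (contDiff_pd h _) _), pd_pd_pd_wt ξ _ hl]

lemma norm_sq_sub_eq (y ξ : E N) : ‖y - ξ‖ ^ 2 = ∑ k, (y k - ξ k) * (y k - ξ k) := by
  rw [EuclideanSpace.norm_sq_eq]
  refine Finset.sum_congr rfl fun k _ => ?_
  rw [Real.norm_eq_abs, sq_abs, sq]
  rfl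

/-- The factor |y - ξ|² is eliminated by writing it as (λ² + |y - ξ|²) - λ², and N = 2m + 4 with m =
`mN N` collects the coefficients. -/
lemma sum_pd_pd_pd_bubble (hl : 0 < lam) (i : Fin N) (y : E N) :
    ∑ k, pd i (pd k (pd k (bubble ξ lam))) y = bubbleConst N lam * (8 * mN N * (mN N + 1))
      * ((y i - ξ i) * wt lam (mN N + 2) (y - ξ)
        + (mN N + 2) * lam ^ 2 * ((y i - ξ i) * wt lam (mN N + 3) (y - ξ))) := by
  simp only [pd_pd_pd_bubble ξ hl]
  have h1 := base_mul_wt hl (mN N + 2) (y - ξ)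
  rw [show mN N + 2 + 1 = mN N + 3 by ring] at h1
  have h2 : ∑ k, (y i - ξ i) * (y k - ξ k) * (y k - ξ k) = (y i - ξ i) * ‖y - ξ‖ ^ 2 := by
    rw [norm_sq_sub_eq, Finset.mul_sum]
    exact Finset.sum_congr rfl fun k _ => by ring
  rw [← Finset.mul_sum, Finset.sum_sub_distrib, ← Finset.sum_mul, ← Finset.mul_sum,
    ← Finset.sum_mul, ← Finset.mul_sum, h2]
  simp only [if_true, Finset.sum_add_distrib, ite_mul, one_mul, zero_mul, Finset.sum_ite_eq,
    Finset.mem_univ, Finset.sum_const, Finset.card_univ, Fintype.card_fin, nsmul_eq_mul]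
  rw [← h1]
  have : (N : ℝ) = 2 * mN N + 4 := by rw [mN]; ring
  rw [this]
  ring

lemma sum_pd_pd_pd_pd_bubble (hl : 0 < lam) (i j : Fin N) (y : E N) :
    ∑ k, pd i (pd j (pd k (pd k (bubble ξ lam)))) y = bubbleConst N lam * (8 * mN N * (mN N + 1))
      * ((if i = j then 1 else 0) * (wt lam (mN N + 2) (y - ξ)
          + (mN N + 2) * lam ^ 2 * wt lam (mN N + 3) (y - ξ))
        - ((y i - ξ i) * (y j - ξ j)) * (2 * (mN N + 2) * wt lam (mN N + 3) (y - ξ)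
          + 2 * (mN N + 2) * (mN N + 3) * lam ^ 2 * wt lam (mN N + 4) (y - ξ))) := by
  have hb := contDiff_bubble hl ξ (n := ∞)
  rw [← pd_sum Finset.univ (fun k => pd j (pd k (pd k (bubble ξ lam)))) i fun k _ =>
    differentiable_of_contDiff (contDiff_pd (contDiff_pd (contDiff_pd hb _) _) _) y]
  simp only [sum_pd_pd_pd_bubble ξ hl]
  have d2 := (differentiable_sub_coord j ξ y).mul (differentiable_wt hl (mN N + 2) ξ y)
  have d3 := (differentiable_sub_coord j ξ y).mul (differentiable_wt hl (mN N + 3) ξ y)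
  have h := pd_const_mul i (bubbleConst N lam * (8 * mN N * (mN N + 1)))
    (d2.add (d3.const_mul ((mN N + 2) * lam ^ 2)))
  refine Eq.trans h ?_
  have h' := pd_add i d2 (d3.const_mul ((mN N + 2) * lam ^ 2))
  have e2 := congrFun (pd_coord_mul_wt ξ (mN N + 2) hl i j) y
  have e3 := congrFun (pd_coord_mul_wt ξ (mN N + 3) hl i j) y
  rw [pd_const_mul i _ d3] at h'
  refine Eq.trans (congrArg _ h') ?_
  have e2' : pd i ((fun y : E N => y j - ξ j) * fun y : E N => wt lam (mN N + 2) (y - ξ)) y = _ := e2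
  have e3' : pd i ((fun y : E N => y j - ξ j) * fun y : E N => wt lam (mN N + 3) (y - ξ)) y = _ := e3
  rw [e2', e3', show mN N + 2 + 1 = mN N + 3 by ring, show mN N + 3 + 1 = mN N + 4 by ring]
  ring

end Bubble

end PaneitzBlowup
end

noncomputable section

namespace PaneitzBlowup

open MvPolynomial MeasureTheory Asymptotics Filter

variable {N : ℕ} {W : Fin N → Fin N → Fin N → Fin N → ℝ}

/-! ### The bracket and the corrector term -/

/-- Derivatives of H itself cancel by `sum_pderiv_Hpoly_mul`; only the derivative of the radial
factor remains, and its contraction with y - ξ is quadratic in ξ. -/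
lemma sum_pderiv_HbarPoly_mul (φ : Polynomial ℝ) (hW : IsWeylTensor W) (ξ y : E N) :
    ∑ i, ∑ j, ∑ s, polyFun (pderiv s (HbarPoly φ W i j)) y
        * ((y i - ξ i) * (y j - ξ j) * (y s - ξ s))
      = 2 * (∑ s, y s * (y s - ξ s)) * (φ.derivative.eval (‖y‖ ^ 2) * Hform W ξ y) := by
  have h1 := sum_pderiv_Hpoly_mul hW y fun i => y i - ξ i
  have e : ∀ i j s, polyFun (pderiv s (HbarPoly φ W i j)) y
        * ((y i - ξ i) * (y j - ξ j) * (y s - ξ s)) =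
      polyFun (HbarPoly φ.derivative W i j) y * ((y i - ξ i) * (y j - ξ j))
        * (2 * (y s * (y s - ξ s)))
      + polyFun (radial N φ) y * (polyFun (pderiv s (Hpoly W i j)) y
        * ((y i - ξ i) * (y j - ξ j) * (y s - ξ s))) := fun i j s => by
    rw [pderiv_HbarPoly, HbarPoly]
    simp only [polyFun_add, polyFun_mul, polyFun_X, polyFun_two]
    ring
  simp only [e, Finset.sum_add_distrib, ← Finset.mul_sum, h1, mul_zero, add_zero]
  simp only [← Finset.sum_mul]
  rw [sum_HbarPoly_mul_sub_mul_sub φ.derivative hW]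
  ring

/-- Each Kronecker delta contracts ∂H̄ to a divergence or to the derivative of a trace, both zero.
-/
lemma sum_delta_terms (φ : Polynomial ℝ) (hW : IsWeylTensor W) (z : Fin N → ℝ) (y : E N) :
    ∑ i, ∑ j, ∑ s, polyFun (pderiv s (HbarPoly φ W i j)) y
        * ((if j = s then 1 else 0) * z i + (if i = j then 1 else 0) * z s
          + (if i = s then 1 else 0) * z j) = 0 := by
  have hdiv : ∀ j, ∑ i, polyFun (pderiv i (HbarPoly φ W i j)) y = 0 := fun j => by
    rw [← polyFun_sum, sum_pderiv_HbarPoly φ hW]; simp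
  have hdiv' : ∀ i, ∑ j, polyFun (pderiv j (HbarPoly φ W i j)) y = 0 := fun i => by
    simp only [HbarPoly_symm φ hW i]; exact hdiv i
  have htr : ∀ s, ∑ i, polyFun (pderiv s (HbarPoly φ W i i)) y = 0 := fun s => by
    rw [← polyFun_sum, ← map_sum, sum_HbarPoly_diag φ hW]; simp
  simp only [mul_add, Finset.sum_add_distrib]
  have t1 : ∑ i, ∑ j, ∑ s, polyFun (pderiv s (HbarPoly φ W i j)) y
      * ((if j = s then 1 else 0) * z i) = 0 := by
    simp only [ite_mul, one_mul, zero_mul, mul_ite, mul_zero, Finset.sum_ite_eq, Finset.mem_univ,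
      if_true, ← Finset.sum_mul, hdiv', Finset.sum_const_zero]
  have t2 : ∑ i, ∑ j, ∑ s, polyFun (pderiv s (HbarPoly φ W i j)) y
      * ((if i = j then 1 else 0) * z s) = 0 := by
    have : ∀ i j, ∑ s, polyFun (pderiv s (HbarPoly φ W i j)) y * ((if i = j then 1 else 0) * z s)
        = if i = j then ∑ s, polyFun (pderiv s (HbarPoly φ W i j)) y * z s else 0 := fun i j => by
      split_ifs <;> simp
    simp only [this, Finset.sum_ite_eq, Finset.mem_univ, if_true]
    rw [Finset.sum_comm]
    simp only [← Finset.sum_mul, htr, zero_mul, Finset.sum_const_zero]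
  have t3 : ∑ i, ∑ j, ∑ s, polyFun (pderiv s (HbarPoly φ W i j)) y
      * ((if i = s then 1 else 0) * z j) = 0 := by
    simp only [ite_mul, one_mul, zero_mul, mul_ite, mul_zero, Finset.sum_ite_eq, Finset.mem_univ,
      if_true]
    rw [Finset.sum_comm]
    simp only [← Finset.sum_mul, hdiv, zero_mul, Finset.sum_const_zero]
  rw [t1, t2, t3]
  simp

/-- Closed form of the bracket: it is quadratic in `ξ`. -/
lemma bracket_eq (hW : IsWeylTensor W) (τ : ℝ) {lam : ℝ} (hl : 0 < lam) (ξ y : E N) :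
    bracket τ W ξ lam y = bubbleConst N lam * Hform W ξ y *
      (-(16 * mN N * (mN N + 1)) * (quarticPoly τ).eval (‖y‖ ^ 2)
          * (2 * (mN N + 2) * wt lam (mN N + 3) (y - ξ)
            + 2 * (mN N + 2) * (mN N + 3) * lam ^ 2 * wt lam (mN N + 4) (y - ξ))
        - 32 * mN N * (mN N + 1) * (mN N + 2) * ((∑ s, y s * (y s - ξ s))
          * (quarticPoly τ).derivative.eval (‖y‖ ^ 2)) * wt lam (mN N + 3) (y - ξ)
        + (1 - bN N / 2) * (4 * mN N * (mN N + 1)) * (lapRadial N (quarticPoly τ)).eval (‖y‖ ^ 2)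
          * wt lam (mN N + 2) (y - ξ)) := by
  set φ := quarticPoly τ with hφ
  set m := mN N with hm
  have S1 : ∑ i, ∑ j, ∑ s, 2 * Hbar τ W i j y * pd i (pd j (pd s (pd s (bubble ξ lam)))) y
      = -(bubbleConst N lam * (16 * m * (m + 1)) * (φ.eval (‖y‖ ^ 2) * Hform W ξ y)
        * (2 * (m + 2) * wt lam (m + 3) (y - ξ)
          + 2 * (m + 2) * (m + 3) * lam ^ 2 * wt lam (m + 4) (y - ξ))) := by
    have htr : ∑ i, polyFun (HbarPoly φ W i i) y = 0 := by
      rw [← polyFun_sum, sum_HbarPoly_diag φ hW]; simp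
    rw [← sum_HbarPoly_mul_sub_mul_sub φ hW ξ y]
    simp only [← Finset.mul_sum, sum_pd_pd_pd_pd_bubble ξ hl, Hbar_eq]
    have e : ∀ i j, 2 * polyFun (HbarPoly φ W i j) y * (bubbleConst N lam * (8 * m * (m + 1))
        * ((if i = j then 1 else 0) * (wt lam (m + 2) (y - ξ)
          + (m + 2) * lam ^ 2 * wt lam (m + 3) (y - ξ))
        - ((y i - ξ i) * (y j - ξ j)) * (2 * (m + 2) * wt lam (m + 3) (y - ξ)
          + 2 * (m + 2) * (m + 3) * lam ^ 2 * wt lam (m + 4) (y - ξ)))) =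
        (if i = j then polyFun (HbarPoly φ W i j) y else 0) *
          (bubbleConst N lam * (16 * m * (m + 1)) * (wt lam (m + 2) (y - ξ)
          + (m + 2) * lam ^ 2 * wt lam (m + 3) (y - ξ)))
        - polyFun (HbarPoly φ W i j) y * ((y i - ξ i) * (y j - ξ j)) *
          (bubbleConst N lam * (16 * m * (m + 1)) * (2 * (m + 2) * wt lam (m + 3) (y - ξ)
          + 2 * (m + 2) * (m + 3) * lam ^ 2 * wt lam (m + 4) (y - ξ))) := fun i j => by
      split_ifs <;> ring
    simp only [← hφ, ← hm, e, Finset.sum_sub_distrib, ← Finset.sum_mul, Finset.sum_ite_eq,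
      Finset.mem_univ, if_true, htr]
    ring
  have S2 : ∑ i, ∑ j, ∑ s, 2 * pd s (Hbar τ W i j) y * pd i (pd j (pd s (bubble ξ lam))) y
      = -(bubbleConst N lam * (16 * m * (m + 1) * (m + 2))
        * (2 * (∑ s, y s * (y s - ξ s)) * (φ.derivative.eval (‖y‖ ^ 2) * Hform W ξ y))
        * wt lam (m + 3) (y - ξ)) := by
    have h0 := sum_delta_terms φ hW (fun i => y i - ξ i) y
    rw [← sum_pderiv_HbarPoly_mul φ hW ξ y]
    simp only [pd_pd_pd_bubble ξ hl, Hbar_eq, pd_polyFun, ← hφ, ← hm]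
    have e : ∀ i j s, 2 * polyFun (pderiv s (HbarPoly φ W i j)) y * (bubbleConst N lam *
        (4 * m * (m + 1) * ((if j = s then 1 else 0) * (y i - ξ i)
          + (if i = j then 1 else 0) * (y s - ξ s)
          + (if i = s then 1 else 0) * (y j - ξ j)) * wt lam (m + 2) (y - ξ)
        - 8 * m * (m + 1) * (m + 2) * ((y i - ξ i) * (y j - ξ j) * (y s - ξ s))
          * wt lam (m + 3) (y - ξ))) =
        polyFun (pderiv s (HbarPoly φ W i j)) y * ((if j = s then 1 else 0) * (y i - ξ i)
          + (if i = j then 1 else 0) * (y s - ξ s)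
          + (if i = s then 1 else 0) * (y j - ξ j)) *
          (bubbleConst N lam * (8 * m * (m + 1)) * wt lam (m + 2) (y - ξ))
        - polyFun (pderiv s (HbarPoly φ W i j)) y
          * ((y i - ξ i) * (y j - ξ j) * (y s - ξ s)) *
          (bubbleConst N lam * (16 * m * (m + 1) * (m + 2)) * wt lam (m + 3) (y - ξ)) :=
      fun i j s => by ring
    simp only [e, Finset.sum_sub_distrib, ← Finset.sum_mul, h0]
    ring
  have hlap : ∀ i j, ∑ s, pd s (pd s (Hbar τ W i j)) y
      = polyFun (HbarPoly (lapRadial N φ) W i j) y := fun i j => by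
    simp only [Hbar_eq, pd_polyFun, ← polyFun_sum, ← lap_apply]
    rw [lap_HbarPoly φ hW]
  have S3 : ∑ i, ∑ j, ∑ s, pd s (pd s (Hbar τ W i j)) y * pd i (pd j (bubble ξ lam)) y
      = bubbleConst N lam * (4 * m * (m + 1)) * ((lapRadial N φ).eval (‖y‖ ^ 2) * Hform W ξ y)
        * wt lam (m + 2) (y - ξ) := by
    have htr : ∑ i, polyFun (HbarPoly (lapRadial N φ) W i i) y = 0 := by
      rw [← polyFun_sum, sum_HbarPoly_diag _ hW]; simp
    rw [← sum_HbarPoly_mul_sub_mul_sub _ hW ξ y]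
    simp only [← Finset.sum_mul, hlap, pd_pd_bubble ξ hl, ← hm]
    have e : ∀ i j, polyFun (HbarPoly (lapRadial N φ) W i j) y * (bubbleConst N lam *
        (-(2 * m) * (if i = j then 1 else 0) * wt lam (m + 1) (y - ξ)
          + 4 * m * (m + 1) * ((y i - ξ i) * (y j - ξ j)) * wt lam (m + 2) (y - ξ))) =
        (if i = j then polyFun (HbarPoly (lapRadial N φ) W i j) y else 0)
          * (bubbleConst N lam * (-(2 * m)) * wt lam (m + 1) (y - ξ))
        + polyFun (HbarPoly (lapRadial N φ) W i j) y * ((y i - ξ i) * (y j - ξ j))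
          * (bubbleConst N lam * (4 * m * (m + 1)) * wt lam (m + 2) (y - ξ)) := fun i j => by
      split_ifs <;> ring
    simp only [e, Finset.sum_add_distrib, ← Finset.sum_mul, Finset.sum_ite_eq,
      Finset.mem_univ, if_true, htr]
    ring
  -- ΔH̄ has the form of H̄ with another radial factor, so its divergence vanishes too.
  have S4 : ∑ i, ∑ j, ∑ s, pd j (pd s (pd s (Hbar τ W i j))) y * pd i (bubble ξ lam) y = 0 := by
    refine Finset.sum_eq_zero fun i _ => ?_
    simp only [← Finset.sum_mul]
    have : ∑ j, ∑ s, pd j (pd s (pd s (Hbar τ W i j))) y = 0 := by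
      simp only [Hbar_eq, pd_polyFun, ← polyFun_sum, ← map_sum, ← lap_apply, lap_HbarPoly _ hW]
      simp only [HbarPoly_symm (lapRadial N (quarticPoly τ)) hW i, sum_pderiv_HbarPoly _ hW]
      simp
    rw [this, zero_mul]
  have split : bracket τ W ξ lam y =
      (∑ i, ∑ j, ∑ s, 2 * Hbar τ W i j y * pd i (pd j (pd s (pd s (bubble ξ lam)))) y)
      + (∑ i, ∑ j, ∑ s, 2 * pd s (Hbar τ W i j) y * pd i (pd j (pd s (bubble ξ lam))) y)
      + (1 - bN N / 2) * (∑ i, ∑ j, ∑ s,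
        pd s (pd s (Hbar τ W i j)) y * pd i (pd j (bubble ξ lam)) y)
      - bN N / 2 * (∑ i, ∑ j, ∑ s,
        pd j (pd s (pd s (Hbar τ W i j))) y * pd i (bubble ξ lam) y) := by
    simp only [bracket, Finset.mul_sum, ← Finset.sum_add_distrib, ← Finset.sum_sub_distrib]
    refine Finset.sum_congr rfl fun i _ => Finset.sum_congr rfl fun j _ =>
      Finset.sum_congr rfl fun s _ => ?_
    ring
  rw [split, S1, S2, S3, S4]
  ring

lemma polynomial_growth (φ : Polynomial ℝ) {D : ℕ} (hD : φ.natDegree ≤ D) :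
    ∃ K, 0 ≤ K ∧ ∀ w t : ℝ, 1 ≤ w → |t| ≤ w → |φ.eval (t ^ 2)| ≤ K * w ^ (2 * D) := by
  refine ⟨∑ i ∈ Finset.range (D + 1), |φ.coeff i|, Finset.sum_nonneg fun _ _ => abs_nonneg _,
    fun w t hw ht => ?_⟩
  rw [Polynomial.eval_eq_sum_range' (Nat.lt_succ_of_le hD), Finset.sum_mul]
  refine (Finset.abs_sum_le_sum_abs _ _).trans (Finset.sum_le_sum fun i hi => ?_)
  rw [abs_mul, ← pow_mul, abs_pow]
  gcongr
  calc |t| ^ (2 * i) ≤ w ^ (2 * i) := by gcongr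
    _ ≤ _ := pow_le_pow_right₀ hw (by have := Finset.mem_range.1 hi; omega)

lemma Hform_bound (W : Fin N → Fin N → Fin N → Fin N → ℝ) :
    ∃ K, 0 ≤ K ∧ ∀ ξ y : E N, |Hform W ξ y| ≤ K * ‖ξ‖ ^ 2 * ‖y‖ ^ 2 := by
  choose K hK hb using fun i j : Fin N =>
    polyFun_homogeneous_bound (isHomogeneous_Hpoly (W := W) i j)
  refine ⟨∑ i, ∑ j, K i j, Finset.sum_nonneg fun i _ => Finset.sum_nonneg fun j _ => hK i j,
    fun ξ y => ?_⟩
  rw [Hform, Finset.sum_mul, Finset.sum_mul]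
  refine (Finset.abs_sum_le_sum_abs _ _).trans (Finset.sum_le_sum fun i _ => ?_)
  rw [Finset.sum_mul, Finset.sum_mul]
  refine (Finset.abs_sum_le_sum_abs _ _).trans (Finset.sum_le_sum fun j _ => ?_)
  have hi : |ξ i| ≤ ‖ξ‖ := PiLp.norm_apply_le ξ i
  have hj : |ξ j| ≤ ‖ξ‖ := PiLp.norm_apply_le ξ j
  rw [abs_mul, abs_mul]
  calc |polyFun (Hpoly W i j) y| * (|ξ i| * |ξ j|) ≤ (K i j * ‖y‖ ^ 2) * (‖ξ‖ * ‖ξ‖) := by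
        have := hK i j
        gcongr
        exact hb i j y
    _ = _ := by ring

end PaneitzBlowup
end

/-! ### Decay of the bracket and size of the corrector term -/

noncomputable section

namespace PaneitzBlowup

open MvPolynomial MeasureTheory Asymptotics Filter

variable {N : ℕ} {W : Fin N → Fin N → Fin N → Fin N → ℝ}

lemma natDegree_quarticPoly_le (τ : ℝ) : (quarticPoly τ).natDegree ≤ 4 := by
  unfold quarticPoly
  compute_degree

lemma natDegree_derivative_quarticPoly_le (τ : ℝ) : (quarticPoly τ).derivative.natDegree ≤ 3 :=
  (Polynomial.natDegree_derivative_le _).trans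
    (by have := natDegree_quarticPoly_le τ; omega)

lemma natDegree_lapRadial_le (N : ℕ) (τ : ℝ) : (lapRadial N (quarticPoly τ)).natDegree ≤ 3 := by
  have h1 := natDegree_derivative_quarticPoly_le τ
  have h2 := (Polynomial.natDegree_derivative_le (quarticPoly τ).derivative)
  unfold lapRadial
  refine (Polynomial.natDegree_add_le _ _).trans (max_le ?_ ?_)
  · refine Polynomial.natDegree_mul_le.trans ?_
    have : (4 * Polynomial.X : Polynomial ℝ).natDegree ≤ 1 := by compute_degree
    omega
  · refine Polynomial.natDegree_mul_le.trans ?_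
    rw [Polynomial.natDegree_C]
    omega

/-- The bracket is `O(|ξ|² (1 + |y - ξ|)^(8 - N))`. -/
lemma bracket_bound (hN : 4 ≤ N) (hW : IsWeylTensor W) (τ : ℝ) :
    ∃ K, 0 ≤ K ∧ ∀ ξ y : E N, ∀ lam : ℝ, ‖ξ‖ ≤ 1 → 1 / 2 < lam → lam < 3 / 2 →
      |bracket τ W ξ lam y| ≤ K * ‖ξ‖ ^ 2 * (1 + ‖y - ξ‖) ^ (8 - (N : ℝ)) := by
  obtain ⟨K0, hK0, hQ⟩ := Hform_bound W
  obtain ⟨K1, hK1, h1⟩ := polynomial_growth _ (natDegree_quarticPoly_le τ)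
  obtain ⟨K2, hK2, h2⟩ := polynomial_growth _ (natDegree_derivative_quarticPoly_le τ)
  obtain ⟨K3, hK3, h3⟩ := polynomial_growth _ (natDegree_lapRadial_le N τ)
  have hN' : (4 : ℝ) ≤ N := by exact_mod_cast hN
  have hm : 0 ≤ mN N := by rw [mN]; linarith
  set m := mN N with hmdef
  have hγ : 0 ≤ gammaN N := by
    unfold gammaN
    refine Real.rpow_nonneg ?_ _
    have : 0 ≤ (N : ℝ) - 2 := by linarith
    positivity
  set c : ℝ := 2 / (1 / 2) ^ 2 with hc
  have hcpos : 0 < c := by rw [hc]; positivity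
  set C0 := gammaN N * (3 / 2) ^ m with hC0
  have hC0' : 0 ≤ C0 := mul_nonneg hγ (by positivity)
  refine ⟨C0 * (4 * K0) * (16 * m * (m + 1) * (K1 * 2 ^ 8) * (2 * (m + 2) * c ^ (m + 3)
      + 2 * (m + 2) * (m + 3) * (3 / 2) ^ 2 * c ^ (m + 4))
    + 32 * m * (m + 1) * (m + 2) * (N * 2 * (K2 * 2 ^ 6)) * c ^ (m + 3)
    + |1 - bN N / 2| * (4 * m * (m + 1)) * (K3 * 2 ^ 6) * c ^ (m + 2)), by positivity, ?_⟩
  intro ξ y lam hξ hl1 hl2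
  have hl : 0 < lam := by linarith
  set w := 1 + ‖y - ξ‖ with hw
  have hw1 : 1 ≤ w := by rw [hw]; linarith [norm_nonneg (y - ξ)]
  have hw0 : 0 < w := by linarith
  have hyw : ‖y‖ ≤ 2 * w := by
    have : ‖y‖ ≤ ‖y - ξ‖ + ‖ξ‖ := norm_le_norm_sub_add y ξ
    linarith
  have hyw' : |‖y‖| ≤ 2 * w := by rwa [abs_of_nonneg (norm_nonneg y)]
  have hwt : ∀ s, 0 ≤ s → |wt lam s (y - ξ)| ≤ c ^ s * w ^ (-(2 * s)) := fun s hs => by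
    rw [abs_of_pos (wt_pos hl _ _)]
    exact wt_le (by norm_num) (by norm_num) hs hl1.le _
  have hcb : |bubbleConst N lam| ≤ C0 := by
    rw [bubbleConst, abs_of_nonneg (by positivity), hC0]
    gcongr
  have hQ' : |Hform W ξ y| ≤ 4 * K0 * ‖ξ‖ ^ 2 * w ^ 2 := by
    refine (hQ ξ y).trans ?_
    calc K0 * ‖ξ‖ ^ 2 * ‖y‖ ^ 2 ≤ K0 * ‖ξ‖ ^ 2 * (2 * w) ^ 2 := by gcongr
      _ = _ := by ring
  have e1 := h1 (2 * w) ‖y‖ (by linarith) hyw'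
  have e2 := h2 (2 * w) ‖y‖ (by linarith) hyw'
  have e3 := h3 (2 * w) ‖y‖ (by linarith) hyw'
  have e4 : |∑ s, y s * (y s - ξ s)| ≤ N * 2 * w ^ 2 := by
    refine (Finset.abs_sum_le_sum_abs _ _).trans ?_
    have : ∀ s ∈ Finset.univ, |y s * (y s - ξ s)| ≤ 2 * w ^ 2 := fun s _ => by
      have a1 : |y s| ≤ ‖y‖ := PiLp.norm_apply_le y s
      have a2 : |y s - ξ s| ≤ ‖y - ξ‖ := PiLp.norm_apply_le (y - ξ) s
      rw [abs_mul]
      calc |y s| * |y s - ξ s| ≤ (2 * w) * w := by gcongr <;> linarith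
        _ = _ := by ring
    refine (Finset.sum_le_sum this).trans_eq ?_
    simp; ring
  -- All weights are compared with V = w^(-2(m+3)) = w^(-N-2). The three summands are O(w⁸ V), and
  -- the quadratic form adds |ξ|² w², which gives the decay w^(8-N).
  have p2 : w ^ (-(2 * (m + 2))) = w ^ 2 * w ^ (-(2 * (m + 3))) := by
    rw [← Real.rpow_natCast w 2, ← Real.rpow_add hw0]; congr 1; push_cast; ring
  have p4 : w ^ (-(2 * (m + 4))) ≤ w ^ (-(2 * (m + 3))) :=
    Real.rpow_le_rpow_of_exponent_le hw1 (by linarith)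
  set V := w ^ (-(2 * (m + 3))) with hV
  have hV0 : 0 < V := Real.rpow_pos_of_pos hw0 _
  have w3 := hwt (m + 3) (by linarith)
  have w4 : |wt lam (m + 4) (y - ξ)| ≤ c ^ (m + 4) * V := by
    refine (hwt (m + 4) (by linarith)).trans ?_
    gcongr
  have w2 := hwt (m + 2) (by linarith)
  rw [p2] at w2
  have hpow : w ^ (8 - (N : ℝ)) = w ^ 2 * (w ^ 8 * V) := by
    rw [hV, ← Real.rpow_natCast w 2, ← Real.rpow_natCast w 8, ← Real.rpow_add hw0,
      ← Real.rpow_add hw0]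
    congr 1
    rw [hmdef, mN]; push_cast; ring
  rw [bracket_eq hW τ hl, abs_mul, abs_mul, hpow]
  have T1 : |-(16 * m * (m + 1)) * (quarticPoly τ).eval (‖y‖ ^ 2)
          * (2 * (m + 2) * wt lam (m + 3) (y - ξ)
            + 2 * (m + 2) * (m + 3) * lam ^ 2 * wt lam (m + 4) (y - ξ))|
      ≤ (16 * m * (m + 1) * (K1 * 2 ^ 8) * (2 * (m + 2) * c ^ (m + 3)
      + 2 * (m + 2) * (m + 3) * (3 / 2) ^ 2 * c ^ (m + 4))) * (w ^ 8 * V) := by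
    rw [abs_mul, abs_mul, abs_neg, abs_of_nonneg (by positivity : 0 ≤ 16 * m * (m + 1))]
    have : |2 * (m + 2) * wt lam (m + 3) (y - ξ)
            + 2 * (m + 2) * (m + 3) * lam ^ 2 * wt lam (m + 4) (y - ξ)|
        ≤ 2 * (m + 2) * (c ^ (m + 3) * V)
          + 2 * (m + 2) * (m + 3) * (3 / 2) ^ 2 * (c ^ (m + 4) * V) := by
      refine (abs_add_le _ _).trans (add_le_add ?_ ?_)
      · rw [abs_mul, abs_of_nonneg (by positivity)]
        gcongr
      · rw [abs_mul, abs_of_nonneg (by positivity)]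
        gcongr
    calc _ ≤ 16 * m * (m + 1) * (K1 * (2 * w) ^ (2 * 4)) * (2 * (m + 2) * (c ^ (m + 3) * V)
          + 2 * (m + 2) * (m + 3) * (3 / 2) ^ 2 * (c ^ (m + 4) * V)) := by gcongr
      _ = _ := by ring
  have T2 : |32 * m * (m + 1) * (m + 2) * ((∑ s, y s * (y s - ξ s))
          * (quarticPoly τ).derivative.eval (‖y‖ ^ 2)) * wt lam (m + 3) (y - ξ)|
      ≤ (32 * m * (m + 1) * (m + 2) * (N * 2 * (K2 * 2 ^ 6)) * c ^ (m + 3)) * (w ^ 8 * V) := by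
    rw [abs_mul, abs_mul, abs_mul (∑ s, y s * (y s - ξ s)),
      abs_of_nonneg (by positivity : 0 ≤ 32 * m * (m + 1) * (m + 2))]
    calc _ ≤ 32 * m * (m + 1) * (m + 2) * ((N * 2 * w ^ 2) * (K2 * (2 * w) ^ (2 * 3)))
            * (c ^ (m + 3) * V) := by gcongr
      _ = _ := by ring
  have T3 : |(1 - bN N / 2) * (4 * m * (m + 1)) * (lapRadial N (quarticPoly τ)).eval (‖y‖ ^ 2)
          * wt lam (m + 2) (y - ξ)|
      ≤ (|1 - bN N / 2| * (4 * m * (m + 1)) * (K3 * 2 ^ 6) * c ^ (m + 2)) * (w ^ 8 * V) := by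
    rw [abs_mul, abs_mul, abs_mul (1 - bN N / 2), abs_of_nonneg (by positivity : 0 ≤ 4 * m * (m + 1))]
    calc _ ≤ |1 - bN N / 2| * (4 * m * (m + 1)) * (K3 * (2 * w) ^ (2 * 3))
            * (c ^ (m + 2) * (w ^ 2 * V)) := by gcongr
      _ = _ := by ring
  have T := (abs_add_le _ _).trans (add_le_add ((abs_sub _ _).trans (add_le_add T1 T2)) T3)
  exact (mul_le_mul (mul_le_mul hcb hQ' (abs_nonneg _) hC0') T (abs_nonneg _)
    (by positivity)).trans_eq (by ring)

/-- Only the summand of order zero in the weighted norm is needed. -/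
lemma norm_le_normStar {μ ε : ℝ} (hμ : 0 < μ) (hε : 0 < ε) (ξ : E N) (v : E N → ℝ) (y : E N) :
    ENNReal.ofReal ((1 + ‖y - ξ‖) ^ ((N : ℝ) - 14) / (μ * ε ^ 10) * |v y|)
      ≤ normStar μ ε ξ v := by
  unfold normStar
  refine le_trans ?_ (le_iSup _ y)
  refine ENNReal.ofReal_le_ofReal ?_
  have h : ∀ i ∈ Finset.range 3, 0 ≤
      (1 + ‖y - ξ‖) ^ ((N : ℝ) - 14 + (i : ℕ)) / (μ * ε ^ 10) * ‖iteratedFDeriv ℝ i v y‖ :=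
    fun i _ => by positivity
  refine le_trans (le_of_eq ?_) (Finset.single_le_sum h (Finset.mem_range.2 (by norm_num : 0 < 3)))
  simp

/-- The corrector term in `F` is `O(|ξ|⁴)`. -/
lemma corrector_bound (hN : 25 ≤ N) (hW : IsWeylTensor W) {τ : ℝ}
    {h : E N → Matrix (Fin N) (Fin N) ℝ} {ρ μ ε : ℝ} (hb : IsBackground τ W h ρ μ ε)
    {r₀ : ℝ} {χ : E N → E N → ℝ} {χhat : E N → ℝ} (hχ : IsCutoff r₀ χ χhat ρ ε)
    {w : E N → ℝ → E N → ℝ} (hw : IsCorrector τ W h μ ε χ χhat w) :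
    ∃ K, ∀ p ∈ configSet N,
      |∫ y, bracket τ W p.1 p.2 y * (w p.1 p.2 y / (μ * ε ^ 10))| ≤ K * ‖p.1‖ ^ 4 := by
  obtain ⟨K, hK, hB⟩ := bracket_bound (by omega) hW τ
  obtain ⟨-, Cw, hCw⟩ := hw
  have hμ := hb.mu_pos
  have hε := hb.eps_pos
  have hN' : (25 : ℝ) ≤ N := by exact_mod_cast hN
  refine ⟨K * (Cw * K) * ∫ y : E N, (1 + ‖y‖) ^ (-(2 * (N : ℝ) - 22)), fun p hp => ?_⟩
  obtain ⟨hξ, hl1, hl2⟩ := hp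
  -- The weight of exponent N - 10 exceeds what the decay 8 - N of the bracket requires by w^(-2) ≤
  -- 1, and the cut-off is at most one. The factor |ξ|² passes to w through the weighted estimate.
  have hss : normStarStar μ ε p.1 (R1 τ W χhat μ ε p.1 p.2)
      ≤ ENNReal.ofReal (K * ‖p.1‖ ^ 2) := by
    refine iSup_le fun y => ENNReal.ofReal_le_ofReal ?_
    have hB' := hB p.1 y p.2 hξ hl1 hl2
    set v := 1 + ‖y - p.1‖ with hv
    have hv1 : 1 ≤ v := by rw [hv]; linarith [norm_nonneg (y - p.1)]
    have hv0 : 0 < v := by linarith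
    obtain ⟨c0, c1⟩ := hχ.hat_mem_Icc y
    have e1 : |R1 τ W χhat μ ε p.1 p.2 y| ≤ μ * ε ^ 10 * (K * ‖p.1‖ ^ 2 * v ^ (8 - (N : ℝ))) := by
      rw [R1, abs_neg, abs_mul, abs_of_nonneg (by positivity)]
      calc μ * ε ^ 10 * χhat y * |bracket τ W p.1 p.2 y|
          ≤ μ * ε ^ 10 * 1 * (K * ‖p.1‖ ^ 2 * v ^ (8 - (N : ℝ))) := by gcongr
        _ = _ := by ring
    calc v ^ ((N : ℝ) - 10) / (μ * ε ^ 10) * |R1 τ W χhat μ ε p.1 p.2 y|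
        ≤ v ^ ((N : ℝ) - 10) / (μ * ε ^ 10) * (μ * ε ^ 10 * (K * ‖p.1‖ ^ 2 * v ^ (8 - (N : ℝ)))) := by
          gcongr
      _ = K * ‖p.1‖ ^ 2 * (v ^ ((N : ℝ) - 10) * v ^ (8 - (N : ℝ))) := by field_simp
      _ ≤ K * ‖p.1‖ ^ 2 * 1 := by
          gcongr
          rw [← Real.rpow_add hv0]
          exact Real.rpow_le_one_of_one_le_of_nonpos hv1 (by linarith)
      _ = _ := mul_one _
  have hs : normStar μ ε p.1 (w p.1 p.2) ≤ ENNReal.ofReal (Cw * (K * ‖p.1‖ ^ 2)) := by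
    refine (hCw p ⟨hξ, hl1, hl2⟩).trans ?_
    rw [ENNReal.ofReal_mul (by positivity), ENNReal.ofReal_coe_nnreal]
    gcongr
  have hpt : ∀ y, |bracket τ W p.1 p.2 y * (w p.1 p.2 y / (μ * ε ^ 10))|
      ≤ K * (Cw * K) * ‖p.1‖ ^ 4 * (1 + ‖y - p.1‖) ^ (-(2 * (N : ℝ) - 22)) := fun y => by
    have hB' := hB p.1 y p.2 hξ hl1 hl2
    have h1 := (norm_le_normStar hμ hε p.1 (w p.1 p.2) y).trans hs
    rw [ENNReal.ofReal_le_ofReal_iff (by positivity)] at h1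
    set v := 1 + ‖y - p.1‖ with hv
    have hv1 : 1 ≤ v := by rw [hv]; linarith [norm_nonneg (y - p.1)]
    have hv0 : 0 < v := by linarith
    have e1 : |w p.1 p.2 y / (μ * ε ^ 10)| ≤ Cw * (K * ‖p.1‖ ^ 2) * v ^ (14 - (N : ℝ)) := by
      rw [abs_div, abs_of_pos (by positivity : 0 < μ * ε ^ 10)]
      have e2 : v ^ ((N : ℝ) - 14) * v ^ (14 - (N : ℝ)) = 1 := by
        rw [← Real.rpow_add hv0]; simp
      calc |w p.1 p.2 y| / (μ * ε ^ 10)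
          = (v ^ ((N : ℝ) - 14) / (μ * ε ^ 10) * |w p.1 p.2 y|) * v ^ (14 - (N : ℝ)) := by
            rw [show (v ^ ((N : ℝ) - 14) / (μ * ε ^ 10) * |w p.1 p.2 y|) * v ^ (14 - (N : ℝ))
              = (v ^ ((N : ℝ) - 14) * v ^ (14 - (N : ℝ))) * (|w p.1 p.2 y| / (μ * ε ^ 10)) by ring,
              e2, one_mul]
        _ ≤ _ := by gcongr
    rw [abs_mul]
    have e3 : v ^ (-(2 * (N : ℝ) - 22)) = v ^ (8 - (N : ℝ)) * v ^ (14 - (N : ℝ)) := by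
      rw [← Real.rpow_add hv0]; congr 1; ring
    calc _ ≤ (K * ‖p.1‖ ^ 2 * v ^ (8 - (N : ℝ))) * (Cw * (K * ‖p.1‖ ^ 2) * v ^ (14 - (N : ℝ))) := by
          gcongr
      _ = _ := by rw [e3]; ring
  -- The bracket decays with exponent 8 - N and the corrector with 14 - N; the product is integrable
  -- because 2N - 22 > N.
  have hint : Integrable fun y : E N => (1 + ‖y - p.1‖) ^ (-(2 * (N : ℝ) - 22)) :=
    (integrable_one_add_norm_rpow (N := N) (r := 2 * (N : ℝ) - 22) (by linarith)).comp_sub_right p.1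
  have h2 := norm_integral_le_of_norm_le
    (f := fun y => bracket τ W p.1 p.2 y * (w p.1 p.2 y / (μ * ε ^ 10))) (hint.const_mul (K * (Cw * K) * ‖p.1‖ ^ 4))
    (Eventually.of_forall hpt)
  rw [integral_const_mul, integral_sub_right_eq_self (fun y : E N => (1 + ‖y‖) ^ (-(2 * (N : ℝ) - 22)))]
    at h2
  rw [← Real.norm_eq_abs]
  exact h2.trans_eq (by ring)

lemma bracket_zero (hN : 4 ≤ N) (hW : IsWeylTensor W) (τ : ℝ) {lam : ℝ} (h1 : 1 / 2 < lam)
    (h2 : lam < 3 / 2) (y : E N) : bracket τ W 0 lam y = 0 := by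
  obtain ⟨K, -, hB⟩ := bracket_bound hN hW τ
  have := hB 0 y lam (by simp) h1 h2
  simpa using this

end PaneitzBlowup
end

noncomputable section

namespace PaneitzBlowup

open MvPolynomial MeasureTheory Asymptotics Filter

variable {N : ℕ} {W : Fin N → Fin N → Fin N → Fin N → ℝ}

/-! ### Reduction of the integrals in `F` to moments -/

lemma integral_polyFun_mul_wt (P : Poly N) (lam s : ℝ) (ξ : E N) :
    ∫ y, polyFun P y * wt lam s (y - ξ) = moment lam s (trans ξ P) := by
  rw [moment, ← integral_add_right_eq_self _ ξ]
  simp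

lemma bubbleConst_sq {lam : ℝ} (hl : 0 < lam) :
    bubbleConst N lam ^ 2 = gammaN N ^ 2 * lam ^ ((N : ℝ) - 4) := by
  rw [bubbleConst, mul_pow, ← Real.rpow_natCast (lam ^ mN N), ← Real.rpow_mul hl.le]
  congr 2
  rw [mN]; push_cast; ring

lemma integral_bubbleConst_sq {lam : ℝ} (hl : 0 < lam) (P : Poly N) (s c : ℝ) (ξ : E N)
    {f : E N → ℝ}
    (hf : ∀ y, f y = bubbleConst N lam ^ 2 * c * (polyFun P y * wt lam s (y - ξ))) :
    ∫ y, f y = gammaN N ^ 2 * (c * scaledMoment s P (ξ, lam)) := by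
  rw [integral_congr_ae (Eventually.of_forall hf), integral_const_mul, integral_polyFun_mul_wt,
    bubbleConst_sq hl, scaledMoment]
  ring

/-- The family of all components of `H`. -/
def Hfam (W : Fin N → Fin N → Fin N → Fin N → ℝ) (e : Fin N × Fin N) : Poly N := Hpoly W e.1 e.2

lemma isSolidHarmonic_Hfam (hW : IsWeylTensor W) (e : Fin N × Fin N) :
    IsSolidHarmonic (Hfam W e) 2 := isSolidHarmonic_Hpoly hW _ _

/-- The polynomial `|∂H̄|²`. -/
def gradHbar (φ : Polynomial ℝ) (W : Fin N → Fin N → Fin N → Fin N → ℝ) : Poly N :=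
  ∑ m, ∑ k, ∑ l, pderiv l (HbarPoly φ W m k) * pderiv l (HbarPoly φ W m k)

lemma sum_X_mul_pderiv_Hpoly (i j : Fin N) :
    ∑ l, X l * pderiv l (Hpoly W i j) = 2 * Hpoly W i j := by
  rw [(isHomogeneous_Hpoly i j).sum_X_mul_pderiv]; simp

/-- The mixed terms are evaluated by Euler's identity y·∇H = 2H. Two different radial factors are
allowed, since the pair (H̄, ΔH̄) also occurs. -/
lemma sum_pderiv_mul_pderiv (φ ψ : Polynomial ℝ) (i j : Fin N) :
    ∑ l, pderiv l (HbarPoly φ W i j) * pderiv l (HbarPoly ψ W i j) =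
      radial N (4 * Polynomial.X * φ.derivative * ψ.derivative + 4 * φ.derivative * ψ
        + 4 * φ * ψ.derivative) * (Hpoly W i j * Hpoly W i j)
      + radial N (φ * ψ) * ∑ l, pderiv l (Hpoly W i j) * pderiv l (Hpoly W i j) := by
  have h : ∀ l, pderiv l (HbarPoly φ W i j) * pderiv l (HbarPoly ψ W i j) =
      4 * radial N φ.derivative * radial N ψ.derivative * (Hpoly W i j * Hpoly W i j) * X l ^ 2
      + (2 * radial N φ.derivative * radial N ψ * Hpoly W i j
        + 2 * radial N φ * radial N ψ.derivative * Hpoly W i j) * (X l * pderiv l (Hpoly W i j))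
      + radial N φ * radial N ψ * (pderiv l (Hpoly W i j) * pderiv l (Hpoly W i j)) := fun l => by
    rw [pderiv_HbarPoly, pderiv_HbarPoly]; ring
  simp only [h, Finset.sum_add_distrib, ← Finset.mul_sum, sum_X_mul_pderiv_Hpoly]
  rw [← nsq]
  simp only [radial, map_add, map_mul, map_ofNat, Polynomial.aeval_X]
  ring

lemma sum_Hpoly_sq : ∑ i, ∑ j, Hpoly W i j * Hpoly W i j = sqSum (Hfam W) := by
  rw [sqSum, Fintype.sum_prod_type]; rfl

lemma sum_grad_Hpoly_sq :
    ∑ i, ∑ j, ∑ l, pderiv l (Hpoly W i j) * pderiv l (Hpoly W i j) = gradSum (Hfam W) := by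
  rw [gradSum, Fintype.sum_prod_type]; rfl

lemma sum_sum_pderiv_mul_pderiv (φ ψ : Polynomial ℝ) :
    ∑ i, ∑ j, ∑ l, pderiv l (HbarPoly φ W i j) * pderiv l (HbarPoly ψ W i j) =
      radial N (4 * Polynomial.X * φ.derivative * ψ.derivative + 4 * φ.derivative * ψ
        + 4 * φ * ψ.derivative) * sqSum (Hfam W) + radial N (φ * ψ) * gradSum (Hfam W) := by
  simp only [sum_pderiv_mul_pderiv, Finset.sum_add_distrib, ← Finset.mul_sum, sum_Hpoly_sq,
    sum_grad_Hpoly_sq]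

lemma gradHbar_eq (φ : Polynomial ℝ) : gradHbar φ W =
    radial N (4 * Polynomial.X * φ.derivative ^ 2 + 8 * φ * φ.derivative) * sqSum (Hfam W)
      + radial N (φ ^ 2) * gradSum (Hfam W) := by
  rw [gradHbar, sum_sum_pderiv_mul_pderiv]
  congr 3 <;> ring

lemma sum_HbarPoly_sq (φ : Polynomial ℝ) :
    ∑ i, ∑ j, HbarPoly φ W i j * HbarPoly φ W i j = radial N (φ ^ 2) * sqSum (Hfam W) := by
  rw [← sum_Hpoly_sq, Finset.mul_sum]
  refine Finset.sum_congr rfl fun i _ => ?_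
  rw [Finset.mul_sum]
  refine Finset.sum_congr rfl fun j _ => ?_
  simp only [HbarPoly, radial, map_pow]
  ring

lemma two_mul_mN : 2 * mN N = N - 4 := by rw [mN]; ring

lemma wt_mul_wt {lam : ℝ} (hl : 0 < lam) {s t r : ℝ} (h : s + t = r) (z : E N) :
    wt lam s z * wt lam t z = wt lam r z := by rw [← h, wt_add hl]

/-- Here |y - ξ|² = (λ² + |y - ξ|²) - λ² expresses |∇u|² by two weights without polynomial factors,
so the moments need no further centring. -/
lemma sum_pd_bubble_sq {lam : ℝ} (hl : 0 < lam) (ξ y : E N) :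
    ∑ i, pd i (bubble ξ lam) y ^ 2 = bubbleConst N lam ^ 2 * (4 * mN N ^ 2)
      * (wt lam (N - 3) (y - ξ) - lam ^ 2 * wt lam (N - 2) (y - ξ)) := by
  have h1 := base_mul_wt hl ((N : ℝ) - 3) (y - ξ)
  rw [show (N : ℝ) - 3 + 1 = N - 2 by ring, norm_sq_sub_eq] at h1
  have h2 := wt_mul_wt hl (show (mN N + 1) + (mN N + 1) = N - 2 by
    linarith [two_mul_mN (N := N)]) (y - ξ)
  simp only [pd_bubble ξ hl]
  have e : ∀ i, (bubbleConst N lam * (-(2 * mN N) * (y i - ξ i) * wt lam (mN N + 1) (y - ξ))) ^ 2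
      = bubbleConst N lam ^ 2 * (4 * mN N ^ 2) * wt lam (N - 2) (y - ξ)
        * ((y i - ξ i) * (y i - ξ i)) := fun i => by
    rw [← h2]; ring
  simp only [e, ← Finset.mul_sum]
  rw [← h1]
  ring

lemma degree_radial (φ : Polynomial ℝ) : (radial N φ).totalDegree ≤ 2 * φ.natDegree := by
  rw [radial, Polynomial.aeval_eq_sum_range]
  refine totalDegree_finsetSum_le fun i hi => ?_
  rw [smul_eq_C_mul]
  refine (isHomogeneous_C_mul' (isHomogeneous_nsq.pow i) _).totalDegree_le.trans ?_
  have := Finset.mem_range.1 hi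
  omega

lemma degree_HbarPoly (φ : Polynomial ℝ) (hφ : φ.natDegree ≤ 4) (m k : Fin N) :
    (HbarPoly φ W m k).totalDegree ≤ 10 :=
  (totalDegree_mul _ _).trans
    (by have := (isHomogeneous_Hpoly (W := W) m k).totalDegree_le
        have := degree_radial (N := N) φ; omega)

lemma degree_gradHbar (φ : Polynomial ℝ) (hφ : φ.natDegree ≤ 4) (W) :
    (gradHbar φ W : Poly N).totalDegree ≤ 18 := by
  refine totalDegree_finsetSum_le fun m _ => totalDegree_finsetSum_le fun k _ =>
    totalDegree_finsetSum_le fun l _ => ?_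
  have h1 := degree_HbarPoly (W := W) φ hφ m k
  have h2 := totalDegree_pderiv_le l (HbarPoly φ W m k)
  exact (totalDegree_mul _ _).trans (by omega)

/-- The gradient term with `a_N`. -/
lemma integral_aN (hN : 25 ≤ N) (τ : ℝ) {lam : ℝ} (hl : 0 < lam) (ξ : E N) :
    ∫ y, ∑ i, ∑ k, ∑ l, ∑ m, pd l (Hbar τ W m k) y ^ 2 * pd i (bubble ξ lam) y ^ 2 =
      gammaN N ^ 2 * (4 * mN N ^ 2 * (scaledMoment (N - 3) (gradHbar (quarticPoly τ) W) (ξ, lam)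
        - lam ^ 2 * scaledMoment (N - 2) (gradHbar (quarticPoly τ) W) (ξ, lam))) := by
  set P := gradHbar (quarticPoly τ) W
  have hd : ((trans ξ P).totalDegree : ℝ) ≤ 18 := by
    exact_mod_cast (totalDegree_trans_le ξ P).trans
      (degree_gradHbar _ (natDegree_quarticPoly_le τ) W)
  have hN' : (25 : ℝ) ≤ N := by exact_mod_cast hN
  have hP : ∀ y, ∑ k, ∑ l, ∑ m, pd l (Hbar τ W m k) y ^ 2 = polyFun P y := fun y => by
    simp only [Hbar_eq, pd_polyFun, P, gradHbar, polyFun_sum, polyFun_mul, pow_two]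
    conv_rhs => rw [Finset.sum_comm]
    refine Finset.sum_congr rfl fun k _ => ?_
    rw [Finset.sum_comm]
  have hpt : ∀ y, ∑ i, ∑ k, ∑ l, ∑ m, pd l (Hbar τ W m k) y ^ 2 * pd i (bubble ξ lam) y ^ 2
      = bubbleConst N lam ^ 2 * (4 * mN N ^ 2) * (polyFun P y * wt lam (N - 3) (y - ξ)
        - lam ^ 2 * (polyFun P y * wt lam (N - 2) (y - ξ))) := fun y => by
    simp only [← Finset.sum_mul, hP, ← Finset.mul_sum, sum_pd_bubble_sq hl]
    ring
  have hint : ∀ s : ℝ, (N : ℝ) - 3 ≤ s → Integrable fun y => polyFun P y * wt lam s (y - ξ) :=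
    fun s hs => by
      have := (integrable_polyFun_mul_wt (trans ξ P) hl (s := s) (by linarith)).comp_sub_right ξ
      simpa using this
  rw [integral_congr_ae (Eventually.of_forall hpt), integral_const_mul, integral_sub
    (hint _ le_rfl) ((hint _ (by linarith)).const_mul _), integral_const_mul,
    integral_polyFun_mul_wt, integral_polyFun_mul_wt, bubbleConst_sq hl, scaledMoment, scaledMoment]
  ring

/-- The zeroth-order term with the second derivatives of `H̄`. -/
lemma integral_zeroth (τ : ℝ) {lam : ℝ} (hl : 0 < lam) (ξ : E N) :
    ∫ y, ∑ i, ∑ k, ∑ l, ∑ m, (pd i (pd l (Hbar τ W m k)) y ^ 2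
        + pd l (Hbar τ W m k) y * pd i (pd i (pd l (Hbar τ W m k))) y) * bubble ξ lam y ^ 2 =
      gammaN N ^ 2 * (1 / 2 * scaledMoment (N - 4) (lap (gradHbar (quarticPoly τ) W)) (ξ, lam)) := by
  refine integral_bubbleConst_sq hl _ _ _ ξ fun y => ?_
  -- The integrand is half of Δ|∂H̄|² = 2(|∂∂H̄|² + ∂H̄·Δ∂H̄).
  have hL : lap (gradHbar (quarticPoly τ) W) = ∑ m, ∑ k, ∑ l, ∑ i, 2 *
      (pderiv i (pderiv l (HbarPoly (quarticPoly τ) W m k)) ^ 2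
      + pderiv l (HbarPoly (quarticPoly τ) W m k)
        * pderiv i (pderiv i (pderiv l (HbarPoly (quarticPoly τ) W m k)))) := by
    simp only [gradHbar, map_sum, lap_mul]
    refine Finset.sum_congr rfl fun m _ => Finset.sum_congr rfl fun k _ =>
      Finset.sum_congr rfl fun l _ => ?_
    rw [lap_apply, Finset.mul_sum, Finset.mul_sum, ← Finset.sum_add_distrib,
      ← Finset.sum_add_distrib]
    refine Finset.sum_congr rfl fun i _ => ?_
    ring
  have hw := wt_mul_wt hl (show mN N + mN N = N - 4 by linarith [two_mul_mN (N := N)]) (y - ξ)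
  have hu : bubble ξ lam y ^ 2 = bubbleConst N lam ^ 2 * wt lam (N - 4) (y - ξ) := by
    rw [bubble_eq hl, ← hw]; ring
  simp only [← Finset.sum_mul, Hbar_eq, pd_polyFun, hu, hL, polyFun_sum, polyFun_mul, polyFun_add,
    polyFun_pow, polyFun_two, ← Finset.mul_sum]
  have : ∀ F : Fin N → Fin N → Fin N → Fin N → ℝ,
      ∑ i, ∑ k, ∑ l, ∑ m, F i k l m = ∑ m, ∑ k, ∑ l, ∑ i, F i k l m := fun F => by
    rw [Finset.sum_comm]
    conv_rhs => rw [Finset.sum_comm]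
    refine Finset.sum_congr rfl fun k _ => ?_
    rw [Finset.sum_comm]
    conv_rhs => rw [Finset.sum_comm]
    refine Finset.sum_congr rfl fun l _ => ?_
    rw [Finset.sum_comm]
  rw [this]
  ring

/-- The zeroth-order term with the Laplacian of `H̄`. -/
lemma integral_lap_sq (hW : IsWeylTensor W) (τ : ℝ) {lam : ℝ} (hl : 0 < lam) (ξ : E N) :
    ∫ y, ∑ i, ∑ j, ∑ m, ∑ s, pd m (pd m (Hbar τ W i j)) y * pd s (pd s (Hbar τ W i j)) y
        * bubble ξ lam y ^ 2 =
      gammaN N ^ 2 * (1 * scaledMoment (N - 4)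
        (radial N (lapRadial N (quarticPoly τ) ^ 2) * sqSum (Hfam W)) (ξ, lam)) := by
  refine integral_bubbleConst_sq hl _ _ _ ξ fun y => ?_
  have hw := wt_mul_wt hl (show mN N + mN N = N - 4 by linarith [two_mul_mN (N := N)]) (y - ξ)
  have hu : bubble ξ lam y ^ 2 = bubbleConst N lam ^ 2 * wt lam (N - 4) (y - ξ) := by
    rw [bubble_eq hl, ← hw]; ring
  have hlap : ∀ i j, ∑ s, polyFun (pderiv s (pderiv s (HbarPoly (quarticPoly τ) W i j))) y
      = polyFun (HbarPoly (lapRadial N (quarticPoly τ)) W i j) y := fun i j => by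
    rw [← polyFun_sum, ← lap_apply, lap_HbarPoly _ hW]
  simp only [← Finset.sum_mul, Hbar_eq, pd_polyFun, hu, ← Finset.mul_sum, hlap,
    ← sum_HbarPoly_sq, polyFun_sum, polyFun_mul]
  ring

/-- Contracting twice with `y - ξ`. -/
lemma sum_mul_sub_mul_sub (hW : IsWeylTensor W) (φ ψ : Polynomial ℝ) (ξ y : E N) :
    ∑ i, ∑ j, (∑ l, polyFun (HbarPoly φ W i l) y * polyFun (HbarPoly ψ W j l) y)
        * ((y i - ξ i) * (y j - ξ j)) =
      polyFun (∑ i, ∑ j, C (ξ i * ξ j) * (radial N (φ * ψ) * ∑ l, Hpoly W i l * Hpoly W j l)) y := by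
  have e1 : ∀ z : Fin N → ℝ,
      ∑ i, ∑ j, (∑ l, polyFun (HbarPoly φ W i l) y * polyFun (HbarPoly ψ W j l) y) * (z i * z j)
      = ∑ l, (∑ i, polyFun (HbarPoly φ W i l) y * z i)
        * (∑ j, polyFun (HbarPoly ψ W j l) y * z j) := fun z => by
    simp only [Finset.sum_mul_sum]
    simp only [Finset.sum_mul]
    conv_rhs => rw [Finset.sum_comm]
    refine Finset.sum_congr rfl fun i _ => ?_
    rw [Finset.sum_comm]
    refine Finset.sum_congr rfl fun l _ => Finset.sum_congr rfl fun j _ => ?_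
    ring
  rw [e1 fun i => y i - ξ i]
  -- Each of the two contractions with y - ξ becomes one with -ξ, and the signs cancel.
  simp only [sum_HbarPoly_mul_sub _ hW, neg_mul_neg]
  rw [← e1 fun i => ξ i]
  simp only [polyFun_sum, polyFun_mul, polyFun_C, HbarPoly, radial, map_mul]
  refine Finset.sum_congr rfl fun i _ => Finset.sum_congr rfl fun j _ => ?_
  rw [Finset.sum_mul, Finset.mul_sum, Finset.mul_sum]
  refine Finset.sum_congr rfl fun l _ => ?_
  ring

/-- The quadratic form in `ξ` given by the moments of `φ(|y|²) H_il H_jl`. -/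
def quadMoment (W : Fin N → Fin N → Fin N → Fin N → ℝ) (φ : Polynomial ℝ) (s : ℝ)
    (p : E N × ℝ) : ℝ :=
  ∑ i, ∑ j, p.1 i * p.1 j * scaledMoment s (radial N φ * ∑ l, Hpoly W i l * Hpoly W j l) p

lemma degree_radial_mul (φ : Polynomial ℝ) (i j : Fin N) :
    (radial N φ * ∑ l, Hpoly W i l * Hpoly W j l).totalDegree ≤ 2 * φ.natDegree + 4 := by
  have hr := degree_radial (N := N) φ
  have h2 : (∑ l, Hpoly W i l * Hpoly W j l : Poly N).totalDegree ≤ 4 :=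
    (IsHomogeneous.sum _ _ _ fun l _ =>
      (isHomogeneous_Hpoly i l).mul (isHomogeneous_Hpoly j l)).totalDegree_le
  exact (totalDegree_mul _ _).trans (by omega)

lemma scaledMoment_quad (φ : Polynomial ℝ) {s : ℝ} {p : E N × ℝ} (hp : 0 < p.2)
    (hs : (N : ℝ) + (2 * φ.natDegree + 4) < 2 * s) :
    scaledMoment s (∑ i, ∑ j, C (p.1 i * p.1 j) * (radial N φ * ∑ l, Hpoly W i l * Hpoly W j l)) p
      = quadMoment W φ s p := by
  have hd : ∀ i j, (C (p.1 i * p.1 j) * (radial N φ * ∑ l, Hpoly W i l * Hpoly W j l)).totalDegree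
      ≤ 2 * φ.natDegree + 4 := fun i j =>
    (totalDegree_mul _ _).trans (by
      have := degree_radial_mul (W := W) φ i j
      rw [totalDegree_C]; omega)
  rw [scaledMoment_sum _ hp, quadMoment]
  · refine Finset.sum_congr rfl fun i _ => ?_
    rw [scaledMoment_sum _ hp]
    · simp only [scaledMoment_C_mul]
    · intro j _
      have := hd i j
      rify at this
      linarith
  · intro i _
    have := totalDegree_finsetSum_le (s := Finset.univ) fun j _ => hd i j
    rify at this
    linarith

/-- The term with `H̄ ΔH̄`. -/
lemma integral_lap_mul (hW : IsWeylTensor W) (τ : ℝ) {lam : ℝ} (hl : 0 < lam) (ξ : E N) :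
    ∫ y, ∑ i, ∑ j, ∑ m, ∑ s, Hbar τ W i s y * pd m (pd m (Hbar τ W j s)) y
        * pd i (bubble ξ lam) y * pd j (bubble ξ lam) y =
      gammaN N ^ 2 * (4 * mN N ^ 2 * scaledMoment (N - 2) (∑ i, ∑ j, C (ξ i * ξ j) *
        (radial N (quarticPoly τ * lapRadial N (quarticPoly τ))
          * ∑ l, Hpoly W i l * Hpoly W j l)) (ξ, lam)) := by
  refine integral_bubbleConst_sq hl _ _ _ ξ fun y => ?_
  have h2 := wt_mul_wt hl (show (mN N + 1) + (mN N + 1) = N - 2 by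
    linarith [two_mul_mN (N := N)]) (y - ξ)
  have hlap : ∀ i j, ∑ s, polyFun (pderiv s (pderiv s (HbarPoly (quarticPoly τ) W i j))) y
      = polyFun (HbarPoly (lapRadial N (quarticPoly τ)) W i j) y := fun i j => by
    rw [← polyFun_sum, ← lap_apply, lap_HbarPoly _ hW]
  rw [← sum_mul_sub_mul_sub hW]
  simp only [Finset.sum_mul, Finset.mul_sum]
  refine Finset.sum_congr rfl fun i _ => Finset.sum_congr rfl fun j _ => ?_
  rw [Finset.sum_comm]
  refine Finset.sum_congr rfl fun s _ => ?_
  simp only [Hbar_eq, pd_polyFun, ← Finset.sum_mul, ← Finset.mul_sum, hlap, pd_bubble ξ hl, ← h2]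
  ring

/-- The leading term. -/
lemma integral_first (hN : 25 ≤ N) (hW : IsWeylTensor W) (τ : ℝ) {lam : ℝ} (hl : 0 < lam)
    (ξ : E N) :
    ∫ y, ∑ i, ∑ j, ∑ k, ∑ l, Hbar τ W i l y * Hbar τ W j l y
        * pd i (pd k (pd k (bubble ξ lam))) y * pd j (bubble ξ lam) y =
      gammaN N ^ 2 * (-(16 * mN N ^ 2 * (mN N + 1)) *
        (quadMoment W (quarticPoly τ * quarticPoly τ) (N - 1) (ξ, lam)
        + (mN N + 2) * lam ^ 2 * quadMoment W (quarticPoly τ * quarticPoly τ) N (ξ, lam))) := by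
  have hN' : (25 : ℝ) ≤ N := by exact_mod_cast hN
  have hdeg : (quarticPoly τ * quarticPoly τ).natDegree ≤ 8 :=
    Polynomial.natDegree_mul_le.trans (by have := natDegree_quarticPoly_le τ; omega)
  have hdeg' : ((quarticPoly τ * quarticPoly τ).natDegree : ℝ) ≤ 8 := by exact_mod_cast hdeg
  rw [← scaledMoment_quad (p := (ξ, lam)) _ hl (by linarith),
    ← scaledMoment_quad (p := (ξ, lam)) _ hl (by linarith)]
  set P : Poly N := ∑ i, ∑ j, C ((ξ, lam).1 i * (ξ, lam).1 j) *
    (radial N (quarticPoly τ * quarticPoly τ) * ∑ l, Hpoly W i l * Hpoly W j l) with hP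
  have hPd : ((trans ξ P).totalDegree : ℝ) ≤ 20 := by
    have : P.totalDegree ≤ 20 := totalDegree_finsetSum_le fun i _ =>
      totalDegree_finsetSum_le fun j _ => (totalDegree_mul _ _).trans (by
        have := degree_radial_mul (W := W) (quarticPoly τ * quarticPoly τ) i j
        rw [totalDegree_C]; omega)
    exact_mod_cast (totalDegree_trans_le ξ P).trans this
  have hint : ∀ s : ℝ, (N : ℝ) - 1 ≤ s → Integrable fun y => polyFun P y * wt lam s (y - ξ) :=
    fun s hs => by
      have := (integrable_polyFun_mul_wt (trans ξ P) hl (s := s) (by linarith)).comp_sub_right ξ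
      simpa using this
  have w1 := fun y => wt_mul_wt hl (show (mN N + 1) + (mN N + 2) = N - 1 by
    linarith [two_mul_mN (N := N)]) (y - ξ)
  have w2 := fun y => wt_mul_wt hl (show (mN N + 1) + (mN N + 3) = N by
    linarith [two_mul_mN (N := N)]) (y - ξ)
  have hpt : ∀ y, ∑ i, ∑ j, ∑ k, ∑ l, Hbar τ W i l y * Hbar τ W j l y
        * pd i (pd k (pd k (bubble ξ lam))) y * pd j (bubble ξ lam) y =
      bubbleConst N lam ^ 2 * (-(16 * mN N ^ 2 * (mN N + 1))) *
        (polyFun P y * wt lam (N - 1) (y - ξ)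
          + (mN N + 2) * lam ^ 2 * (polyFun P y * wt lam N (y - ξ))) := fun y => by
    rw [hP]
    simp only []
    rw [← sum_mul_sub_mul_sub hW, ← w1, ← w2]
    simp only [Finset.sum_mul, Finset.mul_sum, ← Finset.sum_add_distrib]
    refine Finset.sum_congr rfl fun i _ => Finset.sum_congr rfl fun j _ => ?_
    rw [Finset.sum_comm]
    refine Finset.sum_congr rfl fun s _ => ?_
    simp only [Hbar_eq, ← Finset.sum_mul, ← Finset.mul_sum, sum_pd_pd_pd_bubble ξ hl]
    simp only [pd_bubble ξ hl]
    ring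
  rw [integral_congr_ae (Eventually.of_forall hpt), integral_const_mul, integral_add
    (hint _ le_rfl) ((hint _ (by linarith)).const_mul _), integral_const_mul,
    integral_polyFun_mul_wt, integral_polyFun_mul_wt, bubbleConst_sq hl, scaledMoment, scaledMoment]
  ring

end PaneitzBlowup
end

noncomputable section

namespace PaneitzBlowup

open MvPolynomial MeasureTheory Asymptotics Filter

variable {N : ℕ} {W : Fin N → Fin N → Fin N → Fin N → ℝ}

/-! ### The term with `∂_j H̄_ms ∂_i H̄_sm` -/

/-- The polynomial `∑_ms ∂_j H̄_ms ∂_i H̄_sm`. -/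
def crossHbar (φ : Polynomial ℝ) (W : Fin N → Fin N → Fin N → Fin N → ℝ) (i j : Fin N) : Poly N :=
  ∑ m, ∑ s, pderiv j (HbarPoly φ W m s) * pderiv i (HbarPoly φ W s m)

/-- `∑ |ΔH̄|² + ∑ ∂_j H̄ ∂_j ΔH̄`. -/
def divHbar (φ : Polynomial ℝ) (W : Fin N → Fin N → Fin N → Fin N → ℝ) : Poly N :=
  radial N (lapRadial N φ ^ 2 + 4 * Polynomial.X * φ.derivative * (lapRadial N φ).derivative
      + 4 * φ.derivative * lapRadial N φ + 4 * φ * (lapRadial N φ).derivative) * sqSum (Hfam W)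
    + radial N (φ * lapRadial N φ) * gradSum (Hfam W)

lemma sum_crossHbar_diag (hW : IsWeylTensor W) (φ : Polynomial ℝ) :
    ∑ i, crossHbar φ W i i = gradHbar φ W := by
  simp only [crossHbar, gradHbar]
  rw [Finset.sum_comm]
  refine Finset.sum_congr rfl fun m _ => ?_
  rw [Finset.sum_comm]
  refine Finset.sum_congr rfl fun s _ => Finset.sum_congr rfl fun i _ => ?_
  rw [HbarPoly_symm φ hW s m]

/-- A Bochner identity: the double divergence of ∇h ⊗ ∇h is |∇²h|² + 2∇h·∇Δh + (Δh)², and |∇²h|² is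
eliminated through ½Δ|∇h|² = |∇²h|² + ∇h·∇Δh. -/
lemma two_mul_sum_pderiv_pderiv_cross (h : Poly N) :
    2 * ∑ i, ∑ j, pderiv j (pderiv i (pderiv j h * pderiv i h)) =
      lap (∑ l, pderiv l h * pderiv l h)
        + 2 * (lap h * lap h + ∑ j, pderiv j h * pderiv j (lap h)) := by
  have e : ∀ i j, 2 * pderiv j (pderiv i (pderiv j h * pderiv i h)) =
      pderiv j (pderiv j (pderiv i h * pderiv i h))
        + 2 * (pderiv j (pderiv j h) * pderiv i (pderiv i h)
          + pderiv j h * pderiv j (pderiv i (pderiv i h))) := fun i j => by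
    simp only [Derivation.leibniz, map_add, smul_eq_mul, pderiv_comm i j]
    ring
  simp only [Finset.mul_sum, e, Finset.sum_add_distrib]
  congr 1
  · simp only [map_sum, lap_apply]
  · rw [Finset.sum_comm]
    simp only [lap_apply, map_sum, mul_add, Finset.sum_add_distrib, ← Finset.mul_sum,
      ← Finset.sum_mul]

lemma two_mul_sum_pderiv_pderiv_crossHbar (hW : IsWeylTensor W) (φ : Polynomial ℝ) :
    2 * ∑ i, ∑ j, pderiv j (pderiv i (crossHbar φ W i j)) =
      lap (gradHbar φ W) + 2 * divHbar φ W := by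
  have h1 : ∑ i, ∑ j, pderiv j (pderiv i (crossHbar φ W i j)) = ∑ m, ∑ s, ∑ i, ∑ j,
      pderiv j (pderiv i (pderiv j (HbarPoly φ W m s) * pderiv i (HbarPoly φ W m s))) := by
    simp only [crossHbar, map_sum]
    have : ∀ F : Fin N → Fin N → Fin N → Fin N → Poly N,
        ∑ i, ∑ j, ∑ m, ∑ s, F i j m s = ∑ m, ∑ s, ∑ i, ∑ j, F i j m s := fun F => by
      have h : ∀ i, ∑ j, ∑ m, ∑ s, F i j m s = ∑ m, ∑ s, ∑ j, F i j m s := fun i =>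
        Finset.sum_comm.trans (Finset.sum_congr rfl fun m _ => Finset.sum_comm)
      simp only [h]
      rw [Finset.sum_comm]
      exact Finset.sum_congr rfl fun m _ => Finset.sum_comm
    rw [this]
    refine Finset.sum_congr rfl fun m _ => Finset.sum_congr rfl fun s _ =>
      Finset.sum_congr rfl fun i _ => Finset.sum_congr rfl fun j _ => ?_
    rw [HbarPoly_symm φ hW s m]
  rw [h1, Finset.mul_sum]
  simp only [Finset.mul_sum (s := Finset.univ) (a := (2 : Poly N)) (f := fun s => ∑ i, ∑ j,
      pderiv j (pderiv i (pderiv j (HbarPoly φ W _ s) * pderiv i (HbarPoly φ W _ s)))),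
    two_mul_sum_pderiv_pderiv_cross, Finset.sum_add_distrib, ← Finset.mul_sum,
    lap_HbarPoly φ hW, sum_HbarPoly_sq, sum_sum_pderiv_mul_pderiv]
  rw [gradHbar, divHbar, map_sum]
  simp only [map_sum (lap (N := N))]
  congr 2
  simp only [radial, map_add, map_mul, map_pow, add_mul]
  ring

lemma degree_crossHbar (φ : Polynomial ℝ) (hφ : φ.natDegree ≤ 4) (i j : Fin N) :
    (crossHbar φ W i j).totalDegree ≤ 18 := by
  refine totalDegree_finsetSum_le fun m _ => totalDegree_finsetSum_le fun k _ => ?_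
  have h1 := degree_HbarPoly (W := W) φ hφ m k
  have h1' := degree_HbarPoly (W := W) φ hφ k m
  have h2 := totalDegree_pderiv_le j (HbarPoly φ W m k)
  have h2' := totalDegree_pderiv_le i (HbarPoly φ W k m)
  exact (totalDegree_mul _ _).trans (by omega)

/-- Two integrations by parts. -/
lemma moment_sum_X_mul_X_mul {lam s : ℝ} (hl : 0 < lam) (P : Fin N → Fin N → Poly N) {D : ℕ}
    (hP : ∀ i j, (P i j).totalDegree ≤ D + 2) (hs : (N : ℝ) + D + 1 ≤ 2 * s) :
    4 * (s + 1) * s * moment lam (s + 2) (∑ i, ∑ j, X i * (X j * P i j)) =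
      2 * s * moment lam (s + 1) (∑ i, P i i)
        + moment lam s (∑ i, ∑ j, pderiv j (pderiv i (P i j))) := by
  have hX : ∀ i j, ((X j * P i j).totalDegree : ℝ) ≤ D + 3 := fun i j => by
    have := (totalDegree_X_mul_le j (P i j)).trans (Nat.add_le_add_right (hP i j) 1)
    exact_mod_cast this
  have hXX : ∀ i j, ((X i * (X j * P i j)).totalDegree : ℝ) ≤ D + 4 := fun i j => by
    have h1 := totalDegree_X_mul_le i (X j * P i j)
    have h2 := hX i j
    rify at h1
    linarith
  have hd : ∀ i j, ((pderiv i (P i j)).totalDegree : ℝ) ≤ D + 1 := fun i j => by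
    have := totalDegree_pderiv_le i (P i j)
    have := hP i j
    exact_mod_cast (by omega : (pderiv i (P i j)).totalDegree ≤ D + 1)
  have hdd : ∀ i j, ((pderiv j (pderiv i (P i j))).totalDegree : ℝ) ≤ D := fun i j => by
    have h1 := totalDegree_pderiv_le j (pderiv i (P i j))
    have h2 := totalDegree_pderiv_le i (P i j)
    have := hP i j
    exact_mod_cast (by omega : (pderiv j (pderiv i (P i j))).totalDegree ≤ D)
  have hP' : ∀ i j, ((P i j).totalDegree : ℝ) ≤ D + 2 := fun i j => by exact_mod_cast hP i j
  have hXd : ∀ i j, ((X j * pderiv i (P i j)).totalDegree : ℝ) ≤ D + 2 := fun i j => by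
    have h1 := totalDegree_X_mul_le j (pderiv i (P i j))
    have h2 := hd i j
    rify at h1
    linarith
  -- The first integration by parts may differentiate X_j, which leaves the diagonal term; the
  -- second one acts on the rest.
  have key : ∀ i j, 4 * (s + 1) * s * moment lam (s + 2) (X i * (X j * P i j)) =
      2 * s * (if i = j then moment lam (s + 1) (P i j) else 0)
        + moment lam s (pderiv j (pderiv i (P i j))) := fun i j => by
    have e1 := moment_X_mul (X j * P i j) i hl (s := s + 1) (by linarith [hX i j])
    have e2 := moment_X_mul (pderiv i (P i j)) j hl (s := s) (by linarith [hd i j])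
    rw [show s + 1 + 1 = s + 2 by ring] at e1
    rw [Derivation.leibniz, pderiv_X, smul_eq_mul, smul_eq_mul] at e1
    by_cases hij : i = j
    · subst hij
      rw [if_pos rfl]
      rw [Pi.single_eq_same, mul_one, moment_add hl (by linarith [hXd i i])
        (by linarith [hP' i i])] at e1
      linear_combination 2 * s * e1 + e2
    · rw [if_neg hij]
      rw [Pi.single_eq_of_ne (fun h => hij h.symm), mul_zero, add_zero] at e1
      linear_combination 2 * s * e1 + e2
  have hfin : ∀ {Q : Fin N → Fin N → Poly N} {K : ℝ}, 0 ≤ K →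
      (∀ i j, ((Q i j).totalDegree : ℝ) ≤ K) → ∀ i, ((∑ j, Q i j).totalDegree : ℝ) ≤ K :=
    fun {Q K} hK hQ i => by
      have h1 := totalDegree_finsetSum_le (s := Finset.univ) (f := Q i) (d := ⌊K⌋₊)
        fun j _ => Nat.le_floor (hQ i j)
      exact (Nat.cast_le.2 h1).trans (Nat.floor_le hK)
  have hD : (0 : ℝ) ≤ D := Nat.cast_nonneg _
  rw [moment_sum hl _ fun i _ => by linarith [hfin (by linarith) hXX i],
    moment_sum hl _ fun i _ => by linarith [hP' i i],
    moment_sum hl _ fun i _ => by linarith [hfin hD hdd i], Finset.mul_sum, Finset.mul_sum,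
    ← Finset.sum_add_distrib]
  refine Finset.sum_congr rfl fun i _ => ?_
  rw [moment_sum hl _ fun j _ => by linarith [hXX i j],
    moment_sum hl _ fun j _ => by linarith [hdd i j], Finset.mul_sum]
  simp only [key, Finset.sum_add_distrib, ← Finset.mul_sum]
  simp

/-- The gradient term with `b_N`. -/
lemma integral_bN (hN : 25 ≤ N) (hW : IsWeylTensor W) (τ : ℝ) {lam : ℝ} (hl : 0 < lam) (ξ : E N) :
    ∫ y, ∑ i, ∑ j, ∑ m, ∑ s, pd j (Hbar τ W m s) y * pd i (Hbar τ W s m) y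
        * pd i (bubble ξ lam) y * pd j (bubble ξ lam) y =
      gammaN N ^ 2 * (4 * mN N ^ 2 / (2 * (N - 3)) *
        (scaledMoment (N - 3) (gradHbar (quarticPoly τ) W) (ξ, lam)
          + 1 / (4 * (N - 4)) * scaledMoment (N - 4)
            (lap (gradHbar (quarticPoly τ) W) + 2 * divHbar (quarticPoly τ) W) (ξ, lam))) := by
  have hN' : (25 : ℝ) ≤ N := by exact_mod_cast hN
  have h2 := fun y => wt_mul_wt hl (show (mN N + 1) + (mN N + 1) = N - 2 by
    linarith [two_mul_mN (N := N)]) (y - ξ)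
  -- Here y - ξ is contracted with derivative indices, where H̄ gives no cancellation. The two
  -- factors y - ξ are removed instead by two integrations by parts in the variable centred at ξ.
  set Q : Fin N → Fin N → Poly N := fun i j => trans ξ (crossHbar (quarticPoly τ) W i j) with hQ
  have hpt : ∀ y, ∑ i, ∑ j, ∑ m, ∑ s, pd j (Hbar τ W m s) y * pd i (Hbar τ W s m) y
        * pd i (bubble ξ lam) y * pd j (bubble ξ lam) y = bubbleConst N lam ^ 2 * (4 * mN N ^ 2) *
      (polyFun (∑ i, ∑ j, X i * (X j * Q i j)) (y - ξ) * wt lam (N - 2) (y - ξ)) := fun y => by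
    simp only [← Finset.sum_mul, Hbar_eq, pd_polyFun, pd_bubble ξ hl, polyFun_sum, polyFun_mul,
      polyFun_X, hQ, polyFun_trans, sub_add_cancel, crossHbar]
    rw [Finset.sum_mul, Finset.mul_sum]
    refine Finset.sum_congr rfl fun i _ => ?_
    rw [Finset.sum_mul, Finset.mul_sum]
    refine Finset.sum_congr rfl fun j _ => ?_
    rw [← h2]
    simp only [PiLp.sub_apply]
    ring
  have hm : ∫ y, polyFun (∑ i, ∑ j, X i * (X j * Q i j)) (y - ξ) * wt lam (N - 2) (y - ξ)
      = moment lam (N - 2) (∑ i, ∑ j, X i * (X j * Q i j)) := by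
    rw [moment]
    exact integral_sub_right_eq_self (μ := volume) (fun z =>
      polyFun (∑ i, ∑ j, X i * (X j * Q i j)) z * wt lam (N - 2) z) ξ
  have hQd : ∀ i j, (Q i j).totalDegree ≤ 16 + 2 := fun i j =>
    (totalDegree_trans_le ξ _).trans (degree_crossHbar _ (natDegree_quarticPoly_le τ) i j)
  have hk := moment_sum_X_mul_X_mul hl Q (s := N - 4) hQd (by push_cast; linarith)
  have hd1 : ∑ i, Q i i = trans ξ (gradHbar (quarticPoly τ) W) := by
    rw [← sum_crossHbar_diag hW, map_sum]
  have hd2 : ∑ i, ∑ j, pderiv j (pderiv i (Q i j)) = C (1 / 2) *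
      trans ξ (lap (gradHbar (quarticPoly τ) W) + 2 * divHbar (quarticPoly τ) W) := by
    rw [← two_mul_sum_pderiv_pderiv_crossHbar hW, map_mul, map_ofNat, ← mul_assoc,
      ← map_ofNat C 2, ← C_mul]
    norm_num [hQ, pderiv_trans, map_sum]
  rw [hd1, hd2, moment_C_mul, show (N : ℝ) - 4 + 2 = N - 2 by ring,
    show (N : ℝ) - 4 + 1 = N - 3 by ring] at hk
  rw [integral_congr_ae (Eventually.of_forall hpt), integral_const_mul, hm, bubbleConst_sq hl,
    scaledMoment, scaledMoment]
  have h3 : (N : ℝ) - 3 ≠ 0 := by linarith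
  have h4 : (N : ℝ) - 4 ≠ 0 := by linarith
  have hk' : moment lam (N - 2) (∑ i, ∑ j, X i * (X j * Q i j)) = 1 / (2 * (N - 3)) *
      (moment lam (N - 3) (trans ξ (gradHbar (quarticPoly τ) W)) + 1 / (4 * (N - 4)) *
        moment lam (N - 4) (trans ξ (lap (gradHbar (quarticPoly τ) W)
          + 2 * divHbar (quarticPoly τ) W))) := by
    field_simp
    linear_combination 2 * hk
  rw [hk']
  ring

/-! ### The term with the derivative of `∂_i u ∂_j u` -/

/-- The four products group into an expression antisymmetric in (m, i) and one antisymmetric in (m,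
j); both die against z_m z_i z_j. In the delta terms, trace and divergence conditions leave one
contraction from each group, and these two cancel after renaming indices. -/
lemma sum_cubic_eq_zero {h : Fin N → Fin N → ℝ} (hh : ∀ i j, h i j = h j i)
    {d : Fin N → Fin N → Fin N → ℝ} (hd : ∀ s i j, d s i j = d s j i)
    (htr : ∀ s, ∑ i, d s i i = 0) (hdiv : ∀ j, ∑ i, d i i j = 0) (z : Fin N → ℝ) (α β : ℝ) :
    ∑ i, ∑ j, ∑ m, ∑ s, (h m s * d s i j - h s i * d s m j + h s j * d i m s - h m s * d i s j)
      * (((if m = i then 1 else 0) * z j + (if m = j then 1 else 0) * z i) * α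
        - β * (z m * z i * z j)) = 0 := by
  set A : Fin N → Fin N → Fin N → ℝ := fun m i j => ∑ s, h m s * d s i j with hA
  set B : Fin N → Fin N → Fin N → ℝ := fun i m j => ∑ s, h s j * d i m s with hB
  have e : ∀ i j m, ∑ s, (h m s * d s i j - h s i * d s m j + h s j * d i m s - h m s * d i s j)
      * (((if m = i then 1 else 0) * z j + (if m = j then 1 else 0) * z i) * α
        - β * (z m * z i * z j)) = (A m i j - A i m j + B i m j - B i j m) *
        (((if m = i then 1 else 0) * z j + (if m = j then 1 else 0) * z i) * α
        - β * (z m * z i * z j)) := fun i j m => by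
    rw [← Finset.sum_mul]
    congr 1
    simp only [hA, hB, ← Finset.sum_sub_distrib, ← Finset.sum_add_distrib]
    refine Finset.sum_congr rfl fun s _ => ?_
    rw [hh s i, hh s m, hd i s j]
  have c1 : ∑ i, ∑ j, ∑ m, A i m j * (z m * z i * z j)
      = ∑ i, ∑ j, ∑ m, A m i j * (z m * z i * z j) := by
    have : ∀ F : Fin N → Fin N → Fin N → ℝ, ∑ i, ∑ j, ∑ m, F i j m = ∑ m, ∑ j, ∑ i, F i j m :=
      fun F => by
        rw [Finset.sum_comm]
        conv_rhs => rw [Finset.sum_comm]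
        refine Finset.sum_congr rfl fun j _ => ?_
        rw [Finset.sum_comm]
    rw [this]
    refine Finset.sum_congr rfl fun i _ => Finset.sum_congr rfl fun j _ =>
      Finset.sum_congr rfl fun m _ => ?_
    ring
  have c2 : ∑ i, ∑ j, ∑ m, B i j m * (z m * z i * z j)
      = ∑ i, ∑ j, ∑ m, B i m j * (z m * z i * z j) := by
    refine Finset.sum_congr rfl fun i _ => ?_
    rw [Finset.sum_comm]
    refine Finset.sum_congr rfl fun j _ => Finset.sum_congr rfl fun m _ => ?_
    ring
  have d1 : ∑ i, ∑ j, ∑ m, (A m i j - A i m j + B i m j - B i j m) *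
      ((if m = i then 1 else 0) * z j) = -∑ i, ∑ j, B i j i * z j := by
    simp only [ite_mul, one_mul, zero_mul, mul_ite, mul_zero, Finset.sum_ite_eq', Finset.mem_univ,
      if_true, sub_self, zero_add, sub_mul, Finset.sum_sub_distrib]
    have : ∑ i, ∑ j, B i i j * z j = 0 := by
      rw [Finset.sum_comm]
      refine Finset.sum_eq_zero fun j _ => ?_
      rw [← Finset.sum_mul]
      simp only [hB]
      rw [Finset.sum_comm]
      simp only [← Finset.mul_sum, hdiv]
      simp
    rw [this, zero_sub]
  have d2 : ∑ i, ∑ j, ∑ m, (A m i j - A i m j + B i m j - B i j m) *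
      ((if m = j then 1 else 0) * z i) = ∑ i, ∑ j, A j i j * z i := by
    simp only [ite_mul, one_mul, zero_mul, mul_ite, mul_zero, Finset.sum_ite_eq', Finset.mem_univ,
      if_true]
    have : ∑ i, ∑ j, A i j j * z i = 0 := by
      refine Finset.sum_eq_zero fun i _ => ?_
      rw [← Finset.sum_mul]
      simp only [hA]
      rw [Finset.sum_comm]
      simp only [← Finset.mul_sum, htr]
      simp
    have e : ∀ i j, (A j i j - A i j j + B i j j - B i j j) * z i = A j i j * z i - A i j j * z i :=
      fun i j => by ring
    simp only [e, Finset.sum_sub_distrib, this, sub_zero]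
  have d3 : ∑ i, ∑ j, A j i j * z i = ∑ i, ∑ j, B i j i * z j := by
    conv_rhs => rw [Finset.sum_comm]
    refine Finset.sum_congr rfl fun i _ => ?_
    rw [← Finset.sum_mul, ← Finset.sum_mul]
    congr 1
    simp only [hA, hB]
    rw [Finset.sum_comm]
  simp only [e]
  have split : ∀ i j m, (A m i j - A i m j + B i m j - B i j m) *
        (((if m = i then 1 else 0) * z j + (if m = j then 1 else 0) * z i) * α
        - β * (z m * z i * z j)) =
      α * ((A m i j - A i m j + B i m j - B i j m) * ((if m = i then 1 else 0) * z j))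
      + α * ((A m i j - A i m j + B i m j - B i j m) * ((if m = j then 1 else 0) * z i))
      + (-β) * (A m i j * (z m * z i * z j)) + β * (A i m j * (z m * z i * z j))
      + (-β) * (B i m j * (z m * z i * z j)) + β * (B i j m * (z m * z i * z j)) :=
    fun i j m => by ring
  simp only [split, Finset.sum_add_distrib, ← Finset.mul_sum, c1, c2, d1, d2, d3]
  ring

lemma integral_cubic (hW : IsWeylTensor W) (τ : ℝ) {lam : ℝ} (hl : 0 < lam) (ξ : E N) :
    ∫ y, ∑ i, ∑ j, ∑ m, ∑ s,
      (Hbar τ W m s y * pd s (Hbar τ W i j) y - Hbar τ W s i y * pd s (Hbar τ W m j) y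
        + Hbar τ W s j y * pd i (Hbar τ W m s) y - Hbar τ W m s y * pd i (Hbar τ W s j) y)
        * pd m (fun z => pd i (bubble ξ lam) z * pd j (bubble ξ lam) z) y = 0 := by
  have h2 := fun y => wt_mul_wt hl (show (mN N + 1) + (mN N + 1) = N - 2 by
    linarith [two_mul_mN (N := N)]) (y - ξ)
  have hD : ∀ i j m y, pd m (fun z => pd i (bubble ξ lam) z * pd j (bubble ξ lam) z) y =
      ((if m = i then 1 else 0) * (y j - ξ j) + (if m = j then 1 else 0) * (y i - ξ i))
        * (bubbleConst N lam ^ 2 * (4 * mN N ^ 2) * wt lam (N - 2) (y - ξ))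
      - bubbleConst N lam ^ 2 * (4 * mN N ^ 2) * (2 * (N - 2)) * wt lam (N - 2 + 1) (y - ξ)
        * ((y m - ξ m) * (y i - ξ i) * (y j - ξ j)) := fun i j m y => by
    have e : (fun z => pd i (bubble ξ lam) z * pd j (bubble ξ lam) z) = fun z =>
        bubbleConst N lam ^ 2 * (4 * mN N ^ 2) *
          (((z i - ξ i) * (z j - ξ j)) * wt lam (N - 2) (z - ξ)) := by
      funext z
      rw [pd_bubble ξ hl, pd_bubble ξ hl, ← h2]
      ring
    rw [e, pd_const_mul, pd_coord_mul_coord_mul_wt ξ _ hl]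
    · ring
    · exact ((differentiable_sub_coord i ξ y).mul (differentiable_sub_coord j ξ y)).mul
        (differentiable_wt hl _ ξ y)
  refine (integral_congr_ae (Eventually.of_forall fun y => ?_)).trans (integral_zero _ _)
  simp only [hD, Hbar_eq, pd_polyFun]
  refine sum_cubic_eq_zero (fun i j => by rw [HbarPoly_symm _ hW])
    (fun s i j => by rw [HbarPoly_symm _ hW]) (fun s => ?_) (fun j => ?_) (fun i => y i - ξ i) _ _
  · rw [← polyFun_sum, ← map_sum, sum_HbarPoly_diag _ hW]; simp
  · rw [← polyFun_sum, sum_pderiv_HbarPoly _ hW]; simp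

end PaneitzBlowup
end

noncomputable section

namespace PaneitzBlowup

open MvPolynomial MeasureTheory Asymptotics Filter

variable {N : ℕ} {W : Fin N → Fin N → Fin N → Fin N → ℝ}

/-! ### Expansions of the graded pieces -/

lemma isBigO_polyFun_gradSum (hW : IsWeylTensor W) :
    (fun p : E N × ℝ => polyFun (gradSum (Hfam W)) p.1) =O[𝓝 (0, 1)] fun p => ‖p.1‖ ^ 2 :=
  isBigO_polyFun (isHomogeneous_gradSum (isSolidHarmonic_Hfam hW)) _

/-- On the part quadratic in ξ the factor λ² = 1 + o(1) changes nothing at this order, whereas in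
the leading function of λ it is kept exactly. -/
lemma HasExpansion.snd_sq_mul {G : E N → ℝ} {T : E N × ℝ → ℝ} {a : ℝ → ℝ} {b c : ℝ}
    (h : HasExpansion G T a b c)
    (hG : (fun p : E N × ℝ => G p.1) =O[𝓝 (0, 1)] fun p => ‖p.1‖ ^ 2) :
    HasExpansion G (fun p => p.2 ^ 2 * T p) (fun l => l ^ 2 * a l) b c := by
  have ht : Tendsto (fun p : E N × ℝ => p.2 ^ 2) (𝓝 (0, 1)) (𝓝 1) := by
    have : Continuous fun p : E N × ℝ => p.2 ^ 2 := by fun_prop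
    simpa using this.tendsto (0, 1)
  have h1 : (fun p : E N × ℝ => p.2 ^ 2) =O[𝓝 (0, 1)] fun _ => (1 : ℝ) := ht.isBigO_one ℝ
  have h2 : (fun p : E N × ℝ => p.2 ^ 2 - 1) =o[𝓝 (0, 1)] fun _ => (1 : ℝ) := by
    rw [isLittleO_one_iff]
    simpa using ht.sub_const 1
  have h3 : (fun p : E N × ℝ => b * ‖p.1‖ ^ 2 + c * G p.1) =O[𝓝 (0, 1)] fun p => ‖p.1‖ ^ 2 :=
    ((isBigO_refl _ _).const_mul_left b).add (hG.const_mul_left c)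
  have h4 := (h1.mul_isLittleO h).add (h2.mul_isBigO h3)
  refine h4.congr (fun p => ?_) fun p => ?_
  · ring
  · ring

section Pieces

variable {ι : Type*} [Fintype ι] {q : ι → Poly N} {s : ℝ}

/-- The expansion of a piece `c |y|^(2(j-1)) ∑ q_e² + c' |y|^(2j) ∑ |∇ q_e|²`. -/
lemma hasExpansion_piece_grad (hq : ∀ e, IsSolidHarmonic (q e) 2) (hN : 2 ≤ N) (j : ℕ)
    (hs : (N : ℝ) + (2 * j + 2) + 1 ≤ 2 * s) {c c' : ℝ} (hc : j = 0 → c = 0) :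
    HasExpansion (polyFun (gradSum q))
      (fun p => c * scaledMoment s (nsq ^ (j - 1) * sqSum q) p
        + c' * scaledMoment s (nsq ^ j * gradSum q) p)
      (fun l => hessSum q * ((c / (2 * N * (N + 2)) + c' / N) * (radialMoment N (j + 1) s
        * l ^ (2 * (N : ℝ) - 4 - 2 * s + 2 * (j + 1)))))
      (hessSum q * ((c / (2 * N * (N + 2)) + c' / N) * ((j + 1) * (2 * j + N) / N
        * radialMoment N j s) - (c / (N + 4) + c') * kappa N j s / N))
      ((c / (N + 4) + c') * kappa N j s) := by
  have h2 := (hasExpansion_gradSum hq hN j hs).const_mul c'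
  -- At j = 0 the truncated exponent j - 1 has no meaning; the hypothesis on c removes that summand.
  rcases j with _ | j
  · rw [hc rfl]
    refine h2.congr' (Eventually.of_forall fun p => ?_) (fun l _ => ?_) ?_ ?_
    · ring
    · push_cast; ring
    · push_cast; ring
    · ring
  · have hs' := hs
    push_cast at hs'
    have h1 := (hasExpansion_sqSum hq hN j (s := s) (by linarith)).const_mul c
    refine (h1.add h2).congr' (Eventually.of_forall fun p => ?_) (fun l _ => ?_) ?_ ?_
    · simp
    · push_cast
      rw [show 2 * (N : ℝ) - 4 - 2 * s + 2 * (j + 1 + 1) = 2 * (N : ℝ) - 4 - 2 * s + 2 * (j + 2) by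
        ring]
      ring
    · push_cast; ring
    · ring

/-- The expansion of a piece
`c |y|^(2(j-2)) ∑ q_e² + c' |y|^(2(j-1)) ∑ |∇ q_e|² + c'' |y|^(2j) ∑ |∇² q_e|²`. -/
lemma hasExpansion_piece_hess (hq : ∀ e, IsSolidHarmonic (q e) 2) (hN : 2 ≤ N) (j : ℕ)
    (hs : (N : ℝ) + 2 * j + 1 ≤ 2 * s) {c c' c'' : ℝ} (hc : j < 2 → c = 0) (hc' : j = 0 → c' = 0) :
    HasExpansion (polyFun (gradSum q))
      (fun p => c * scaledMoment s (nsq ^ (j - 2) * sqSum q) p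
        + c' * scaledMoment s (nsq ^ (j - 1) * gradSum q) p
        + c'' * (hessSum q * scaledMoment s (nsq ^ j) p))
      (fun l => hessSum q * ((c / (2 * N * (N + 2)) + c' / N + c'') * (radialMoment N j s
        * l ^ (2 * (N : ℝ) - 4 - 2 * s + 2 * j))))
      (hessSum q * ((c / (2 * N * (N + 2)) + c' / N + c'') * (j * (2 * j + N - 2) / N
        * radialMoment N (j - 1) s) - (c / (N + 4) + c') * kappa N (j - 1) s / N))
      ((c / (N + 4) + c') * kappa N (j - 1) s) := by
  have h3 := (hasExpansion_nsq (polyFun (gradSum q)) hN j hs).const_mul (c'' * hessSum q)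
  rcases j with _ | j
  · rw [hc (by norm_num), hc' rfl]
    refine h3.congr' (Eventually.of_forall fun p => ?_) (fun l _ => ?_) ?_ ?_
    · ring
    · push_cast; ring
    · push_cast; ring
    · ring
  · have hs' := hs
    push_cast at hs'
    have h2 := hasExpansion_piece_grad hq hN j (s := s) (c := c) (c' := c') (by linarith)
      fun hj => hc (by omega)
    refine (h2.add h3).congr' (Eventually.of_forall fun p => ?_) (fun l _ => ?_) ?_ ?_
    · simp [mul_assoc]
    · push_cast; ring
    · push_cast; ring
    · simp

end Pieces

/-- The quadratic form in `ξ`. -/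
lemma hessSum_contract (hW : IsWeylTensor W) (ξ : E N) :
    hessSum (fun l => ∑ i, C (ξ i) * Hpoly W i l) = polyFun (gradSum (Hfam W)) ξ := by
  -- The pair symmetry and the antisymmetries exchange a tensor index with the index of the
  -- variable. So second derivatives of ∑ ξ_i H_il are first derivatives of H evaluated at ξ.
  have hT : ∀ m k l q, W m l k q + W m q k l = W q k l m + W q m l k := fun m k l q => by
    rw [hW.pair_symm m l k q, hW.antisymm_left k q m l, hW.antisymm_right q k m l,
      hW.antisymm_left m q k l, hW.antisymm_right q m k l]
    ring
  have h1 : ∀ l a b, polyFun (pderiv b (pderiv a (∑ i, C (ξ i) * Hpoly W i l))) 0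
      = ∑ i, ξ i * (W i a l b + W i b l a) := fun l a b => by
    simp [map_sum, pderiv_pderiv_Hpoly, mul_add]
  have h2 : ∀ m k l, polyFun (pderiv l (Hpoly W m k)) ξ = ∑ q, ξ q * (W q k l m + W q m l k) :=
    fun m k l => by
      rw [pderiv_Hpoly]
      simp only [polyFun_sum, polyFun_mul, polyFun_C, polyFun_X, hT m k l]
      exact Finset.sum_congr rfl fun q _ => mul_comm _ _
  simp only [hessSum, gradSum, h1, Hfam, polyFun_sum, polyFun_mul, h2, Fintype.sum_prod_type]
  have h3 : ∀ F : Fin N → Fin N → Fin N → ℝ, ∑ m, ∑ k, ∑ l, F m k l = ∑ l, ∑ k, ∑ m, F m k l :=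
    fun F => by
      rw [Finset.sum_comm]
      conv_rhs => rw [Finset.sum_comm]
      exact Finset.sum_congr rfl fun k _ => Finset.sum_comm
  rw [h3 fun m k l => (∑ q, ξ q * (W q k l m + W q m l k)) * ∑ q, ξ q * (W q k l m + W q m l k)]
  simp only [sq]

lemma isSolidHarmonic_contract (hW : IsWeylTensor W) (ξ : E N) (l : Fin N) :
    IsSolidHarmonic (∑ i, C (ξ i) * Hpoly W i l) 2 := by
  refine ⟨IsHomogeneous.sum _ _ _ fun i _ =>
    isHomogeneous_C_mul' (isHomogeneous_Hpoly i l) _, ?_⟩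
  rw [map_sum]
  exact Finset.sum_eq_zero fun i _ => by
    rw [lap_C_mul, (isSolidHarmonic_Hpoly hW i l).harmonic, mul_zero]

/-- The form equals the moment at (0, 1) of φ(|y|²) ∑_l (∑_i ξ_i H_il)². For fixed ξ the inner sums
are again harmonic quadratic forms, so `hasExpansion_sqSum` gives the value, and `hessSum_contract`
identifies it with a multiple of G(ξ). -/
lemma scaledMoment_quad_zero_one (hN : 2 ≤ N) (hW : IsWeylTensor W) (φ : Polynomial ℝ) {D : ℕ}
    (hφ : φ.natDegree < D) {s : ℝ} (hs : (N : ℝ) + 2 * D + 3 ≤ 2 * s) (ξ : E N) :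
    ∑ i, ∑ j, ξ i * ξ j * scaledMoment s (radial N φ * ∑ l, Hpoly W i l * Hpoly W j l) (0, 1)
      = (∑ j ∈ Finset.range D, φ.coeff j * radialMoment N (j + 2) s) / (2 * N * (N + 2))
        * polyFun (gradSum (Hfam W)) ξ := by
  set q : Fin N → Poly N := fun l => ∑ i, C (ξ i) * Hpoly W i l with hq
  have hdeg : ∀ i j, ((C (ξ i * ξ j) *
      (radial N φ * ∑ l, Hpoly W i l * Hpoly W j l)).totalDegree : ℝ) ≤ 2 * D + 2 := fun i j => by
    have h1 := degree_radial_mul (W := W) φ i j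
    have h2 := totalDegree_mul (C (ξ i * ξ j)) (radial N φ * ∑ l, Hpoly W i l * Hpoly W j l)
    rw [totalDegree_C] at h2
    exact_mod_cast (by omega : (C (ξ i * ξ j) *
      (radial N φ * ∑ l, Hpoly W i l * Hpoly W j l)).totalDegree ≤ 2 * D + 2)
  have hdeg' : ∀ i, ((∑ j, C (ξ i * ξ j) *
      (radial N φ * ∑ l, Hpoly W i l * Hpoly W j l)).totalDegree : ℝ) ≤ 2 * D + 2 := fun i => by
    exact_mod_cast totalDegree_finsetSum_le (s := Finset.univ) fun j _ => by
      exact_mod_cast hdeg i j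
  have e1 : ∑ i, ∑ j, ξ i * ξ j *
      scaledMoment s (radial N φ * ∑ l, Hpoly W i l * Hpoly W j l) (0, 1)
      = scaledMoment s (Polynomial.aeval nsq φ * sqSum q) (0, 1) := by
    have : Polynomial.aeval nsq φ * sqSum q = ∑ i, ∑ j, C (ξ i * ξ j) *
        (radial N φ * ∑ l, Hpoly W i l * Hpoly W j l) := by
      simp only [sqSum, hq, Finset.sum_mul_sum]
      simp only [radial, C_mul, Finset.mul_sum]
      rw [Finset.sum_comm]
      refine Finset.sum_congr rfl fun i _ => ?_
      rw [Finset.sum_comm]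
      refine Finset.sum_congr rfl fun j _ => Finset.sum_congr rfl fun l _ => ?_
      ring
    rw [this, scaledMoment_sum _ one_pos fun i _ => by linarith [hdeg' i]]
    refine Finset.sum_congr rfl fun i _ => ?_
    rw [scaledMoment_sum _ one_pos fun j _ => by linarith [hdeg i j]]
    simp only [scaledMoment_C_mul]
  have hharm : ∀ l, IsSolidHarmonic (q l) 2 := isSolidHarmonic_contract hW ξ
  have hexp := HasExpansion.aeval_nsq_mul (isHomogeneous_sqSum hharm) φ hφ (s := s)
    (by push_cast; linarith) fun j hj => hasExpansion_sqSum hharm hN j (s := s) (by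
      have : (j : ℝ) + 1 ≤ D := by exact_mod_cast hj
      linarith)
  have h0 := hexp.apply_zero_one (polyFun_apply_zero (isHomogeneous_gradSum hharm) (by norm_num))
  rw [e1, h0]
  simp only [Real.one_rpow, mul_one, hq, hessSum_contract hW]
  rw [Finset.sum_div, Finset.sum_mul]
  refine Finset.sum_congr rfl fun j _ => ?_
  ring

/-- The factor ξ_i ξ_j is already quadratic, so by continuity the moment may be evaluated at (0, 1).
-/
lemma hasExpansion_quadMoment (hN : 2 ≤ N) (hW : IsWeylTensor W) (φ : Polynomial ℝ) {D : ℕ}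
    (hφ : φ.natDegree < D) {s : ℝ} (hs : (N : ℝ) + 2 * D + 3 ≤ 2 * s) :
    HasExpansion (polyFun (gradSum (Hfam W))) (quadMoment W φ s) (fun _ => 0) 0
      ((∑ j ∈ Finset.range D, φ.coeff j * radialMoment N (j + 2) s) / (2 * N * (N + 2))) := by
  have h : (fun p : E N × ℝ => ∑ i, ∑ j, p.1 i * p.1 j *
      (scaledMoment s (radial N φ * ∑ l, Hpoly W i l * Hpoly W j l) p
        - scaledMoment s (radial N φ * ∑ l, Hpoly W i l * Hpoly W j l) (0, 1)))
      =o[𝓝 (0, 1)] fun p => ‖p.1‖ ^ 2 := by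
    refine IsLittleO.fun_sum fun i _ => IsLittleO.fun_sum fun j _ => ?_
    have hc := continuousAt_scaledMoment hN (radial N φ * ∑ l, Hpoly W i l * Hpoly W j l) (s := s)
      (by
        have h1 := degree_radial_mul (W := W) φ i j
        have : (radial N φ * ∑ l, Hpoly W i l * Hpoly W j l).totalDegree ≤ 2 * D + 2 := by omega
        rify at this
        linarith)
    have h1 : (fun p : E N × ℝ => scaledMoment s (radial N φ * ∑ l, Hpoly W i l * Hpoly W j l) p
        - scaledMoment s (radial N φ * ∑ l, Hpoly W i l * Hpoly W j l) (0, 1))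
        =o[𝓝 (0, 1)] fun _ => (1 : ℝ) := by
      rw [isLittleO_one_iff]
      simpa using (hc.tendsto.sub_const
        (scaledMoment s (radial N φ * ∑ l, Hpoly W i l * Hpoly W j l) (0, 1)))
    have h2 : (fun p : E N × ℝ => p.1 i * p.1 j) =O[𝓝 (0, 1)] fun p => ‖p.1‖ ^ 2 := by
      refine IsBigO.of_bound 1 (Eventually.of_forall fun p => ?_)
      rw [one_mul, norm_mul, norm_pow, norm_norm, sq]
      exact mul_le_mul (PiLp.norm_apply_le p.1 i) (PiLp.norm_apply_le p.1 j) (norm_nonneg _)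
        (norm_nonneg _)
    exact (h2.mul_isLittleO h1).congr_right fun p => mul_one _
  refine IsLittleO.congr_left h fun p => ?_
  rw [← scaledMoment_quad_zero_one hN hW φ hφ hs, quadMoment]
  simp only [mul_sub, Finset.sum_sub_distrib]
  ring

end PaneitzBlowup
end

noncomputable section

namespace PaneitzBlowup

open MvPolynomial MeasureTheory Asymptotics Filter

variable {N : ℕ} {W : Fin N → Fin N → Fin N → Fin N → ℝ}

/-! ### The quadratic expressions in the quartic, by degree -/

/-- The coefficients of the quartic. -/
def quarticCoeff (τ : ℝ) : ℕ → ℝ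
  | 0 => τ
  | 1 => -12000
  | 2 => 2411
  | 3 => -135
  | 4 => 1
  | _ => 0

/-- The part of degree `j` of a quadratic expression in the quartic. -/
def conv (τ : ℝ) (w : ℝ → ℝ → ℝ) (j : ℕ) : ℝ :=
  ∑ k ∈ Finset.range (j + 1), quarticCoeff τ k * quarticCoeff τ (j - k) * w k (j - k : ℕ)

/-- `lapRadial` acts on `X^l` with this coefficient. -/
def lapWeight (n l : ℝ) : ℝ := l * (4 * l + 2 * n + 4)

def sqCoeff (τ : ℝ) : ℕ → ℝ := conv τ fun _ _ => 1

def gradCoeff (τ : ℝ) : ℕ → ℝ := conv τ fun k l => 4 * k * l + 8 * l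

def mixCoeff (n τ : ℝ) : ℕ → ℝ := conv τ fun _ l => lapWeight n l

def lapSqCoeff (n τ : ℝ) : ℕ → ℝ := conv τ fun k l => lapWeight n k * lapWeight n l

/-- With g the image of the quartic φ under `lapRadial`, the terms 4Xφ'g' and 4φ'g combine to the
weight 4kl, while 4φg' gives 4(l - 1). -/
def divCoeff (n τ : ℝ) : ℕ → ℝ := conv τ fun k l =>
  lapWeight n k * lapWeight n l + 4 * k * l * lapWeight n l + 4 * (l - 1) * lapWeight n l

lemma quarticPoly_sq (τ : ℝ) : quarticPoly τ ^ 2 =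
    ∑ j ∈ Finset.range 9, Polynomial.C (sqCoeff τ j) * Polynomial.X ^ j := by
  simp [Finset.sum_range_succ, sqCoeff, conv, quarticCoeff, quarticPoly]
  simp only [map_ofNat Polynomial.C]
  ring

/-- The index j is the sum k + l of the indices of the two coefficients, not the resulting power of
X. All expressions then share the index that belongs to λ^(2j+4), and the coefficients with
truncated exponents vanish. -/
lemma quarticPoly_grad (τ : ℝ) :
    4 * Polynomial.X * (quarticPoly τ).derivative ^ 2 + 8 * quarticPoly τ * (quarticPoly τ).derivative
      = ∑ j ∈ Finset.range 9, Polynomial.C (gradCoeff τ j) * Polynomial.X ^ (j - 1) := by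
  simp [Finset.sum_range_succ, gradCoeff, conv, quarticCoeff, quarticPoly]
  simp only [map_ofNat Polynomial.C]
  ring

lemma quarticPoly_mix (τ : ℝ) : quarticPoly τ * lapRadial N (quarticPoly τ)
      = ∑ j ∈ Finset.range 9, Polynomial.C (mixCoeff N τ j) * Polynomial.X ^ (j - 1) := by
  simp [Finset.sum_range_succ, mixCoeff, lapRadial, lapWeight, conv, quarticCoeff, quarticPoly]
  simp only [map_ofNat Polynomial.C]
  ring

lemma quarticPoly_lapSq (τ : ℝ) : lapRadial N (quarticPoly τ) ^ 2
      = ∑ j ∈ Finset.range 9, Polynomial.C (lapSqCoeff N τ j) * Polynomial.X ^ (j - 2) := by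
  simp [Finset.sum_range_succ, lapSqCoeff, lapRadial, lapWeight, conv, quarticCoeff, quarticPoly]
  simp only [map_ofNat Polynomial.C]
  ring

lemma quarticPoly_div (τ : ℝ) : lapRadial N (quarticPoly τ) ^ 2
    + 4 * Polynomial.X * (quarticPoly τ).derivative * (lapRadial N (quarticPoly τ)).derivative
    + 4 * (quarticPoly τ).derivative * lapRadial N (quarticPoly τ)
    + 4 * quarticPoly τ * (lapRadial N (quarticPoly τ)).derivative
      = ∑ j ∈ Finset.range 9, Polynomial.C (divCoeff N τ j) * Polynomial.X ^ (j - 2) := by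
  simp [Finset.sum_range_succ, divCoeff, lapRadial, lapWeight, conv, quarticCoeff, quarticPoly]
  simp only [map_ofNat Polynomial.C]
  ring

end PaneitzBlowup
end

noncomputable section

namespace PaneitzBlowup

open MvPolynomial MeasureTheory Asymptotics Filter

variable {N : ℕ} {W : Fin N → Fin N → Fin N → Fin N → ℝ}

/-! ### The expansion of the explicit part of `F` -/

lemma lap_nsq_pow_mul_of_isHomogeneous {h : Poly N} {d : ℕ} (hh : h.IsHomogeneous d) (i : ℕ) :
    lap (nsq ^ i * h) = C (i * (4 * ((i : ℝ) - 1) + 2 * N + 4 * d)) * (nsq ^ (i - 1) * h)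
      + nsq ^ i * lap h := by
  have h1 := lap_aeval_nsq_mul (Polynomial.X ^ i) hh
  rw [map_pow, Polynomial.aeval_X] at h1
  rw [h1]
  congr 1
  rw [← mul_assoc]
  congr 1
  rcases i with _ | _ | i
  · simp
  · simp [algebraMap_eq]
  · simp [algebraMap_eq]
    simp only [map_ofNat C, map_ofNat (Polynomial.aeval (nsq : Poly N))]
    ring

lemma radial_sum (a : ℕ → ℝ) (i : ℕ) (P : Poly N) :
    radial N (∑ j ∈ Finset.range 9, Polynomial.C (a j) * Polynomial.X ^ (j - i)) * P =
      ∑ j ∈ Finset.range 9, C (a j) * (nsq ^ (j - i) * P) := by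
  simp [radial, Finset.sum_mul, mul_assoc, algebraMap_eq]

lemma quarticPoly_sq' (τ : ℝ) : quarticPoly τ ^ 2 =
    ∑ j ∈ Finset.range 9, Polynomial.C (sqCoeff τ j) * Polynomial.X ^ (j - 0) := quarticPoly_sq τ

lemma gradHbar_sum (τ : ℝ) : gradHbar (quarticPoly τ) W = ∑ j ∈ Finset.range 9,
    (C (gradCoeff τ j) * (nsq ^ (j - 1) * sqSum (Hfam W))
      + C (sqCoeff τ j) * (nsq ^ j * gradSum (Hfam W))) := by
  rw [gradHbar_eq, quarticPoly_grad, quarticPoly_sq', radial_sum, radial_sum,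
    ← Finset.sum_add_distrib]
  rfl

/-- The coefficients of `Δ|∂H̄|²`. -/
def lapCoeffA (n τ : ℝ) (j : ℕ) : ℝ := gradCoeff τ j * ((j - 1) * (4 * j + 2 * n + 8))

/-- The coefficients of `Δ|∂H̄|²`. -/
def lapCoeffG (n τ : ℝ) (j : ℕ) : ℝ :=
  2 * gradCoeff τ j + sqCoeff τ j * (j * (4 * j + 2 * n + 4))

/-- A sum of graded pieces. -/
def gradedSum (W : Fin N → Fin N → Fin N → Fin N → ℝ) (α β γ : ℕ → ℝ) : Poly N :=
  ∑ j ∈ Finset.range 9, (C (α j) * (nsq ^ (j - 2) * sqSum (Hfam W))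
    + C (β j) * (nsq ^ (j - 1) * gradSum (Hfam W)) + C (γ j * hessSum (Hfam W)) * nsq ^ j)

lemma gradCoeff_zero (τ : ℝ) : gradCoeff τ 0 = 0 := by simp [gradCoeff, conv]

lemma mixCoeff_zero (n τ : ℝ) : mixCoeff n τ 0 = 0 := by simp [mixCoeff, conv, lapWeight]

lemma lapSqCoeff_of_lt (n τ : ℝ) {j : ℕ} (hj : j < 2) : lapSqCoeff n τ j = 0 := by
  interval_cases j <;> simp [lapSqCoeff, conv, lapWeight, Finset.sum_range_succ]

lemma divCoeff_of_lt (n τ : ℝ) {j : ℕ} (hj : j < 2) : divCoeff n τ j = 0 := by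
  interval_cases j <;> simp [divCoeff, conv, lapWeight, Finset.sum_range_succ]

lemma lapCoeffA_of_lt (n τ : ℝ) {j : ℕ} (hj : j < 2) : lapCoeffA n τ j = 0 := by
  interval_cases j <;> simp [lapCoeffA, gradCoeff_zero]

lemma lapCoeffG_zero (n τ : ℝ) : lapCoeffG n τ 0 = 0 := by simp [lapCoeffG, gradCoeff_zero]

/-- Since Δ∑H² = 2∑|∇H|² and Δ∑|∇H|² = 2∑|∇²H|², the Laplacian stays within graded sums and
preserves the index j. -/
lemma lap_gradHbar (hW : IsWeylTensor W) (τ : ℝ) : lap (gradHbar (quarticPoly τ) W) =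
    gradedSum W (lapCoeffA N τ) (lapCoeffG N τ) (fun j => 2 * sqCoeff τ j) := by
  have hq := isSolidHarmonic_Hfam hW
  rw [gradHbar_sum, map_sum, gradedSum]
  refine Finset.sum_congr rfl fun j _ => ?_
  rw [map_add, lap_C_mul, lap_C_mul, lap_nsq_pow_mul_of_isHomogeneous (isHomogeneous_sqSum hq),
    lap_nsq_pow_mul_of_isHomogeneous (isHomogeneous_gradSum hq), lap_sqSum hq, lap_gradSum hq]
  rcases j with _ | j
  · simp [gradCoeff_zero, lapCoeffA_of_lt, lapCoeffG_zero, C_mul]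
    ring
  · simp only [lapCoeffA, lapCoeffG, C_mul, C_add, C_sub, Nat.add_sub_cancel,
      show j + 1 - 2 = j - 1 by omega]
    push_cast
    simp only [C_add, C_1, map_ofNat C]
    ring

lemma divHbar_sum (τ : ℝ) : divHbar (quarticPoly τ) W =
    gradedSum W (divCoeff N τ) (mixCoeff N τ) (fun _ => 0) := by
  rw [divHbar, quarticPoly_div, quarticPoly_mix, radial_sum, radial_sum, ← Finset.sum_add_distrib,
    gradedSum]
  simp

lemma lap_gradHbar_add (hW : IsWeylTensor W) (τ : ℝ) :
    lap (gradHbar (quarticPoly τ) W) + 2 * divHbar (quarticPoly τ) W =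
    gradedSum W (fun j => lapCoeffA N τ j + 2 * divCoeff N τ j)
      (fun j => lapCoeffG N τ j + 2 * mixCoeff N τ j) (fun j => 2 * sqCoeff τ j) := by
  rw [lap_gradHbar hW, divHbar_sum, gradedSum, gradedSum, gradedSum, Finset.mul_sum,
    ← Finset.sum_add_distrib]
  refine Finset.sum_congr rfl fun j _ => ?_
  simp only [C_add, C_mul, map_ofNat C, C_0]
  ring

lemma lapSq_sum (τ : ℝ) : radial N (lapRadial N (quarticPoly τ) ^ 2) * sqSum (Hfam W) =
    gradedSum W (lapSqCoeff N τ) (fun _ => 0) (fun _ => 0) := by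
  rw [quarticPoly_lapSq, radial_sum, gradedSum]
  simp

lemma degree_nsq_pow_mul {h : Poly N} {d : ℕ} (hh : h.IsHomogeneous d) (c : ℝ) (i : ℕ) :
    ((C c * (nsq ^ i * h)).totalDegree : ℝ) ≤ 2 * i + d := by
  exact_mod_cast (isHomogeneous_C_mul' ((isHomogeneous_nsq.pow i).mul hh) c).totalDegree_le

lemma hasExpansion_gradedSum (hN : 25 ≤ N) (hW : IsWeylTensor W) {α β γ : ℕ → ℝ}
    (hα : ∀ j < 2, α j = 0) (hβ : β 0 = 0) :
    HasExpansion (polyFun (gradSum (Hfam W))) (scaledMoment (N - 4) (gradedSum W α β γ))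
      (fun l => hessSum (Hfam W) * ∑ j ∈ Finset.range 9,
        (α j / (2 * N * (N + 2)) + β j / N + γ j) * radialMoment N j (N - 4) * l ^ (2 * j + 4))
      (hessSum (Hfam W) * ∑ j ∈ Finset.range 9, ((α j / (2 * N * (N + 2)) + β j / N + γ j)
        * (j * (2 * j + N - 2) / N * radialMoment N (j - 1) (N - 4))
        - (α j / (N + 4) + β j) * kappa N (j - 1) (N - 4) / N))
      (∑ j ∈ Finset.range 9, (α j / (N + 4) + β j) * kappa N (j - 1) (N - 4)) := by
  have hq := isSolidHarmonic_Hfam hW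
  have hN' : (25 : ℝ) ≤ N := by exact_mod_cast hN
  have h := HasExpansion.sum fun j (hj : j ∈ Finset.range 9) =>
    hasExpansion_piece_hess hq (by omega) j (s := (N : ℝ) - 4) (c := α j) (c' := β j) (c'' := γ j)
      (by
        have : (j : ℝ) ≤ 8 := by
          exact_mod_cast Nat.lt_succ_iff.1 (Finset.mem_range.1 hj)
        linarith) (hα j) (fun h => by rw [h, hβ])
  refine h.congr' ?_ (fun l _ => ?_) ?_ rfl
  · filter_upwards [eventually_snd_pos] with p hp
    have d1 : ∀ j < 9, ((C (α j) * (nsq ^ (j - 2) * sqSum (Hfam W))).totalDegree : ℝ) ≤ 16 :=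
      fun j hj => (degree_nsq_pow_mul (isHomogeneous_sqSum hq) _ _).trans (by
        exact_mod_cast (by omega : 2 * (j - 2) + 4 ≤ 16))
    have d2 : ∀ j < 9, ((C (β j) * (nsq ^ (j - 1) * gradSum (Hfam W))).totalDegree : ℝ) ≤ 16 :=
      fun j hj => (degree_nsq_pow_mul (isHomogeneous_gradSum hq) _ _).trans (by
        exact_mod_cast (by omega : 2 * (j - 1) + 2 ≤ 16))
    have d3 : ∀ j < 9, ((C (γ j * hessSum (Hfam W)) * nsq ^ j : Poly N).totalDegree : ℝ) ≤ 16 :=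
      fun j hj => by
        have := (isHomogeneous_C_mul' (isHomogeneous_nsq.pow j : (nsq ^ j : Poly N).IsHomogeneous _)
          (γ j * hessSum (Hfam W))).totalDegree_le
        exact_mod_cast this.trans (by omega : 2 * j ≤ 16)
    have d12 : ∀ j < 9, ((C (α j) * (nsq ^ (j - 2) * sqSum (Hfam W))
        + C (β j) * (nsq ^ (j - 1) * gradSum (Hfam W))).totalDegree : ℝ) ≤ 16 := fun j hj => by
      have h1 := d1 j hj
      have h2 := d2 j hj
      norm_cast at h1 h2 ⊢
      exact (totalDegree_add _ _).trans (max_le h1 h2)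
    rw [gradedSum, scaledMoment_sum _ hp]
    · refine Finset.sum_congr rfl fun j hj => ?_
      have hj' := Finset.mem_range.1 hj
      rw [scaledMoment_add hp (by linarith [d12 j hj']) (by linarith [d3 j hj']),
        scaledMoment_add hp (by linarith [d1 j hj']) (by linarith [d2 j hj'])]
      simp only [scaledMoment_C_mul]
      ring
    · intro j hj
      have hj' := Finset.mem_range.1 hj
      have h1 := d12 j hj'
      have h2 := d3 j hj'
      norm_cast at h1 h2
      have : ((C (α j) * (nsq ^ (j - 2) * sqSum (Hfam W))
        + C (β j) * (nsq ^ (j - 1) * gradSum (Hfam W))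
        + C (γ j * hessSum (Hfam W)) * nsq ^ j).totalDegree : ℝ) ≤ 16 := by
        exact_mod_cast (totalDegree_add _ _).trans (max_le h1 h2)
      linarith
  · rw [Finset.mul_sum]
    refine Finset.sum_congr rfl fun j _ => ?_
    -- For the exponent s = N - 4 the powers of λ become natural: the grading index j matches
    -- λ^(2j+4), as in I.
    rw [show 2 * (N : ℝ) - 4 - 2 * (N - 4) + 2 * j = ((2 * j + 4 : ℕ) : ℝ) by push_cast; ring,
      Real.rpow_natCast]
    ring
  · rw [Finset.mul_sum]

lemma hasExpansion_gradHbar (hN : 25 ≤ N) (hW : IsWeylTensor W) (τ : ℝ) {s : ℝ}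
    (hs : (N : ℝ) - 3 ≤ s) :
    HasExpansion (polyFun (gradSum (Hfam W))) (scaledMoment s (gradHbar (quarticPoly τ) W))
      (fun l => hessSum (Hfam W) * ∑ j ∈ Finset.range 9,
        (gradCoeff τ j / (2 * N * (N + 2)) + sqCoeff τ j / N) * radialMoment N (j + 1) s
          * l ^ (2 * (N : ℝ) - 4 - 2 * s + 2 * (j + 1)))
      (hessSum (Hfam W) * ∑ j ∈ Finset.range 9,
        ((gradCoeff τ j / (2 * N * (N + 2)) + sqCoeff τ j / N)
        * ((j + 1) * (2 * j + N) / N * radialMoment N j s)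
        - (gradCoeff τ j / (N + 4) + sqCoeff τ j) * kappa N j s / N))
      (∑ j ∈ Finset.range 9, (gradCoeff τ j / (N + 4) + sqCoeff τ j) * kappa N j s) := by
  have hq := isSolidHarmonic_Hfam hW
  have hN' : (25 : ℝ) ≤ N := by exact_mod_cast hN
  have h := HasExpansion.sum fun j (hj : j ∈ Finset.range 9) =>
    hasExpansion_piece_grad hq (by omega) j (s := s) (c := gradCoeff τ j) (c' := sqCoeff τ j)
      (by
        have : (j : ℝ) ≤ 8 := by
          exact_mod_cast Nat.lt_succ_iff.1 (Finset.mem_range.1 hj)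
        linarith) (fun h => by rw [h, gradCoeff_zero])
  refine h.congr' ?_ (fun l _ => ?_) ?_ rfl
  · filter_upwards [eventually_snd_pos] with p hp
    have d1 : ∀ j < 9, ((C (gradCoeff τ j) * (nsq ^ (j - 1) * sqSum (Hfam W))).totalDegree : ℝ)
        ≤ 18 := fun j hj => (degree_nsq_pow_mul (isHomogeneous_sqSum hq) _ _).trans (by
        exact_mod_cast (by omega : 2 * (j - 1) + 4 ≤ 18))
    have d2 : ∀ j < 9, ((C (sqCoeff τ j) * (nsq ^ j * gradSum (Hfam W))).totalDegree : ℝ) ≤ 18 :=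
      fun j hj => (degree_nsq_pow_mul (isHomogeneous_gradSum hq) _ _).trans (by
        exact_mod_cast (by omega : 2 * j + 2 ≤ 18))
    rw [gradHbar_sum, scaledMoment_sum _ hp]
    · refine Finset.sum_congr rfl fun j hj => ?_
      have hj' := Finset.mem_range.1 hj
      rw [scaledMoment_add hp (by linarith [d1 j hj']) (by linarith [d2 j hj'])]
      simp only [scaledMoment_C_mul]
    · intro j hj
      have hj' := Finset.mem_range.1 hj
      have h1 := d1 j hj'
      have h2 := d2 j hj'
      norm_cast at h1 h2
      have : ((C (gradCoeff τ j) * (nsq ^ (j - 1) * sqSum (Hfam W))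
        + C (sqCoeff τ j) * (nsq ^ j * gradSum (Hfam W))).totalDegree : ℝ) ≤ 18 := by
        exact_mod_cast (totalDegree_add _ _).trans (max_le h1 h2)
      linarith
  · rw [Finset.mul_sum]
    refine Finset.sum_congr rfl fun j _ => ?_
    ring
  · rw [Finset.mul_sum]

/-- The explicit part of `F / γ_N²`. -/
def reducedF (τ : ℝ) (W : Fin N → Fin N → Fin N → Fin N → ℝ) (p : E N × ℝ) : ℝ :=
  -(aN N * mN N ^ 2) * scaledMoment (N - 3) (gradHbar (quarticPoly τ) W) p
  + aN N * mN N ^ 2 * (p.2 ^ 2 * scaledMoment (N - 2) (gradHbar (quarticPoly τ) W) p)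
  + -(bN N * mN N ^ 2 / (2 * (N - 3))) * scaledMoment (N - 3) (gradHbar (quarticPoly τ) W) p
  + -(bN N * mN N ^ 2 / (8 * (N - 3) * (N - 4))) * scaledMoment (N - 4)
      (lap (gradHbar (quarticPoly τ) W) + 2 * divHbar (quarticPoly τ) W) p
  + ((N : ℝ) - 4) / (16 * (N - 1)) * scaledMoment (N - 4) (lap (gradHbar (quarticPoly τ) W)) p
  + -(((N : ℝ) - 4) / (4 * (N - 2) ^ 2)) * scaledMoment (N - 4)
      (radial N (lapRadial N (quarticPoly τ) ^ 2) * sqSum (Hfam W)) p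
  + 16 * mN N ^ 2 * (mN N + 1) * quadMoment W (quarticPoly τ * quarticPoly τ) (N - 1) p
  + 16 * mN N ^ 2 * (mN N + 1) * (mN N + 2)
      * (p.2 ^ 2 * quadMoment W (quarticPoly τ * quarticPoly τ) N p)
  + 2 * bN N * mN N ^ 2 * quadMoment W (quarticPoly τ * lapRadial N (quarticPoly τ)) (N - 2) p

/-- The square term and the corrector term are left as integrals: of the former only the sign and
the vanishing at ξ = 0 matter, of the latter only the size. -/
lemma auxF_eq (hN : 25 ≤ N) (hW : IsWeylTensor W) (τ μ ε : ℝ) (w : E N → ℝ → E N → ℝ)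
    {p : E N × ℝ} (hp : 0 < p.2) :
    auxF τ W μ ε w p = gammaN N ^ 2 * reducedF τ W p
      + (∫ y, (∑ i, ∑ j, Hbar τ W i j y * pd i (pd j (bubble p.1 p.2)) y) ^ 2)
      + ∫ y, bracket τ W p.1 p.2 y * (w p.1 p.2 y / (μ * ε ^ 10)) := by
  obtain ⟨ξ, lam⟩ := p
  have hl : 0 < lam := hp
  have hN' : (25 : ℝ) ≤ N := by exact_mod_cast hN
  have hdeg : (quarticPoly τ * lapRadial N (quarticPoly τ)).natDegree ≤ 7 :=
    Polynomial.natDegree_mul_le.trans (by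
      have := natDegree_quarticPoly_le τ
      have := natDegree_lapRadial_le (N := N) τ
      omega)
  have hdeg' : ((quarticPoly τ * lapRadial N (quarticPoly τ)).natDegree : ℝ) ≤ 7 := by
    exact_mod_cast hdeg
  have hmix := scaledMoment_quad (W := W) (quarticPoly τ * lapRadial N (quarticPoly τ))
    (s := (N : ℝ) - 2) (p := (ξ, lam)) hl (by linarith)
  simp only [auxF]
  rw [integral_first hN hW τ hl, integral_aN hN τ hl, integral_bN hN hW τ hl,
    integral_cubic hW τ hl, integral_lap_mul hW τ hl, integral_zeroth τ hl,
    integral_lap_sq hW τ hl, reducedF]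
  simp only at hmix
  rw [hmix]
  have h1 : (N : ℝ) - 1 ≠ 0 := by linarith
  have h2 : (N : ℝ) - 2 ≠ 0 := by linarith
  have h3 : (N : ℝ) - 3 ≠ 0 := by linarith
  have h4 : (N : ℝ) - 4 ≠ 0 := by linarith
  field_simp
  ring

end PaneitzBlowup
end

noncomputable section

namespace PaneitzBlowup

open MvPolynomial MeasureTheory Asymptotics Filter

variable {N : ℕ} {W : Fin N → Fin N → Fin N → Fin N → ℝ}

/-! ### Radial moments in terms of a common factor -/

lemma radialMoment_exponent (j : ℕ) {s : ℝ} (hs : (N : ℝ) + 2 * j + 1 ≤ 2 * s) :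
    2 * s * radialMoment N j (s + 1) = (2 * s - 2 * j - N) * radialMoment N j s := by
  have h1 := radialMoment_succ_succ j hs
  have h2 := radialMoment_add (N := N) j (s := s) (by linarith)
  linear_combination -2 * s * h2 - h1

lemma radialMoment_succ (j : ℕ) {s : ℝ} (hs : (N : ℝ) + 2 * j + 3 ≤ 2 * s) :
    (2 * s - 2 - 2 * j - N) * radialMoment N (j + 1) s = (2 * j + N) * radialMoment N j s := by
  have h1 := radialMoment_succ_succ (N := N) j (s := s - 1) (by linarith)
  have h2 := radialMoment_add (N := N) j (s := s - 1) (by linarith)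
  rw [sub_add_cancel] at h1 h2
  linear_combination h1 + (2 * j + N) * h2

/-- Consecutive moments have ratio (N + 2j)/(2s - 2 - 2j - N) by `radialMoment_succ`. Clearing the
eight positive denominators makes all of them polynomial multiples of one positive number, so that
signs of combinations become signs of polynomials. -/
lemma exists_radialMoment_eq (hN : 2 ≤ N) {s : ℝ} (hs : (N : ℝ) + 17 ≤ 2 * s) :
    ∃ κ : ℝ, 0 < κ ∧ ∀ j ≤ 8, radialMoment N j s =
      κ * ((∏ i ∈ Finset.range j, ((N : ℝ) + 2 * i)) *
        ∏ i ∈ Finset.Ico j 8, (2 * s - 2 - 2 * i - N)) := by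
  have hpos : ∀ i : ℕ, i < 8 → 0 < 2 * s - 2 - 2 * (i : ℝ) - N := fun i hi => by
    have : (i : ℝ) ≤ 7 := by exact_mod_cast Nat.lt_succ_iff.1 hi
    linarith
  have hprod : 0 < ∏ i ∈ Finset.Ico (0 : ℕ) 8, (2 * s - 2 - 2 * (i : ℝ) - N) :=
    Finset.prod_pos fun i hi => hpos i (Finset.mem_Ico.1 hi).2
  refine ⟨radialMoment N 0 s / ∏ i ∈ Finset.Ico (0 : ℕ) 8, (2 * s - 2 - 2 * (i : ℝ) - N),
    div_pos (radialMoment_pos 0 (by push_cast; linarith) hN) hprod, fun j => ?_⟩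
  induction j with
  | zero =>
    intro _
    rw [Finset.range_zero, Finset.prod_empty, one_mul, div_mul_cancel₀ _ hprod.ne']
  | succ j ih =>
    intro hj
    have hj' : (j : ℝ) ≤ 7 := by exact_mod_cast Nat.lt_succ_iff.1 hj
    have h1 := radialMoment_succ (N := N) j (s := s) (by linarith)
    rw [ih (by omega), Finset.prod_eq_prod_Ico_succ_bot (by omega : j < 8)] at h1
    have h2 := (hpos j (by omega)).ne'
    refine mul_left_cancel₀ h2 (h1.trans ?_)
    rw [Finset.prod_range_succ]
    ring

/-! ### The coefficients of the expansion of the explicit part of `F` -/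

/-- The coefficient of `λ^(2j+4)`, up to the moment of `|y|^(2j)`. -/
def leadFactor (N : ℕ) (τ : ℝ) (j : ℕ) : ℝ :=
  (-(aN N * mN N ^ 2) * ((N + 2 * j + 2) / (2 * (N - 3))) - bN N * mN N ^ 2 / (2 * (N - 3)))
      * (gradCoeff τ j / (2 * N * (N + 2)) + sqCoeff τ j / N) * ((2 * j + N) / (2 * (N - 4)))
  - bN N * mN N ^ 2 / (8 * (N - 3) * (N - 4))
      * ((lapCoeffA N τ j + 2 * divCoeff N τ j) / (2 * N * (N + 2))
        + (lapCoeffG N τ j + 2 * mixCoeff N τ j) / N + 2 * sqCoeff τ j)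
  + (N - 4) / (16 * (N - 1)) * (lapCoeffA N τ j / (2 * N * (N + 2)) + lapCoeffG N τ j / N
      + 2 * sqCoeff τ j)
  - (N - 4) / (4 * (N - 2) ^ 2) * (lapSqCoeff N τ j / (2 * N * (N + 2)))

/-- The contribution of a graded piece to the coefficient of `G(ξ)`. -/
def pieceC (n j α β : ℝ) : ℝ := (α / (n + 4) + β) * (2 * (n - 4) * (2 * j + n) / (n * (n + 2)))

/-- The contribution of a graded piece to the coefficient of `|ξ|²`. -/
def pieceB (n j α β γ : ℝ) : ℝ :=
  (α / (2 * n * (n + 2)) + β / n + γ) * (2 * (n - 4) * j / n) - pieceC n j α β / n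

/-- The coefficient of `|ξ|²`, up to a moment. -/
def hessFactorB (N : ℕ) (τ : ℝ) (j : ℕ) : ℝ :=
  (-(aN N * mN N ^ 2) * ((N + 2 * j) / (2 * (N - 3))) - bN N * mN N ^ 2 / (2 * (N - 3)))
      * ((gradCoeff τ j / (2 * N * (N + 2)) + sqCoeff τ j / N) * ((j + 1) * (2 * j + N) / N)
        - (gradCoeff τ j / (N + 4) + sqCoeff τ j)
          * ((2 * j + N) * (2 * j + N + 2) / (N * (N + 2))) / N)
  - bN N * mN N ^ 2 / (8 * (N - 3) * (N - 4)) * pieceB N j (lapCoeffA N τ j + 2 * divCoeff N τ j)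
      (lapCoeffG N τ j + 2 * mixCoeff N τ j) (2 * sqCoeff τ j)
  + (N - 4) / (16 * (N - 1)) * pieceB N j (lapCoeffA N τ j) (lapCoeffG N τ j) (2 * sqCoeff τ j)
  - (N - 4) / (4 * (N - 2) ^ 2) * pieceB N j (lapSqCoeff N τ j) 0 0

/-- The coefficient of `G(ξ)`, up to a moment. -/
def hessFactorC (N : ℕ) (τ : ℝ) (j : ℕ) : ℝ :=
  (-(aN N * mN N ^ 2) * ((N + 2 * j) / (2 * (N - 3))) - bN N * mN N ^ 2 / (2 * (N - 3)))
      * ((gradCoeff τ j / (N + 4) + sqCoeff τ j)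
          * ((2 * j + N) * (2 * j + N + 2) / (N * (N + 2))))
  - bN N * mN N ^ 2 / (8 * (N - 3) * (N - 4)) * pieceC N j (lapCoeffA N τ j + 2 * divCoeff N τ j)
      (lapCoeffG N τ j + 2 * mixCoeff N τ j)
  + (N - 4) / (16 * (N - 1)) * pieceC N j (lapCoeffA N τ j) (lapCoeffG N τ j)
  - (N - 4) / (4 * (N - 2) ^ 2) * pieceC N j (lapSqCoeff N τ j) 0
  + 16 * mN N ^ 2 * (mN N + 1) / (2 * N * (N + 2)) * sqCoeff τ j
      * ((2 * j + 2 + N) / (2 * (N - 2)) * ((2 * j + N) / (2 * (N - 3)))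
        + (mN N + 2) * ((2 * j + 2 + N) / (2 * (N - 1)) * ((2 * j + N) / (2 * (N - 2)))
          * ((N - 6 - 2 * j) / (2 * (N - 3)))))
  + 2 * bN N * mN N ^ 2 / (2 * N * (N + 2)) * mixCoeff N τ j * ((2 * j + N) / (2 * (N - 3)))

lemma hasExpansion_quadMoment_sq (hN : 25 ≤ N) (hW : IsWeylTensor W) (τ : ℝ) {s : ℝ}
    (hs : (N : ℝ) - 1 ≤ s) :
    HasExpansion (polyFun (gradSum (Hfam W)))
      (quadMoment W (quarticPoly τ * quarticPoly τ) s) (fun _ => 0) 0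
      ((∑ j ∈ Finset.range 9, sqCoeff τ j * radialMoment N (j + 2) s) / (2 * N * (N + 2))) := by
  have hN' : (25 : ℝ) ≤ N := by exact_mod_cast hN
  have hdeg : (quarticPoly τ * quarticPoly τ).natDegree < 9 :=
    (Polynomial.natDegree_mul_le.trans
      (by have := natDegree_quarticPoly_le τ; omega)).trans_lt (by norm_num : 8 < 9)
  have h := hasExpansion_quadMoment (by omega) hW _ hdeg (s := s) (by push_cast; linarith)
  refine h.congr' EventuallyEq.rfl (fun _ _ => rfl) rfl ?_
  congr 1
  refine Finset.sum_congr rfl fun j hj => ?_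
  rw [← sq, quarticPoly_sq, Polynomial.finsetSum_coeff]
  simp only [Polynomial.coeff_C_mul_X_pow]
  rw [Finset.sum_ite_eq, if_pos hj]

lemma hasExpansion_quadMoment_mix (hN : 25 ≤ N) (hW : IsWeylTensor W) (τ : ℝ) :
    HasExpansion (polyFun (gradSum (Hfam W)))
      (quadMoment W (quarticPoly τ * lapRadial N (quarticPoly τ)) (N - 2)) (fun _ => 0) 0
      ((∑ j ∈ Finset.range 9, mixCoeff N τ j * radialMoment N (j + 1) (N - 2))
        / (2 * N * (N + 2))) := by
  have hN' : (25 : ℝ) ≤ N := by exact_mod_cast hN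
  have hdeg : (quarticPoly τ * lapRadial N (quarticPoly τ)).natDegree < 8 :=
    (Polynomial.natDegree_mul_le.trans (by
      have := natDegree_quarticPoly_le τ
      have := natDegree_lapRadial_le N τ
      omega)).trans_lt (by norm_num : 7 < 8)
  have h := hasExpansion_quadMoment (by omega) hW _ hdeg (s := (N : ℝ) - 2) (by push_cast; linarith)
  refine h.congr' EventuallyEq.rfl (fun _ _ => rfl) rfl ?_
  congr 1
  rw [Finset.sum_range_succ', mixCoeff_zero, zero_mul, add_zero]
  refine Finset.sum_congr rfl fun j hj => ?_
  have e : quarticPoly τ * lapRadial N (quarticPoly τ) =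
      ∑ i ∈ Finset.range 8, Polynomial.C (mixCoeff N τ (i + 1)) * Polynomial.X ^ i := by
    rw [quarticPoly_mix, Finset.sum_range_succ', mixCoeff_zero]
    simp
  rw [e, Polynomial.finsetSum_coeff]
  simp only [Polynomial.coeff_C_mul_X_pow]
  rw [Finset.sum_ite_eq, if_pos hj]

/-- Reduces the moments of every exponent to two references: exponent N - 4 for the leading function
of λ, and exponent N - 3 for the coefficients of the quadratic part. -/
lemma radialMoment_relations (hN : 25 ≤ N) {j : ℕ} (hj : j < 9) :
    radialMoment N (j + 1) (N - 3) = (2 * j + N) / (2 * (N - 4)) * radialMoment N j (N - 4) ∧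
    radialMoment N (j + 1) (N - 2) = (N - 8 - 2 * j) / (2 * (N - 3))
      * ((2 * j + N) / (2 * (N - 4)) * radialMoment N j (N - 4)) ∧
    radialMoment N j (N - 2) = (N - 6 - 2 * j) / (2 * (N - 3)) * radialMoment N j (N - 3) ∧
    radialMoment N (j + 1) (N - 2) = (2 * j + N) / (2 * (N - 3)) * radialMoment N j (N - 3) ∧
    radialMoment N (j + 2) (N - 1) = (2 * j + 2 + N) / (2 * (N - 2))
      * ((2 * j + N) / (2 * (N - 3)) * radialMoment N j (N - 3)) ∧
    radialMoment N (j + 2) N = (2 * j + 2 + N) / (2 * (N - 1)) * ((2 * j + N) / (2 * (N - 2))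
      * ((N - 6 - 2 * j) / (2 * (N - 3)) * radialMoment N j (N - 3))) := by
  have hN' : (25 : ℝ) ≤ N := by exact_mod_cast hN
  have hj' : (j : ℝ) ≤ 8 := by exact_mod_cast Nat.lt_succ_iff.1 hj
  have h1 : (N : ℝ) - 1 ≠ 0 := by linarith
  have h2 : (N : ℝ) - 2 ≠ 0 := by linarith
  have h3 : (N : ℝ) - 3 ≠ 0 := by linarith
  have h4 : (N : ℝ) - 4 ≠ 0 := by linarith
  -- For j = 8 the condition N + 2j + 1 ≤ 2(N - 4) is exactly N ≥ 25.
  have a1 := radialMoment_succ_succ (N := N) j (s := (N : ℝ) - 4) (by linarith)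
  have a2 := radialMoment_exponent (N := N) (j + 1) (s := (N : ℝ) - 3) (by push_cast; linarith)
  have a3 := radialMoment_exponent (N := N) j (s := (N : ℝ) - 3) (by linarith)
  have a4 := radialMoment_succ_succ (N := N) j (s := (N : ℝ) - 3) (by linarith)
  have a5 := radialMoment_succ_succ (N := N) (j + 1) (s := (N : ℝ) - 2) (by push_cast; linarith)
  have a6 := radialMoment_succ_succ (N := N) j (s := (N : ℝ) - 2) (by linarith)
  have a7 := radialMoment_succ_succ (N := N) (j + 1) (s := (N : ℝ) - 1) (by push_cast; linarith)
  rw [show (N : ℝ) - 4 + 1 = N - 3 by ring] at a1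
  rw [show (N : ℝ) - 3 + 1 = N - 2 by ring] at a2 a3 a4
  rw [show (N : ℝ) - 2 + 1 = N - 1 by ring] at a5 a6
  rw [sub_add_cancel] at a7
  push_cast at a2 a5 a7
  have b1 : radialMoment N (j + 1) (N - 3) = (2 * j + N) / (2 * (N - 4))
      * radialMoment N j (N - 4) := by
    field_simp; linear_combination a1
  have b3 : radialMoment N j (N - 2) = (N - 6 - 2 * j) / (2 * (N - 3))
      * radialMoment N j (N - 3) := by
    field_simp; linear_combination a3
  have b4 : radialMoment N (j + 1) (N - 2) = (2 * j + N) / (2 * (N - 3))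
      * radialMoment N j (N - 3) := by
    field_simp; linear_combination a4
  have b6 : radialMoment N (j + 1) (N - 1) = (2 * j + N) / (2 * (N - 2))
      * radialMoment N j (N - 2) := by
    field_simp; linear_combination a6
  refine ⟨b1, ?_, b3, b4, ?_, ?_⟩
  · rw [← b1]; field_simp; linear_combination a2
  · rw [← b4]; field_simp; linear_combination a5
  · rw [← b3, ← b6]; field_simp; linear_combination a7

lemma radialMoment_pred (hN : 25 ≤ N) {j : ℕ} (hj : j < 9) :
    (j : ℝ) * (2 * j + N - 2) / N * radialMoment N (j - 1) (N - 4)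
      = 2 * (N - 4) * j / N * radialMoment N j (N - 3) := by
  have hN' : (25 : ℝ) ≤ N := by exact_mod_cast hN
  rcases j with _ | j
  · simp
  · have hj' : (j : ℝ) + 1 ≤ 8 := by exact_mod_cast Nat.lt_succ_iff.1 hj
    have h0 : (N : ℝ) ≠ 0 := by linarith
    have a1 := radialMoment_succ_succ (N := N) j (s := (N : ℝ) - 4) (by linarith)
    rw [show (N : ℝ) - 4 + 1 = N - 3 by ring] at a1
    rw [Nat.add_sub_cancel]
    push_cast
    field_simp
    linear_combination -a1

lemma kappa_pred (hN : 25 ≤ N) {j : ℕ} (hj : j < 9) {c : ℝ} (hc : j = 0 → c = 0) :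
    c * kappa N (j - 1) (N - 4) =
      c * (2 * (N - 4) * (2 * j + N) / (N * (N + 2))) * radialMoment N j (N - 3) := by
  have hN' : (25 : ℝ) ≤ N := by exact_mod_cast hN
  rcases j with _ | j
  · simp [hc rfl]
  · have hj' : (j : ℝ) + 1 ≤ 8 := by exact_mod_cast Nat.lt_succ_iff.1 hj
    have h0 : (N : ℝ) ≠ 0 := by linarith
    have h2 : (N : ℝ) + 2 ≠ 0 := by linarith
    have a1 := radialMoment_succ_succ (N := N) j (s := (N : ℝ) - 4) (by linarith)
    rw [show (N : ℝ) - 4 + 1 = N - 3 by ring] at a1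
    rw [Nat.add_sub_cancel, kappa]
    push_cast
    field_simp
    linear_combination -c * (2 * j + 2 + N) * a1

lemma hasExpansion_gradedSum' (hN : 25 ≤ N) (hW : IsWeylTensor W) {α β γ : ℕ → ℝ}
    (hα : ∀ j < 2, α j = 0) (hβ : β 0 = 0) :
    HasExpansion (polyFun (gradSum (Hfam W))) (scaledMoment (N - 4) (gradedSum W α β γ))
      (fun l => hessSum (Hfam W) * ∑ j ∈ Finset.range 9,
        (α j / (2 * N * (N + 2)) + β j / N + γ j) * radialMoment N j (N - 4) * l ^ (2 * j + 4))
      (hessSum (Hfam W) * ∑ j ∈ Finset.range 9,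
        pieceB N j (α j) (β j) (γ j) * radialMoment N j (N - 3))
      (∑ j ∈ Finset.range 9, pieceC N j (α j) (β j) * radialMoment N j (N - 3)) := by
  have hc : ∀ j, j = 0 → α j / ((N : ℝ) + 4) + β j = 0 := fun j hj => by
    rw [hj, hα 0 (by norm_num), hβ]; simp
  refine (hasExpansion_gradedSum hN hW hα hβ).congr' EventuallyEq.rfl (fun _ _ => rfl) ?_ ?_
  · congr 1
    refine Finset.sum_congr rfl fun j hj => ?_
    have hj' := Finset.mem_range.1 hj
    rw [radialMoment_pred hN hj', kappa_pred hN hj' (hc j), pieceB, pieceC]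
    ring
  · refine Finset.sum_congr rfl fun j hj => ?_
    rw [kappa_pred hN (Finset.mem_range.1 hj) (hc j), pieceC]

/-- The expansions of the nine terms are added index by index. The quadratic forms in ξ enter only
the coefficient of G. -/
theorem hasExpansion_reducedF (hN : 25 ≤ N) (hW : IsWeylTensor W) (τ : ℝ) :
    HasExpansion (polyFun (gradSum (Hfam W))) (reducedF τ W)
      (fun l => hessSum (Hfam W) * ∑ j ∈ Finset.range 9,
        leadFactor N τ j * radialMoment N j (N - 4) * l ^ (2 * j + 4))
      (hessSum (Hfam W) * ∑ j ∈ Finset.range 9, hessFactorB N τ j * radialMoment N j (N - 3))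
      (∑ j ∈ Finset.range 9, hessFactorC N τ j * radialMoment N j (N - 3)) := by
  have hN' : (25 : ℝ) ≤ N := by exact_mod_cast hN
  have hG := isBigO_polyFun_gradSum hW
  have e1 := hasExpansion_gradHbar hN hW τ (s := (N : ℝ) - 3) le_rfl
  have e2 := (hasExpansion_gradHbar hN hW τ (s := (N : ℝ) - 2) (by linarith)).snd_sq_mul hG
  have e3 := hasExpansion_gradedSum' hN hW (α := fun j => lapCoeffA N τ j + 2 * divCoeff N τ j)
    (β := fun j => lapCoeffG N τ j + 2 * mixCoeff N τ j) (γ := fun j => 2 * sqCoeff τ j)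
    (fun j hj => by rw [lapCoeffA_of_lt _ _ hj, divCoeff_of_lt _ _ hj]; simp)
    (by rw [lapCoeffG_zero, mixCoeff_zero]; simp)
  have e4 := hasExpansion_gradedSum' hN hW (α := lapCoeffA N τ) (β := lapCoeffG N τ)
    (γ := fun j => 2 * sqCoeff τ j) (fun j hj => lapCoeffA_of_lt _ _ hj) (lapCoeffG_zero _ _)
  have e5 := hasExpansion_gradedSum' hN hW (α := lapSqCoeff N τ) (β := fun _ => 0)
    (γ := fun _ => 0) (fun j hj => lapSqCoeff_of_lt _ _ hj) rfl
  have e6 := hasExpansion_quadMoment_sq hN hW τ (s := (N : ℝ) - 1) le_rfl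
  have e7 := (hasExpansion_quadMoment_sq hN hW τ (s := (N : ℝ)) (by linarith)).snd_sq_mul hG
  have e8 := hasExpansion_quadMoment_mix hN hW τ
  rw [← lap_gradHbar_add hW] at e3
  rw [← lap_gradHbar hW] at e4
  rw [← lapSq_sum] at e5
  have h := ((((((((e1.const_mul (-(aN N * mN N ^ 2))).add
    (e2.const_mul (aN N * mN N ^ 2))).add
    (e1.const_mul (-(bN N * mN N ^ 2 / (2 * (N - 3)))))).add
    (e3.const_mul (-(bN N * mN N ^ 2 / (8 * (N - 3) * (N - 4)))))).add
    (e4.const_mul (((N : ℝ) - 4) / (16 * (N - 1))))).add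
    (e5.const_mul (-(((N : ℝ) - 4) / (4 * (N - 2) ^ 2))))).add
    (e6.const_mul (16 * mN N ^ 2 * (mN N + 1)))).add
    (e7.const_mul (16 * mN N ^ 2 * (mN N + 1) * (mN N + 2)))).add
    (e8.const_mul (2 * bN N * mN N ^ 2))
  have h1 : (N : ℝ) - 1 ≠ 0 := by linarith
  have h2 : (N : ℝ) - 2 ≠ 0 := by linarith
  have h3 : (N : ℝ) - 3 ≠ 0 := by linarith
  have h4 : (N : ℝ) - 4 ≠ 0 := by linarith
  have h0 : (N : ℝ) ≠ 0 := by linarith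
  have h5 : (N : ℝ) + 2 ≠ 0 := by linarith
  have h6 : (N : ℝ) + 4 ≠ 0 := by linarith
  refine h.congr' EventuallyEq.rfl (fun l hl => ?_) ?_ ?_
  · have hexp : ∀ j : ℕ, l ^ (2 * (N : ℝ) - 4 - 2 * (N - 3) + 2 * (j + 1)) = l ^ (2 * j + 4) :=
      fun j => by
        rw [show 2 * (N : ℝ) - 4 - 2 * (N - 3) + 2 * (j + 1) = ((2 * j + 4 : ℕ) : ℝ) by
          push_cast; ring, Real.rpow_natCast]
    -- At exponent N - 2 the power is two lower; the explicit factor λ² restores 2j + 4.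
    have hexp' : ∀ j : ℕ, l ^ (2 * (N : ℝ) - 4 - 2 * (N - 2) + 2 * (j + 1)) = l ^ (2 * j + 2) :=
      fun j => by
        rw [show 2 * (N : ℝ) - 4 - 2 * (N - 2) + 2 * (j + 1) = ((2 * j + 2 : ℕ) : ℝ) by
          push_cast; ring, Real.rpow_natCast]
    simp only [hexp, hexp', mul_zero, add_zero, Finset.mul_sum, ← Finset.sum_add_distrib]
    refine Finset.sum_congr rfl fun j hj => ?_
    obtain ⟨r1, r2, -, -, -, -⟩ := radialMoment_relations hN (Finset.mem_range.1 hj)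
    rw [r2, r1, leadFactor]
    generalize radialMoment N j (N - 4) = ρ
    field_simp
    ring
  · simp only [mul_zero, add_zero, Finset.mul_sum, ← Finset.sum_add_distrib]
    refine Finset.sum_congr rfl fun j hj => ?_
    obtain ⟨-, -, r3, -, -, -⟩ := radialMoment_relations hN (Finset.mem_range.1 hj)
    simp only [kappa]
    rw [r3, hessFactorB]
    generalize radialMoment N j (N - 3) = ρ
    generalize pieceB N j _ _ _ = x1
    generalize pieceB N j _ _ _ = x2
    generalize pieceB N j _ _ _ = x3
    field_simp
    ring
  · simp only [Finset.mul_sum, Finset.sum_div, ← Finset.sum_add_distrib]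
    refine Finset.sum_congr rfl fun j hj => ?_
    obtain ⟨-, -, r3, r4, r5, r6⟩ := radialMoment_relations hN (Finset.mem_range.1 hj)
    simp only [kappa]
    rw [r3, r4, r5, r6, hessFactorC]
    generalize radialMoment N j (N - 3) = ρ
    generalize pieceC N j _ _ = x1
    generalize pieceC N j _ _ = x2
    generalize pieceC N j _ _ = x3
    field_simp
    ring

end PaneitzBlowup
end

noncomputable section

namespace PaneitzBlowup

open MvPolynomial MeasureTheory Asymptotics Filter

variable {N : ℕ}

/-! ### Comparison of the leading coefficients with `I` -/

/-- A common denominator of the coefficients of `I / (N - 4)`. -/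
def iDenom (n : ℝ) : ℝ :=
  (n - 24) * (n - 22) * (n - 20) * (n + 4) * (n + 6) * (n + 8) * (n + 10) * (n + 12)

/-- The numerators of the coefficients of `I / (N - 4)`. -/
def iNum (n τ : ℝ) : ℕ → ℝ
  | 0 => -((n - 24) * (n - 22) * (n - 20) * (n - 18) * (n - 16) * (n - 14) * (n - 12) * (n - 10)
      * (n - 2) ^ 2 * τ ^ 2 * (n ^ 2 - 4 * n - 4))
  | 1 => 24000 * (n - 24) * (n - 22) * (n - 20) * (n + 4) * (n - 18) * (n - 16) * (n - 14)
      * (n - 12) * (n - 2) * τ * (n ^ 3 - 8 * n ^ 2 + 16)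
  | 2 => -(2 * (n - 24) * (n - 22) * (n - 20) * (n + 4) * (n - 18) * (n - 16) * (n - 14)
      * ((2411 * τ + 72000000) * n ^ 5 - (14466 * τ + 288000000) * n ^ 4
          - (135016 * τ + 5760000000) * n ^ 3 + (308608 * τ + 14976000000) * n ^ 2
          + (347184 * τ - 2304000000) * n - 694368 * τ - 13824000000))
  | 3 => 30 * (n - 24) * (n - 22) * (n - 20) * (n + 4) * (n + 6) * (n - 18) * (n - 16)
      * ((9 * τ + 1928800) * n ^ 5 - (54 * τ + 3857600) * n ^ 4
          - (864 * τ + 293177600) * n ^ 3 + (1584 * τ + 648076800) * n ^ 2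
          + (2880 * τ + 61721600) * n - 4608 * τ - 740659200)
  | 4 => -((n - 24) * (n - 22) * (n - 20) * (n + 4) * (n + 6) * (n - 18)
      * ((2 * τ + 9052921) * n ^ 6 + (4 * τ + 84049210) * n ^ 5
          - (384 * τ + 2265707776) * n ^ 4 - (1856 * τ + 14204127072) * n ^ 3
          + (4704 * τ + 40189627120) * n ^ 2 + (7360 * τ - 1125216800) * n
          - 12800 * τ - 45033619968))
  | 5 => 30 * (n - 24) * (n - 22) * (n - 20) * (n + 4) * (n + 6) * (n + 8)
      * (22499 * n ^ 6 + 356784 * n ^ 5 - 7984044 * n ^ 4 - 76228592 * n ^ 3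
          + 193344928 * n ^ 2 - 4902016 * n - 209193984)
  | 6 => -((n - 24) * (n - 22) * (n + 4) * (n + 6) * (n + 8) * (n + 10)
      * (23047 * n ^ 6 + 543484 * n ^ 5 - 10985408 * n ^ 4 - 146678256 * n ^ 3
          + 351063488 * n ^ 2 - 16180224 * n - 363260160))
  | 7 => 270 * (n - 24) * (n + 4) * (n + 6) * (n + 8) * (n + 10) * (n + 12)
      * (n ^ 6 + 32 * n ^ 5 - 612 * n ^ 4 - 10768 * n ^ 3 + 24672 * n ^ 2 - 640 * n - 25600)
  | 8 => -((n + 14) * (n + 4) * (n + 6) * (n + 8) * (n + 10) * (n + 12)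
      * (n ^ 6 + 42 * n ^ 5 - 768 * n ^ 4 - 17248 * n ^ 3 + 38768 * n ^ 2 - 2336 * n - 38400))
  | _ => 0

lemma iDenom_pos (hN : 25 ≤ N) : 0 < iDenom N := by
  have hN' : (25 : ℝ) ≤ N := by exact_mod_cast hN
  have h1 : 0 < (N : ℝ) - 20 := by linarith
  have h2 : 0 < (N : ℝ) - 22 := by linarith
  have h3 : 0 < (N : ℝ) - 24 := by linarith
  unfold iDenom
  positivity

set_option maxHeartbeats 1000000 in
lemma Ipoly_eq (hN : 25 ≤ N) (τ lam : ℝ) : Ipoly N τ lam =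
    (N - 4) / iDenom N * ∑ j ∈ Finset.range 9, iNum N τ j * lam ^ (2 * j + 4) := by
  have hN' : (25 : ℝ) ≤ N := by exact_mod_cast hN
  have h1 : (N : ℝ) - 20 ≠ 0 := by linarith
  have h2 : (N : ℝ) - 22 ≠ 0 := by linarith
  have h3 : (N : ℝ) - 24 ≠ 0 := by linarith
  have h4 : (N : ℝ) + 4 ≠ 0 := by linarith
  have h5 : (N : ℝ) + 6 ≠ 0 := by linarith
  have h6 : (N : ℝ) + 8 ≠ 0 := by linarith
  have h7 : (N : ℝ) + 10 ≠ 0 := by linarith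
  have h8 : (N : ℝ) + 12 ≠ 0 := by linarith
  have key : ∀ {a b c d e f g h i x0 x1 x2 x3 x4 x5 x6 x7 x8 : ℝ}, -i = x0 → h = x1 → -g = x2 →
      f = x3 → -e = x4 → d = x5 → -c = x6 → b = x7 → -a = x8 →
      -a + b - c + d - e + f - g + h - i = x0 + x1 + x2 + x3 + x4 + x5 + x6 + x7 + x8 := by
    intros; linarith
  rw [Finset.mul_sum]
  simp only [Finset.sum_range_succ, Finset.sum_range_zero, zero_add, Ipoly]
  generalize (N : ℝ) = n at *
  refine key ?_ ?_ ?_ ?_ ?_ ?_ ?_ ?_ ?_ <;> simp only [iNum, iDenom, Nat.reduceMul, Nat.reduceAdd] <;>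
    field_simp

/-- The numerator of `leadFactor`. -/
def leadNum (n τ : ℝ) (j : ℕ) : ℝ :=
  ((n - 2) * (2 * j + n) * (8 * (n - 1) - (n ^ 2 - 4 * n + 8) * (n + 2 * j + 2)))
      * (gradCoeff τ j + 2 * (n + 2) * sqCoeff τ j)
  + (4 * (n - 1) * (n - 2) + 2 * (n - 2) ^ 2 * (n - 3))
      * (lapCoeffA n τ j + 2 * (n + 2) * lapCoeffG n τ j + 4 * n * (n + 2) * sqCoeff τ j)
  + 8 * (n - 1) * (n - 2) * (divCoeff n τ j + 2 * (n + 2) * mixCoeff n τ j)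
  - 8 * (n - 1) * (n - 3) * lapSqCoeff n τ j

lemma leadFactor_eq (hN : 25 ≤ N) (τ : ℝ) (j : ℕ) : leadFactor N τ j =
    (N - 4) * leadNum N τ j / (64 * N * (N + 2) * (N - 1) * (N - 2) ^ 2 * (N - 3)) := by
  have hN' : (25 : ℝ) ≤ N := by exact_mod_cast hN
  have h1 : (N : ℝ) - 1 ≠ 0 := by linarith
  have h2 : (N : ℝ) - 2 ≠ 0 := by linarith
  have h3 : (N : ℝ) - 3 ≠ 0 := by linarith
  have h4 : (N : ℝ) - 4 ≠ 0 := by linarith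
  have h5 : (N : ℝ) ≠ 0 := by linarith
  have h6 : (N : ℝ) + 2 ≠ 0 := by linarith
  rw [leadFactor, leadNum, aN, bN, mN]
  field_simp
  ring

/-- Nine polynomial identities in n and τ, one for each power of λ, that identify the leading
coefficients of F with those of I. The product is the moment of |y|^(2j) at s = n - 4 up to the
common factor. -/
lemma leadNum_mul (n τ : ℝ) {j : ℕ} (hj : j < 9) :
    leadNum n τ j * ((∏ i ∈ Finset.range j, (n + 2 * i)) *
        ∏ i ∈ Finset.Ico j 8, (2 * (n - 4) - 2 - 2 * (i : ℝ) - n)) = 2 * n * (n + 2) * iNum n τ j := by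
  have hI : ∀ j, Finset.Ico j 8 = (Finset.range 8).filter (j ≤ ·) := fun j => by
    ext i; simp [and_comm]
  interval_cases j
  all_goals
    simp only [hI, Finset.prod_filter, Finset.prod_range_succ, Finset.prod_range_zero, leadNum,
      sqCoeff, gradCoeff, mixCoeff, lapSqCoeff, divCoeff, lapCoeffA, lapCoeffG, conv, lapWeight,
      quarticCoeff, Finset.sum_range_succ, Finset.sum_range_zero, Nat.reduceSub, Nat.reduceLeDiff,
      Nat.cast_ofNat, Nat.cast_zero, Nat.cast_one, iNum, if_true, if_false, zero_mul, mul_zero,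
      add_zero, zero_add, mul_one, one_mul]
    norm_num only [if_true, if_false]
    ring

end PaneitzBlowup
end

noncomputable section

namespace PaneitzBlowup

open MvPolynomial MeasureTheory Asymptotics Filter

variable {N : ℕ}

/-! ### Positivity of the Hessian coefficients -/

/-- The numerator of `pieceC`. -/
def pieceNumC (n j α β : ℝ) : ℝ := 2 * (α + (n + 4) * β) * (2 * j + n)

/-- The numerator of `pieceB`. -/
def pieceNumB (n j α β γ : ℝ) : ℝ :=
  (α + 2 * (n + 2) * β + 2 * n * (n + 2) * γ) * (n + 4) * j - pieceNumC n j α β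

/-- The numerator of `hessFactorB`. -/
def hessNumB (n τ : ℝ) (j : ℕ) : ℝ :=
  (n - 2) * (8 * (n - 1) - (n ^ 2 - 4 * n + 8) * (n + 2 * j))
      * ((gradCoeff τ j + 2 * (n + 2) * sqCoeff τ j) * ((j + 1) * (2 * j + n) * (n + 4))
        - 2 * (gradCoeff τ j + (n + 4) * sqCoeff τ j) * ((2 * j + n) * (2 * j + n + 2)))
  + 4 * (n - 1) * (n - 2) * pieceNumB n j (lapCoeffA n τ j + 2 * divCoeff n τ j)
      (lapCoeffG n τ j + 2 * mixCoeff n τ j) (2 * sqCoeff τ j)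
  + 2 * (n - 2) ^ 2 * (n - 3) * pieceNumB n j (lapCoeffA n τ j) (lapCoeffG n τ j)
      (2 * sqCoeff τ j)
  - 8 * (n - 1) * (n - 3) * pieceNumB n j (lapSqCoeff n τ j) 0 0

/-- The numerator of `hessFactorC`. -/
def hessNumC (n τ : ℝ) (j : ℕ) : ℝ :=
  (n - 2) * (8 * (n - 1) - (n ^ 2 - 4 * n + 8) * (n + 2 * j))
      * ((gradCoeff τ j + (n + 4) * sqCoeff τ j) * ((2 * j + n) * (2 * j + n + 2)))
  + 2 * (n - 1) * (n - 2) * pieceNumC n j (lapCoeffA n τ j + 2 * divCoeff n τ j)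
      (lapCoeffG n τ j + 2 * mixCoeff n τ j)
  + (n - 2) ^ 2 * (n - 3) * pieceNumC n j (lapCoeffA n τ j) (lapCoeffG n τ j)
  - 4 * (n - 1) * (n - 3) * pieceNumC n j (lapSqCoeff n τ j) 0
  + (n - 2) ^ 2 * (n + 4) * sqCoeff τ j * ((2 * j + 2 + n) * (2 * j + n)
      * (4 * (n - 1) + n * (n - 6 - 2 * j)))
  - 8 * (n - 1) * (n - 2) * (n + 4) * mixCoeff n τ j * (2 * j + n)

lemma hessFactorB_eq (hN : 25 ≤ N) (τ : ℝ) (j : ℕ) : hessFactorB N τ j =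
    (N - 4) ^ 2 / (32 * (N - 1) * (N - 2) ^ 2 * (N - 3) * N ^ 2 * (N + 2) * (N + 4))
      * hessNumB N τ j := by
  have hN' : (25 : ℝ) ≤ N := by exact_mod_cast hN
  have h1 : (N : ℝ) - 1 ≠ 0 := by linarith
  have h2 : (N : ℝ) - 2 ≠ 0 := by linarith
  have h3 : (N : ℝ) - 3 ≠ 0 := by linarith
  have h4 : (N : ℝ) - 4 ≠ 0 := by linarith
  have h5 : (N : ℝ) ≠ 0 := by linarith
  have h6 : (N : ℝ) + 2 ≠ 0 := by linarith
  have h7 : (N : ℝ) + 4 ≠ 0 := by linarith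
  rw [hessFactorB, hessNumB, aN, bN, mN]
  simp only [pieceB, pieceC, pieceNumB, pieceNumC]
  field_simp
  ring

lemma hessFactorC_eq (hN : 25 ≤ N) (τ : ℝ) (j : ℕ) : hessFactorC N τ j =
    (N - 4) ^ 2 / (16 * (N - 1) * (N - 2) ^ 2 * (N - 3) * N * (N + 2) * (N + 4))
      * hessNumC N τ j := by
  have hN' : (25 : ℝ) ≤ N := by exact_mod_cast hN
  have h1 : (N : ℝ) - 1 ≠ 0 := by linarith
  have h2 : (N : ℝ) - 2 ≠ 0 := by linarith
  have h3 : (N : ℝ) - 3 ≠ 0 := by linarith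
  have h4 : (N : ℝ) - 4 ≠ 0 := by linarith
  have h5 : (N : ℝ) ≠ 0 := by linarith
  have h6 : (N : ℝ) + 2 ≠ 0 := by linarith
  have h7 : (N : ℝ) + 4 ≠ 0 := by linarith
  rw [hessFactorC, hessNumC, aN, bN, mN]
  simp only [pieceC, pieceNumC]
  field_simp
  ring

/-- The moments of order `n - 3`, up to a common factor. -/
def hessMoment (n : ℝ) (j : ℕ) : ℝ :=
  (∏ i ∈ Finset.range j, (n + 2 * i)) * ∏ i ∈ Finset.Ico j 8, (2 * (n - 3) - 2 - 2 * (i : ℝ) - n)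


-- Shifting to x = N - 25 and t = τ - 16900 makes every coefficient positive. The sum is only affine
-- in t because τ² occurs solely at j = 0, where the numerator cancels.
set_option maxHeartbeats 4000000 in
lemma hessNumB_sum (x t : ℝ) :
    ∑ j ∈ Finset.range 9, hessNumB (x + 25) (16900 + t) j * hessMoment (x + 25) j =
      217577932 * x ^ 15 + 52745133552 * x ^ 14 + 5861624570636 * x ^ 13
         + 395966903387712 * x ^ 12 + 18174892435026492 * x ^ 11 + 600031932363927696 * x ^ 10
         + 14705140385149685820 * x ^ 9 + 272024509061542298528 * x ^ 8
         + 3822105096473621726436 * x ^ 7 + 40689842756135140554512 * x ^ 6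
         + 324611441888813913886244 * x ^ 5 + 1899735298721586090118400 * x ^ 4
         + 7865835672665034306613780 * x ^ 3 + 21652097713928626367694960 * x ^ 2
         + 35235574717871293102660500 * x + 25379614486333052738100000
      + t * (30316 * x ^ 15 + 7693420 * x ^ 14 + 894223036 * x ^ 13 + 63069188060 * x ^ 12
         + 3014500624060 * x ^ 11 + 103277153932284 * x ^ 10 + 2615899353053324 * x ^ 9
         + 49795652528627564 * x ^ 8 + 716906815986037508 * x ^ 7 + 7789929114600047236 * x ^ 6
         + 63215326924225327220 * x ^ 5 + 375207708958459898196 * x ^ 4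
         + 1571586627686047274196 * x ^ 3 + 4367994830949865039380 * x ^ 2
         + 7167160294039578226500 * x + 5200066189633677862500) := by
  have hI : ∀ j, Finset.Ico j 8 = (Finset.range 8).filter (j ≤ ·) := fun j => by
    ext i; simp [and_comm]
  simp only [hI, Finset.prod_filter, Finset.prod_range_succ, Finset.prod_range_zero, hessMoment,
    hessNumB, pieceNumC, pieceNumB,
    sqCoeff, gradCoeff, mixCoeff, lapSqCoeff, divCoeff, lapCoeffA, lapCoeffG, conv, lapWeight,
    quarticCoeff, Finset.sum_range_succ, Finset.sum_range_zero, Nat.reduceSub, Nat.reduceLeDiff,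
    Nat.cast_ofNat, Nat.cast_zero, Nat.cast_one, if_true, if_false, zero_mul, mul_zero,
    add_zero, zero_add, mul_one, one_mul]
  norm_num only [if_true, if_false]
  ring

-- Again τ² cancels at j = 0, here between the a_N gradient term and the leading quadratic form in
-- ξ, and positivity for x, t ≥ 0 is visible.
set_option maxHeartbeats 4000000 in
lemma hessNumC_sum (x t : ℝ) :
    ∑ j ∈ Finset.range 9, hessNumC (x + 25) (16900 + t) j * hessMoment (x + 25) j =
      205390900 * x ^ 14 + 41178995400 * x ^ 13 + 3728908017532 * x ^ 12
         + 202411179139280 * x ^ 11 + 7373799879779156 * x ^ 10 + 191163165270023864 * x ^ 9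
         + 3642136573822267516 * x ^ 8 + 51765328864319758688 * x ^ 7
         + 549653209681715425276 * x ^ 6 + 4318874859918592977336 * x ^ 5
         + 24625136355069359463252 * x ^ 4 + 98430634868990789617872 * x ^ 3
         + 258892544364732656528508 * x ^ 2 + 398233565810829369790920 * x
         + 268220692260678353080500
      + t * (60632 * x ^ 14 + 13871040 * x ^ 13 + 1441670072 * x ^ 12 + 90096624320 * x ^ 11
         + 3776585640120 * x ^ 10 + 112139666861568 * x ^ 9 + 2428307034567448 * x ^ 8
         + 38883629193068928 * x ^ 7 + 461722902145351816 * x ^ 6 + 4036785675566299072 * x ^ 5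
         + 25511011959293177640 * x ^ 4 + 112640118934590355392 * x ^ 3
         + 327170282007335663592 * x ^ 2 + 556732611716338488960 * x + 416005295170694229000) := by
  have hI : ∀ j, Finset.Ico j 8 = (Finset.range 8).filter (j ≤ ·) := fun j => by
    ext i; simp [and_comm]
  simp only [hI, Finset.prod_filter, Finset.prod_range_succ, Finset.prod_range_zero, hessMoment,
    hessNumC, pieceNumC,
    sqCoeff, gradCoeff, mixCoeff, lapSqCoeff, divCoeff, lapCoeffA, lapCoeffG, conv, lapWeight,
    quarticCoeff, Finset.sum_range_succ, Finset.sum_range_zero, Nat.reduceSub, Nat.reduceLeDiff,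
    Nat.cast_ofNat, Nat.cast_zero, Nat.cast_one, if_true, if_false, zero_mul, mul_zero,
    add_zero, zero_add, mul_one, one_mul]
  norm_num only [if_true, if_false]
  ring

lemma sum_hessFactorB_pos (hN : 25 ≤ N) {τ : ℝ} (hτ : 16900 ≤ τ) :
    0 < ∑ j ∈ Finset.range 9, hessFactorB N τ j * radialMoment N j (N - 3) := by
  have hN' : (25 : ℝ) ≤ N := by exact_mod_cast hN
  obtain ⟨κ, hκ, hm⟩ := exists_radialMoment_eq (N := N) (by omega) (s := (N : ℝ) - 3) (by linarith)
  have h1 : 0 < (N : ℝ) - 1 := by linarith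
  have h2 : 0 < (N : ℝ) - 2 := by linarith
  have h3 : 0 < (N : ℝ) - 3 := by linarith
  have h4 : 0 < (N : ℝ) - 4 := by linarith
  have e : ∑ j ∈ Finset.range 9, hessFactorB N τ j * radialMoment N j (N - 3) =
      (N - 4) ^ 2 / (32 * (N - 1) * (N - 2) ^ 2 * (N - 3) * N ^ 2 * (N + 2) * (N + 4)) * κ *
        ∑ j ∈ Finset.range 9, hessNumB N τ j * hessMoment N j := by
    rw [Finset.mul_sum]
    refine Finset.sum_congr rfl fun j hj => ?_
    rw [hm j (Nat.lt_succ_iff.1 (Finset.mem_range.1 hj)), hessFactorB_eq hN, hessMoment]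
    ring
  have hs := hessNumB_sum (N - 25) (τ - 16900)
  rw [sub_add_cancel, add_sub_cancel] at hs
  rw [e, hs]
  have hx : 0 ≤ (N : ℝ) - 25 := by linarith
  have ht : 0 ≤ τ - 16900 := by linarith
  generalize (N : ℝ) - 25 = x at *
  generalize τ - 16900 = t at *
  positivity

lemma sum_hessFactorC_pos (hN : 25 ≤ N) {τ : ℝ} (hτ : 16900 ≤ τ) :
    0 < ∑ j ∈ Finset.range 9, hessFactorC N τ j * radialMoment N j (N - 3) := by
  have hN' : (25 : ℝ) ≤ N := by exact_mod_cast hN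
  obtain ⟨κ, hκ, hm⟩ := exists_radialMoment_eq (N := N) (by omega) (s := (N : ℝ) - 3) (by linarith)
  have h1 : 0 < (N : ℝ) - 1 := by linarith
  have h2 : 0 < (N : ℝ) - 2 := by linarith
  have h3 : 0 < (N : ℝ) - 3 := by linarith
  have h4 : 0 < (N : ℝ) - 4 := by linarith
  have e : ∑ j ∈ Finset.range 9, hessFactorC N τ j * radialMoment N j (N - 3) =
      (N - 4) ^ 2 / (16 * (N - 1) * (N - 2) ^ 2 * (N - 3) * N * (N + 2) * (N + 4)) * κ *
        ∑ j ∈ Finset.range 9, hessNumC N τ j * hessMoment N j := by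
    rw [Finset.mul_sum]
    refine Finset.sum_congr rfl fun j hj => ?_
    rw [hm j (Nat.lt_succ_iff.1 (Finset.mem_range.1 hj)), hessFactorC_eq hN, hessMoment]
    ring
  have hs := hessNumC_sum (N - 25) (τ - 16900)
  rw [sub_add_cancel, add_sub_cancel] at hs
  rw [e, hs]
  have hx : 0 ≤ (N : ℝ) - 25 := by linarith
  have ht : 0 ≤ τ - 16900 := by linarith
  generalize (N : ℝ) - 25 = x at *
  generalize τ - 16900 = t at *
  positivity

end PaneitzBlowup
end

noncomputable section

namespace PaneitzBlowup

open MvPolynomial MeasureTheory Asymptotics Filter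

variable {N : ℕ}

/-! ### The choice of `τ` -/

/-- `I'(1)`, up to a positive factor. -/
def iFirst (n τ : ℝ) : ℝ := ∑ j ∈ Finset.range 9, (2 * (j : ℝ) + 4) * iNum n τ j

/-- `I''(1) - 3 I'(1)`, up to a positive factor. -/
def iSecond (n τ : ℝ) : ℝ :=
  ∑ j ∈ Finset.range 9, (2 * (j : ℝ) + 4) * (2 * (j : ℝ)) * iNum n τ j

lemma hasDerivAt_Ipoly (hN : 25 ≤ N) (τ l : ℝ) : HasDerivAt (Ipoly N τ)
    ((N - 4) / iDenom N *
      ∑ j ∈ Finset.range 9, (2 * (j : ℝ) + 4) * iNum N τ j * l ^ (2 * j + 3)) l := by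
  rw [show Ipoly N τ = fun l => (N - 4) / iDenom N *
    ∑ j ∈ Finset.range 9, iNum N τ j * l ^ (2 * j + 4) from funext fun l => Ipoly_eq hN τ l]
  refine HasDerivAt.const_mul _ (HasDerivAt.fun_sum fun j _ => ?_)
  refine ((hasDerivAt_pow (2 * j + 4) l).const_mul (iNum N τ j)).congr_deriv ?_
  push_cast
  ring

lemma deriv_Ipoly_one (hN : 25 ≤ N) (τ : ℝ) :
    deriv (Ipoly N τ) 1 = (N - 4) / iDenom N * iFirst N τ := by
  rw [(hasDerivAt_Ipoly hN τ 1).deriv, iFirst]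
  simp

lemma deriv_deriv_Ipoly_one (hN : 25 ≤ N) (τ : ℝ) :
    deriv (deriv (Ipoly N τ)) 1 = (N - 4) / iDenom N * (iSecond N τ + 3 * iFirst N τ) := by
  rw [show deriv (Ipoly N τ) = fun l => (N - 4) / iDenom N *
    ∑ j ∈ Finset.range 9, (2 * (j : ℝ) + 4) * iNum N τ j * l ^ (2 * j + 3) from
      funext fun l => (hasDerivAt_Ipoly hN τ l).deriv]
  refine HasDerivAt.deriv (HasDerivAt.const_mul _ ?_)
  rw [iFirst, iSecond, Finset.mul_sum, ← Finset.sum_add_distrib]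
  refine HasDerivAt.fun_sum fun j _ => ?_
  refine ((hasDerivAt_pow (2 * j + 3) (1 : ℝ)).const_mul
    ((2 * (j : ℝ) + 4) * iNum N τ j)).congr_deriv ?_
  push_cast
  rw [one_pow]
  ring

/-- Since (2j + 4)(2j + 3) = (2j + 4)·2j + 3(2j + 4), the second derivative differs from `iSecond`
by a multiple of the first, which is zero here. -/
lemma isChosenTau_iff (hN : 25 ≤ N) (τ : ℝ) :
    IsChosenTau N τ ↔ iFirst N τ = 0 ∧ 0 < iSecond N τ := by
  have hN' : (25 : ℝ) ≤ N := by exact_mod_cast hN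
  have hc : 0 < ((N : ℝ) - 4) / iDenom N := div_pos (by linarith) (iDenom_pos hN)
  rw [IsChosenTau, deriv_Ipoly_one hN, deriv_deriv_Ipoly_one hN, mul_eq_zero,
    or_iff_right hc.ne', mul_pos_iff_of_pos_left hc]
  refine and_congr_right fun h => ?_
  rw [h, mul_zero, add_zero]

/-- The slope of `iSecond` in `τ`. -/
def tauSlope (x : ℝ) : ℝ :=
  149704 * x ^ 12 + 23253088 * x ^ 11 + 1576130128 * x ^ 10 + 61417605344 * x ^ 9
     + 1527265727608 * x ^ 8 + 25459627338432 * x ^ 7 + 290995127751008 * x ^ 6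
     + 2290688592307904 * x ^ 5 + 12264804433423928 * x ^ 4 + 43177912422726880 * x ^ 3
     + 93389054838192464 * x ^ 2 + 108206604127328352 * x + 47754342969185160

/-- The value of `iSecond` at `τ = 16900`. -/
def tauValue (x : ℝ) : ℝ :=
  614895680 * x ^ 12 + 77533788928 * x ^ 11 + 4233431722880 * x ^ 10
     + 135340924553472 * x ^ 9 + 2905066685796544 * x ^ 8 + 44410389927249408 * x ^ 7
     + 477378423658036480 * x ^ 6 + 3483446218002622976 * x ^ 5
     + 17605921645812907456 * x ^ 4 + 59481612666885345024 * x ^ 3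
     + 103593398165716062080 * x ^ 2 + 96443605066547772672 * x + 15957862544552765760

lemma tauSlope_pos {x : ℝ} (hx : 0 ≤ x) : 0 < tauSlope x := by
  unfold tauSlope
  positivity

lemma tauValue_pos {x : ℝ} (hx : 0 ≤ x) : 0 < tauValue x := by
  unfold tauValue
  positivity

/-- The weight 2j kills j = 0, the only coefficient of I that is quadratic in τ, so this quantity is
affine in τ. -/
lemma iSecond_eq (x τ : ℝ) : iSecond (x + 25) τ = tauValue x + (τ - 16900) * tauSlope x := by
  unfold iSecond tauValue tauSlope
  simp only [iNum, Finset.sum_range_succ, Finset.sum_range_zero, Nat.cast_zero, Nat.cast_one,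
    Nat.cast_ofNat, zero_add, mul_zero, mul_one]
  ring

/-- The coefficients of `iFirst` as a polynomial in `τ`. -/
def tauQuadA (x : ℝ) : ℝ :=
  4 * x ^ 12 + 624 * x ^ 11 + 43048 * x ^ 10 + 1730800 * x ^ 9 + 44997084 * x ^ 8
     + 793298400 * x ^ 7 + 9671891120 * x ^ 6 + 81597978720 * x ^ 5 + 468458885372 * x ^ 4
     + 1761942293936 * x ^ 3 + 4041162695592 * x ^ 2 + 4909668542640 * x + 2234665332900

/-- The coefficients of `iFirst` as a polynomial in `τ`. -/
def tauQuadB (x : ℝ) : ℝ :=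
  108100 * x ^ 12 + 17639344 * x ^ 11 + 1264840552 * x ^ 10 + 52520080496 * x ^ 9
     + 1401333045724 * x ^ 8 + 25209418165344 * x ^ 7 + 312053794386992 * x ^ 6
     + 2662029242213216 * x ^ 5 + 15404348182347836 * x ^ 4 + 58260326572694512 * x ^ 3
     + 134134773766580456 * x ^ 2 + 163372257494538288 * x + 74467296924021540

/-- The coefficients of `iFirst` as a polynomial in `τ`. -/
def tauQuadC (x : ℝ) : ℝ :=
  672909384 * x ^ 12 + 117054849280 * x ^ 11 + 8867795377776 * x ^ 10
     + 385221896940352 * x ^ 9 + 10645778078759896 * x ^ 8 + 196552610002528512 * x ^ 7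
     + 2479412490038508192 * x ^ 6 + 21451250663285954432 * x ^ 5
     + 125410340924350356600 * x ^ 4 + 477718498942014399488 * x ^ 3
     + 1106889519527494491632 * x ^ 2 + 1354177704900954943296 * x + 620117948596738533480

lemma tauQuadA_nonneg {x : ℝ} (hx : 0 ≤ x) : 0 ≤ tauQuadA x := by
  unfold tauQuadA
  positivity

/-- The only τ² comes from j = 0, with negative sign for x ≥ 0, so I'(1) is concave in τ. -/
lemma iFirst_eq (x τ : ℝ) :
    iFirst (x + 25) τ = -tauQuadA x * τ ^ 2 + tauQuadB x * τ - tauQuadC x := by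
  unfold iFirst tauQuadA tauQuadB tauQuadC
  simp only [iNum, Finset.sum_range_succ, Finset.sum_range_zero, Nat.cast_zero, Nat.cast_one,
    Nat.cast_ofNat, zero_add, mul_zero, mul_one]
  ring

lemma iFirst_pos_of_eq {x : ℝ} (hx : 0 ≤ x) : 0 < iFirst (x + 25) 16900 := by
  have h : iFirst (x + 25) 16900 =
      11540616 * x ^ 12 + 2829424320 * x ^ 11 + 213070671024 * x ^ 10 + 8033675442048 * x ^ 9
         + 185133232735704 * x ^ 8 + 2912600967785088 * x ^ 7 + 31907812318456608 * x ^ 6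
         + 231844827898195968 * x ^ 5 + 1126601106231151800 * x ^ 4
         + 3652681565461893312 * x ^ 3 + 5791679639684094768 * x ^ 2 + 4563014293331723904 * x
         + 136603689656492520 := by
    rw [iFirst_eq, tauQuadA, tauQuadB, tauQuadC]
    ring
  rw [h]
  positivity

lemma iFirst_neg {x : ℝ} (hx : 0 ≤ x) : iFirst (x + 25) 18200 < 0 := by
  have h : iFirst (x + 25) 18200 =
      -(30449384 * x ^ 12 + 2712548480 * x ^ 11 + 106916851376 * x ^ 10 + 2666623913152 * x ^ 9
         + 46350750743096 * x ^ 8 + 513361409267712 * x ^ 7 + 3750646784053792 * x ^ 6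
         + 30832926218223232 * x ^ 5 + 223525196241021400 * x ^ 4 + 1006320762334921088 * x ^ 3
         + 4231368263624272432 * x ^ 2 + 7081226564431701696 * x + 5023689449342505480) := by
    rw [iFirst_eq, tauQuadA, tauQuadB, tauQuadC]
    ring
  rw [h, neg_lt_zero]
  positivity

/-- A lower bound for the zero of `iSecond` in `τ`. -/
def tauLower (x : ℝ) : ℝ := (12600 * x + 130720) / (x + 8)

/-- Multiplication by (x + 8)² clears the denominator of `tauLower` and leaves positive
coefficients. -/
lemma iFirst_tauLower_pos {x : ℝ} (hx : 0 ≤ x) : 0 < iFirst (x + 25) (tauLower x) := by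
  have hx8 : x + 8 ≠ 0 := by positivity
  have h : (x + 8) ^ 2 * iFirst (x + 25) (tauLower x) =
      54110616 * x ^ 14 + 7218830976 * x ^ 13 + 391962157648 * x ^ 12 + 11186430697792 * x ^ 11
         + 181264141509448 * x ^ 10 + 1713083075166464 * x ^ 9 + 10590202699328992 * x ^ 8
         + 79289655330100608 * x ^ 7 + 989845865242096040 * x ^ 6 + 9954242691400041344 * x ^ 5
         + 60572650300760484560 * x ^ 4 + 202093853534978824000 * x ^ 3
         + 324942742907166964856 * x ^ 2 + 243237397777643917056 * x + 2039794236044167680 := by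
    have e : (x + 8) * tauLower x = 12600 * x + 130720 := mul_div_cancel₀ _ hx8
    rw [iFirst_eq]
    calc _ = -tauQuadA x * ((x + 8) * tauLower x) ^ 2
            + tauQuadB x * (x + 8) * ((x + 8) * tauLower x) - tauQuadC x * (x + 8) ^ 2 := by ring
      _ = _ := by
        rw [e, tauQuadA, tauQuadB, tauQuadC]
        ring
  have h' : 0 < (x + 8) ^ 2 * iFirst (x + 25) (tauLower x) := by
    rw [h]
    positivity
  exact pos_of_mul_pos_right h' (by positivity)

lemma iSecond_tauLower_neg_zero : iSecond 25 (tauLower 0) < 0 := by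
  have := iSecond_eq 0 (tauLower 0)
  rw [zero_add] at this
  rw [this, tauValue, tauSlope, tauLower]
  norm_num

/-- Multiplication by x + 8 clears the denominator. Expanded in x = N - 25 the linear coefficient
has the wrong sign; expanded in y = x - 1 all signs agree, which leaves N = 25 to be checked
numerically. -/
lemma iSecond_tauLower_neg {y : ℝ} (hy : 0 ≤ y) : iSecond (y + 1 + 25) (tauLower (y + 1)) < 0 := by
  have hy8 : y + 1 + 8 ≠ 0 := by positivity
  have h : (y + 1 + 8) * iSecond (y + 1 + 25) (tauLower (y + 1)) =
      -(28831520 * y ^ 13 + 18580807712 * y ^ 12 + 2248552184320 * y ^ 11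
         + 125464374149376 * y ^ 10 + 3989639952947200 * y ^ 9 + 79290338057884160 * y ^ 8
         + 1037700672088371200 * y ^ 7 + 9204724700373344256 * y ^ 6
         + 54932243823052873728 * y ^ 5 + 208118989875617005568 * y ^ 4
         + 450611993682071715840 * y ^ 3 + 492563870783769673728 * y ^ 2
         + 142273148664290476032 * y + 25168633694791925760) := by
    have e : (y + 1 + 8) * tauLower (y + 1) = 12600 * (y + 1) + 130720 := mul_div_cancel₀ _ hy8
    rw [iSecond_eq]
    calc _ = (y + 1 + 8) * tauValue (y + 1)
            + ((y + 1 + 8) * tauLower (y + 1) - 16900 * (y + 1 + 8)) * tauSlope (y + 1) := by ring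
      _ = _ := by
        rw [e, tauValue, tauSlope]
        ring
  have h' : (y + 1 + 8) * iSecond (y + 1 + 25) (tauLower (y + 1)) < 0 := by
    rw [h, neg_lt_zero]
    positivity
  exact (mul_neg_iff.1 h').resolve_right (fun hc => by linarith [hc.1]) |>.2

/-- The affine increasing `iSecond` is negative at `tauLower`, so an admissible τ lies above it. The
concave `iFirst` is positive at `tauLower` and at 16900, so it has no zero between them. -/
lemma le_of_isChosenTau (hN : 25 ≤ N) {τ : ℝ} (hτ : IsChosenTau N τ) : 16900 ≤ τ := by
  obtain ⟨h1, h2⟩ := (isChosenTau_iff hN τ).1 hτ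
  have hN' : (25 : ℝ) ≤ N := by exact_mod_cast hN
  obtain ⟨x, hx⟩ : ∃ x : ℝ, (N : ℝ) = x + 25 := ⟨N - 25, by ring⟩
  have hx0 : 0 ≤ x := by linarith
  have hneg : iSecond (x + 25) (tauLower x) < 0 := by
    rcases hN.eq_or_lt with h | h
    · have : x = 0 := by rw [← h] at hx; push_cast at hx; linarith
      rw [this, zero_add]
      exact iSecond_tauLower_neg_zero
    · have h26 : (26 : ℝ) ≤ N := by exact_mod_cast h
      have := iSecond_tauLower_neg (y := x - 1) (by linarith)
      rwa [sub_add_cancel] at this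
  rw [hx] at h1 h2
  rw [iSecond_eq] at h2 hneg
  have hs := tauSlope_pos hx0
  have hlow : tauLower x < τ := by
    by_contra hc
    have := mul_le_mul_of_nonneg_right (sub_le_sub_right (not_lt.1 hc) 16900) hs.le
    linarith
  by_contra! hc
  have hq0 := iFirst_tauLower_pos hx0
  have hq1 := iFirst_pos_of_eq hx0
  rw [iFirst_eq] at h1 hq0 hq1
  have hA := tauQuadA_nonneg hx0
  generalize tauLower x = a at *
  -- The quadratic is its linear interpolation between a and 16900 plus a term that is nonnegative
  -- by concavity. At a zero the left side vanishes while the right side is positive.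
  have e : (16900 - a) * (-tauQuadA x * τ ^ 2 + tauQuadB x * τ - tauQuadC x) =
      (16900 - τ) * (-tauQuadA x * a ^ 2 + tauQuadB x * a - tauQuadC x)
      + (τ - a) * (-tauQuadA x * 16900 ^ 2 + tauQuadB x * 16900 - tauQuadC x)
      + tauQuadA x * (16900 - a) * (τ - a) * (16900 - τ) := by ring
  rw [h1, mul_zero] at e
  have p1 : 0 < 16900 - τ := by linarith
  have p2 : 0 < τ - a := by linarith
  have p3 : 0 < 16900 - a := by linarith
  have := mul_pos p1 hq0
  have := mul_pos p2 hq1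
  have : 0 ≤ tauQuadA x * (16900 - a) * (τ - a) * (16900 - τ) := by positivity
  linarith

/-- The sign of `iFirst` changes between 16900 and 18200, and at every τ ≥ 16900 the affine
`iSecond` is positive. -/
lemma exists_isChosenTau (hN : 25 ≤ N) : ∃ τ, IsChosenTau N τ := by
  have hN' : (25 : ℝ) ≤ N := by exact_mod_cast hN
  obtain ⟨x, hx⟩ : ∃ x : ℝ, (N : ℝ) = x + 25 := ⟨N - 25, by ring⟩
  have hx0 : 0 ≤ x := by linarith
  have hcont : Continuous fun τ => iFirst (x + 25) τ := by
    simp only [iFirst_eq]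
    fun_prop
  obtain ⟨τ, ⟨hτ, -⟩, h0⟩ := intermediate_value_Icc' (by norm_num : (16900 : ℝ) ≤ 18200)
    hcont.continuousOn ⟨(iFirst_neg hx0).le, (iFirst_pos_of_eq hx0).le⟩
  refine ⟨τ, (isChosenTau_iff hN τ).2 ?_⟩
  rw [hx]
  refine ⟨h0, ?_⟩
  rw [iSecond_eq]
  have := tauValue_pos hx0
  have := mul_nonneg (sub_nonneg.2 hτ) (tauSlope_pos hx0).le
  linarith

/-- `I` has a strict local minimum at `1`. -/
lemma Ipoly_one_lt (hN : 25 ≤ N) {τ : ℝ} (hτ : IsChosenTau N τ) :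
    ∀ᶠ l in 𝓝[≠] (1 : ℝ), Ipoly N τ 1 < Ipoly N τ l := by
  obtain ⟨h1, h2⟩ := hτ
  -- Subtracting c(l - 1)² uses up half of I''(1). The difference still has a local minimum at 1,
  -- and the subtracted square gives strictness.
  set c := deriv (deriv (Ipoly N τ)) 1 / 4 with hc
  have hd : Differentiable ℝ (Ipoly N τ) := fun l => (hasDerivAt_Ipoly hN τ l).differentiableAt
  have hd' : Differentiable ℝ (deriv (Ipoly N τ)) := by
    rw [show deriv (Ipoly N τ) = fun l => (N - 4) / iDenom N *
      ∑ j ∈ Finset.range 9, (2 * (j : ℝ) + 4) * iNum N τ j * l ^ (2 * j + 3) from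
        funext fun l => (hasDerivAt_Ipoly hN τ l).deriv]
    fun_prop
  have hg : deriv (fun l => Ipoly N τ l - c * (l - 1) ^ 2) =
      fun l => deriv (Ipoly N τ) l - c * (2 * (l - 1)) := by
    funext l
    refine (HasDerivAt.fun_sub (hd l).hasDerivAt ?_).deriv
    refine ((((hasDerivAt_id l).sub_const 1).pow 2).const_mul c).congr_deriv ?_
    simp
  have hg' : deriv (deriv fun l => Ipoly N τ l - c * (l - 1) ^ 2) 1 = 2 * c := by
    rw [hg]
    refine HasDerivAt.deriv ?_
    refine (HasDerivAt.fun_sub (hd' 1).hasDerivAt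
      ((((hasDerivAt_id (1 : ℝ)).sub_const 1).const_mul 2).const_mul c)).congr_deriv ?_
    rw [hc]
    ring
  have hmin : IsLocalMin (fun l => Ipoly N τ l - c * (l - 1) ^ 2) 1 := by
    refine isLocalMin_of_deriv_deriv_pos ?_ ?_ ?_
    · rw [hg', hc]
      linarith
    · rw [hg]
      simp [h1]
    · exact (hd.continuous.sub (by fun_prop)).continuousAt
  filter_upwards [hmin.filter_mono nhdsWithin_le_nhds, self_mem_nhdsWithin] with l hl hne
  have : 0 < c * (l - 1) ^ 2 :=
    mul_pos (by rw [hc]; linarith) (sq_pos_of_ne_zero (sub_ne_zero.2 hne))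
  simp only [sub_self] at hl
  linarith

/-- This is where I comes from: along ξ = 0 the explicit part of F is a positive multiple of it. -/
lemma sum_leadFactor (hN : 25 ≤ N) (τ : ℝ) : ∃ K : ℝ, 0 < K ∧ ∀ l : ℝ,
    ∑ j ∈ Finset.range 9, leadFactor N τ j * radialMoment N j (N - 4) * l ^ (2 * j + 4) =
      K * Ipoly N τ l := by
  have hN' : (25 : ℝ) ≤ N := by exact_mod_cast hN
  obtain ⟨κ, hκ, hm⟩ := exists_radialMoment_eq (N := N) (by omega) (s := (N : ℝ) - 4) (by linarith)
  have h1 : 0 < (N : ℝ) - 1 := by linarith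
  have h2 : 0 < (N : ℝ) - 2 := by linarith
  have h3 : 0 < (N : ℝ) - 3 := by linarith
  have h4 : 0 < (N : ℝ) - 4 := by linarith
  have hI := iDenom_pos hN
  refine ⟨κ * iDenom N / (32 * (N - 1) * (N - 2) ^ 2 * (N - 3)), by positivity, fun l => ?_⟩
  rw [Ipoly_eq hN, Finset.mul_sum, Finset.mul_sum]
  refine Finset.sum_congr rfl fun j hj => ?_
  have hj' := Finset.mem_range.1 hj
  have key := leadNum_mul (N : ℝ) τ hj'
  rw [hm j (Nat.lt_succ_iff.1 hj'), leadFactor_eq hN]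
  generalize (∏ i ∈ Finset.range j, ((N : ℝ) + 2 * i)) *
    ∏ i ∈ Finset.Ico j 8, (2 * ((N : ℝ) - 4) - 2 - 2 * (i : ℝ) - N) = P at *
  calc _ = κ * (N - 4) * (leadNum N τ j * P) * l ^ (2 * j + 4)
        / (64 * N * (N + 2) * (N - 1) * (N - 2) ^ 2 * (N - 3)) := by ring
    _ = _ := by
      rw [key]
      field_simp
      ring

end PaneitzBlowup
end

noncomputable section

namespace PaneitzBlowup

open MvPolynomial MeasureTheory Asymptotics Filter

variable {N : ℕ} {W : Fin N → Fin N → Fin N → Fin N → ℝ}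

/-! ### The minimum -/

/-- If the second derivatives of H vanish, then W_iajb + W_ibja = 0. With the antisymmetries, the
three terms of the Bianchi identity become equal, so 3W = 0. -/
lemma hessSum_Hfam_pos (hW : IsWeylTensor W) (hne : ∃ i k j l, W i k j l ≠ 0) :
    0 < hessSum (Hfam W) := by
  have hterm : ∀ e : Fin N × Fin N, ∀ a b,
      polyFun (pderiv b (pderiv a (Hfam W e))) 0 = W e.1 a e.2 b + W e.1 b e.2 a := fun e a b => by
    rw [Hfam, pderiv_pderiv_Hpoly, polyFun_C]
  have hnn : 0 ≤ hessSum (Hfam W) :=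
    Finset.sum_nonneg fun _ _ => Finset.sum_nonneg fun _ _ => Finset.sum_nonneg fun _ _ =>
      sq_nonneg _
  refine hnn.lt_of_ne fun h0 => ?_
  have hz : ∀ i a j b, W i a j b + W i b j a = 0 := fun i a j b => by
    have h1 := (Finset.sum_eq_zero_iff_of_nonneg fun _ _ => Finset.sum_nonneg fun _ _ =>
      Finset.sum_nonneg fun _ _ => sq_nonneg _).1 h0.symm (i, j) (Finset.mem_univ _)
    have h2 := (Finset.sum_eq_zero_iff_of_nonneg fun _ _ =>
      Finset.sum_nonneg fun _ _ => sq_nonneg _).1 h1 a (Finset.mem_univ _)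
    have h3 := (Finset.sum_eq_zero_iff_of_nonneg fun _ _ => sq_nonneg _).1 h2 b (Finset.mem_univ _)
    rw [hterm] at h3
    exact pow_eq_zero_iff two_ne_zero |>.1 h3
  obtain ⟨i, k, j, l, hne⟩ := hne
  refine hne ?_
  have h1 := hW.bianchi i k j l
  have h2 := hW.antisymm_right i k j l
  have h3 := hW.antisymm_right i l k j
  have h4 := hz i k j l
  have h5 := hz i j l k
  linarith

lemma polyFun_gradSum_nonneg {ι : Type*} [Fintype ι] (q : ι → Poly N) (y : E N) :
    0 ≤ polyFun (gradSum q) y := by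
  simp only [gradSum, polyFun_sum, polyFun_mul]
  exact Finset.sum_nonneg fun _ _ => Finset.sum_nonneg fun _ _ => mul_self_nonneg _

/-- At ξ = 0 the Hessian of the bubble is a combination of δ_ij and y_i y_j. The first meets the
trace of H̄, the second the contraction with y. -/
lemma sum_Hbar_mul_pd_pd_bubble_zero (hW : IsWeylTensor W) (τ : ℝ) {lam : ℝ} (hl : 0 < lam)
    (y : E N) : ∑ i, ∑ j, Hbar τ W i j y * pd i (pd j (bubble 0 lam)) y = 0 := by
  have h1 : ∑ i, ∑ j, polyFun (HbarPoly (quarticPoly τ) W i j) y * (if i = j then 1 else 0) = 0 := by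
    simp only [mul_ite, mul_one, mul_zero, Finset.sum_ite_eq, Finset.mem_univ, if_true]
    rw [← polyFun_sum, sum_HbarPoly_diag _ hW, polyFun_zero]
  have h2 := sum_HbarPoly_mul_sub_mul_sub (quarticPoly τ) hW 0 y
  have h3 : Hform W 0 y = 0 := by simp [Hform]
  rw [h3, mul_zero] at h2
  calc _ = bubbleConst N lam * -(2 * mN N) * wt lam (mN N + 1) (y - 0) *
          (∑ i, ∑ j, polyFun (HbarPoly (quarticPoly τ) W i j) y * (if i = j then 1 else 0))
        + bubbleConst N lam * (4 * mN N * (mN N + 1)) * wt lam (mN N + 2) (y - 0) *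
          ∑ i, ∑ j, polyFun (HbarPoly (quarticPoly τ) W i j) y *
            ((y i - (0 : E N) i) * (y j - (0 : E N) j)) := by
        simp only [Finset.mul_sum, ← Finset.sum_add_distrib]
        refine Finset.sum_congr rfl fun i _ => Finset.sum_congr rfl fun j _ => ?_
        rw [Hbar_eq, pd_pd_bubble 0 hl]
        ring
    _ = 0 := by rw [h1, h2, mul_zero, mul_zero, add_zero]

lemma gammaN_pos (hN : 3 ≤ N) : 0 < gammaN N := by
  have hN' : (3 : ℝ) ≤ N := by exact_mod_cast hN
  have : 0 < (N : ℝ) - 2 := by linarith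
  exact Real.rpow_pos_of_pos (by positivity) _

lemma configSet_mem_nhds : configSet N ∈ 𝓝 ((0 : E N), (1 : ℝ)) := by
  have h : {p : E N × ℝ | ‖p.1‖ < 1 ∧ 1 / 2 < p.2 ∧ p.2 < 3 / 2} ∈ 𝓝 ((0 : E N), (1 : ℝ)) := by
    refine IsOpen.mem_nhds ?_ (by norm_num)
    exact (isOpen_lt continuous_fst.norm continuous_const).inter
      ((isOpen_lt continuous_const continuous_snd).inter (isOpen_lt continuous_snd continuous_const))
  exact mem_of_superset h fun p hp => ⟨hp.1.le, hp.2⟩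

/-- A function with a quadratic lower expansion has a strict local minimum. -/
lemma HasExpansion.eventually_lt {G : E N → ℝ} {T : E N × ℝ → ℝ} {a : ℝ → ℝ} {b c K : ℝ}
    (h : HasExpansion G T a b c) (hb : 0 < b) (hc : 0 ≤ c) (hG : ∀ ξ, 0 ≤ G ξ) (hG0 : G 0 = 0)
    (ha : ∀ᶠ l in 𝓝[≠] (1 : ℝ), a 1 < a l) :
    ∀ᶠ p in 𝓝[≠] ((0 : E N), (1 : ℝ)), T (0, 1) < T p - K * ‖p.1‖ ^ 4 := by
  have hlim : Tendsto (fun p : E N × ℝ => K * ‖p.1‖ ^ 2) (𝓝 (0, 1)) (𝓝 0) := by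
    have : Continuous fun p : E N × ℝ => K * ‖p.1‖ ^ 2 := by fun_prop
    simpa using this.tendsto (0, 1)
  have ha' : ∀ᶠ p in 𝓝 ((0 : E N), (1 : ℝ)), p.2 ≠ 1 → a 1 < a p.2 :=
    (continuous_snd.tendsto ((0 : E N), (1 : ℝ))).eventually (eventually_nhdsWithin_iff.1 ha)
  refine eventually_nhdsWithin_iff.2 ?_
  -- Half of b|ξ|² absorbs the error of the expansion, and the other half absorbs K|ξ|⁴ once K|ξ|² <
  -- b/2.
  filter_upwards [h.bound (half_pos hb), hlim.eventually (gt_mem_nhds (half_pos hb)), ha']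
    with p h1 h2 h3 hp
  rw [h.apply_zero_one hG0]
  rw [Real.norm_of_nonneg (sq_nonneg ‖p.1‖), Real.norm_eq_abs] at h1
  have h1' := (abs_le.1 h1).1
  have hcG := mul_nonneg hc (hG p.1)
  have hK : K * ‖p.1‖ ^ 4 = K * ‖p.1‖ ^ 2 * ‖p.1‖ ^ 2 := by ring
  -- On ξ = 0 there is no error at all and a alone gives strictness; off it, a(λ) ≥ a(1) suffices
  -- and |ξ|² gives strictness.
  rcases eq_or_ne p.1 0 with h0 | h0
  · have hne : p.2 ≠ 1 := fun hc => hp (Prod.ext h0 hc)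
    have := h3 hne
    rw [hK]
    simp only [h0, norm_zero] at h1' hcG ⊢
    linarith
  · have hpos : 0 < ‖p.1‖ ^ 2 := pow_pos (norm_pos_iff.2 h0) 2
    have hle : a 1 ≤ a p.2 := by
      rcases eq_or_ne p.2 1 with h | h
      · rw [h]
      · exact (h3 h).le
    have := mul_lt_mul_of_pos_right h2 hpos
    rw [hK]
    linarith

lemma auxF_strict_local_min (hN : 25 ≤ N) {τ : ℝ} (hτ : IsChosenTau N τ) (hW : IsWeylTensor W)
    (hne : ∃ i k j l, W i k j l ≠ 0) {h : E N → Matrix (Fin N) (Fin N) ℝ} {ρ μ ε : ℝ}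
    (hb : IsBackground τ W h ρ μ ε) {r₀ : ℝ} {χ : E N → E N → ℝ} {χhat : E N → ℝ}
    (hχ : IsCutoff r₀ χ χhat ρ ε) {w : E N → ℝ → E N → ℝ}
    (hw : IsCorrector τ W h μ ε χ χhat w) :
    ∀ᶠ p in 𝓝[≠] ((0 : E N), (1 : ℝ)), auxF τ W μ ε w (0, 1) < auxF τ W μ ε w p := by
  obtain ⟨K, hK⟩ := corrector_bound hN hW hb hχ hw
  have hω := hessSum_Hfam_pos hW hne
  have hτ' := le_of_isChosenTau hN hτ
  obtain ⟨L, hL, hlead⟩ := sum_leadFactor hN τ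
  have hγ := pow_pos (gammaN_pos (N := N) (by omega)) 2
  -- The expansion is that of the explicit part divided by γ_N², so the constant of the corrector
  -- bound is divided by γ_N² as well.
  have hmin := (hasExpansion_reducedF hN hW τ).eventually_lt (K := K / gammaN N ^ 2)
    (mul_pos hω (sum_hessFactorB_pos hN hτ')) (sum_hessFactorC_pos hN hτ').le
    (polyFun_gradSum_nonneg _)
    (polyFun_apply_zero (isHomogeneous_gradSum (isSolidHarmonic_Hfam hW)) (by norm_num)) (by
      filter_upwards [Ipoly_one_lt hN hτ] with l hl
      rw [hlead, hlead]
      exact mul_lt_mul_of_pos_left (mul_lt_mul_of_pos_left hl hL) hω)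
  have h0 : auxF τ W μ ε w (0, 1) = gammaN N ^ 2 * reducedF τ W (0, 1) := by
    rw [auxF_eq hN hW τ μ ε w (p := (0, 1)) one_pos]
    simp [sum_Hbar_mul_pd_pd_bubble_zero hW τ one_pos,
      bracket_zero (by omega : 4 ≤ N) hW τ (by norm_num : (1 / 2 : ℝ) < 1) (by norm_num)]
  filter_upwards [hmin, nhdsWithin_le_nhds configSet_mem_nhds] with p hp hmem
  have hp2 : 0 < p.2 := by linarith [hmem.2.1]
  rw [h0, auxF_eq hN hW τ μ ε w hp2]
  -- The square term vanishes at (0, 1) and can only raise the value elsewhere, so it may be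
  -- dropped.
  have hsq : 0 ≤ ∫ y, (∑ i, ∑ j, Hbar τ W i j y * pd i (pd j (bubble p.1 p.2)) y) ^ 2 :=
    integral_nonneg fun _ => sq_nonneg _
  have hcor := (abs_le.1 (hK p hmem)).1
  have hscale := mul_lt_mul_of_pos_left hp hγ
  rw [mul_sub, ← mul_assoc (gammaN N ^ 2), mul_div_cancel₀ _ hγ.ne'] at hscale
  linarith

end PaneitzBlowup
end

theorem propositionp8p3 (N : ℕ) (hN : 25 ≤ N) :
    (∃ τ : ℝ, PaneitzBlowup.IsChosenTau N τ) ∧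
    ∀ τ : ℝ, PaneitzBlowup.IsChosenTau N τ →
    ∀ W : Fin N → Fin N → Fin N → Fin N → ℝ, PaneitzBlowup.IsWeylTensor W →
      (∃ i k j l, W i k j l ≠ 0) →
    ∀ (h : PaneitzBlowup.E N → Matrix (Fin N) (Fin N) ℝ) (ρ μ ε : ℝ),
      PaneitzBlowup.IsBackground τ W h ρ μ ε →
    ∀ (r₀ : ℝ) (χ : PaneitzBlowup.E N → PaneitzBlowup.E N → ℝ)
      (χhat : PaneitzBlowup.E N → ℝ), PaneitzBlowup.IsCutoff r₀ χ χhat ρ ε →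
    ∀ w : PaneitzBlowup.E N → ℝ → PaneitzBlowup.E N → ℝ,
      PaneitzBlowup.IsCorrector τ W h μ ε χ χhat w →
    ∀ᶠ p in 𝓝[≠] ((0 : PaneitzBlowup.E N), (1 : ℝ)),
      PaneitzBlowup.auxF τ W μ ε w (0, 1) < PaneitzBlowup.auxF τ W μ ε w p := by
  open PaneitzBlowup in
  exact ⟨exists_isChosenTau hN, fun _ hτ _ hW hne _ _ _ _ hb _ _ _ hχ _ hw =>
    auxF_strict_local_min hN hτ hW hne hb hχ hw⟩
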